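/- Let $m=(m_0,m_1,\dots)$ be a bounded sequence of integers $m_k\ge 2$, let $G_m=\prod_{k\ge 0}\mathbb Z/m_k\mathbb Z$ be the corresponding (bounded) Vilenkin group, with elements $x=(x_0,x_1,\dots)$, $x_k\in\{0,\dots,m_k-1\}$, and let $\mu$ be its normalized Haar measure (the product of the uniform probability measures). Put $M_0=1$, $M_{k+1}=m_kM_k$, and write every integer $n\ge 0$ as $n=\sum_k n_kM_k$ with $0\le n_k<m_k$. The Vilenkin functions are $\psi_n(x)=\prod_{k\ge 0}\exp(2\pi i\,n_kx_k/m_k)$. Let $\mathcal F_n$ be the $\sigma$-algebra generated by the sets $I_n(x)=\{y\in G_m: y_0=x_0,\dots,y_{n-1}=x_{n-1}\}$, $x\in G_m$. For a (complex-valued) martingale $f=(f^{(n)})_{n\ge 0}$ with respect to $(\mathcal F_n)_{n\ge 0}$, let $$\widehat f(i)=\lim_{k\to\infty}\int_{G_m}f^{(k)}\,\overline{\psi_i}\,d\mu,\qquad S_nf=\sum_{k=0}^{n-1}\widehat f(k)\psi_k,\qquad R_nf=\frac1{l_n}\sum_{k=1}^n\frac{S_kf}{k}\quad(n\ge 1),\qquad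 l_n=\sum_{k=1}^n\frac1k .$$ Let $\|g\|_{1/2}=\big(\int_{G_m}|g|^{1/2}d\mu\big)^{2}$, and let $H_{1/2}$ be the space of all such martingales with $\|f\|_{H_{1/2}}:=\big\|\sup_{n\ge 0}|f^{(n)}|\big\|_{1/2}<\infty$. An operator $T$ is called bounded from $H_{1/2}$ to $L_{1/2}$ if there is a finite constant $C$ such that $\|Tf\|_{1/2}\le C\|f\|_{H_{1/2}}$ for all $f\in H_{1/2}$. (a) The weighted maximal operator $f\mapsto \sup_{n\ge 1}\dfrac{|R_nf|}{\log(n+1)}$ is bounded from $H_{1/2}$ to $L_{1/2}$. (b) If $\varphi:\{1,2,3,\dots\}\to[1,\infty)$ is a nondecreasing function with $$\limsup_{n\to\infty}\frac{\log(n+1)}{\varphi(n)}=+\infty,$$ then the maximal operator $f\mapsto\sup_{n\ge 1}\dfrac{|R_nf|}{\varphi(n)}$ is not bounded from $H_{1/2}$ to $L_{1/2}$. -/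

import Mathlib

open MeasureTheory Filter ProbabilityTheory
open scoped ENNReal NNReal

namespace Vilenkin

/-- The Vilenkin group `G_m`: the direct product of the cyclic groups `ℤ/m_kℤ`, with the product
group structure and the product `σ`-algebra. -/
abbrev Gm (m : ℕ → ℕ) : Type := (k : ℕ) → ZMod (m k)

instance uniformOn_isProbability (m : ℕ) [NeZero m] :
    IsProbabilityMeasure (uniformOn (Set.univ : Set (ZMod m))) :=
  isProbabilityMeasure_uniformOn Set.finite_univ Set.univ_nonempty

/-- The normalized Haar measure of `G_m`: the product of the uniform probability measures. -/
noncomputable def haar (m : ℕ → ℕ) [∀ k, NeZero (m k)] : Measure (Gm m) :=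
  Measure.infinitePi fun k => uniformOn (Set.univ : Set (ZMod (m k)))

/-- The interval `I_n(x) = {y | y_0 = x_0, …, y_{n-1} = x_{n-1}}`. -/
def interval (m : ℕ → ℕ) (n : ℕ) (x : Gm m) : Set (Gm m) :=
  {y | ∀ j < n, y j = x j}

/-- The `σ`-algebra generated by the intervals `I_n(x)`, `x ∈ G_m`. -/
@[reducible] def intervalAlgebra (m : ℕ → ℕ) (n : ℕ) : MeasurableSpace (Gm m) :=
  MeasurableSpace.generateFrom (Set.range (interval m n))

theorem intervalAlgebra_le (m : ℕ → ℕ) (n : ℕ) :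
    intervalAlgebra m n ≤ MeasurableSpace.pi := by
  refine MeasurableSpace.generateFrom_le ?_
  rintro _ ⟨x, rfl⟩
  have h : interval m n x = ⋂ j ∈ Finset.range n, {y : Gm m | y j = x j} := by
    ext y; simp [interval]
  rw [h]
  refine Finset.measurableSet_biInter _ fun j _ => ?_
  exact (measurable_pi_apply (X := fun k => ZMod (m k)) j) (MeasurableSet.singleton (x j))

theorem intervalAlgebra_mono (m : ℕ → ℕ) [∀ k, NeZero (m k)] :
    Monotone (intervalAlgebra m) := by
  intro n k hnk
  refine MeasurableSpace.generateFrom_le ?_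
  rintro _ ⟨x, rfl⟩
  -- `I_n(x)` is the finite union of the intervals of order `k` that it contains.
  let e : ((j : Fin k) → ZMod (m j)) → Gm m := fun v j => if h : j < k then v ⟨j, h⟩ else 0
  have h : interval m n x
      = ⋃ v ∈ {v : (j : Fin k) → ZMod (m j) | e v ∈ interval m n x}, interval m k (e v) := by
    ext y
    simp only [Set.mem_iUnion, Set.mem_ofPred_eq, exists_prop]
    constructor
    · intro hy
      refine ⟨fun j => y j, fun j hj => ?_, fun j hj => ?_⟩
      · simpa [e, lt_of_lt_of_le hj hnk] using hy j hj
      · simp [e, hj]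
    · rintro ⟨v, hv, hy⟩ j hj
      rw [hy j (lt_of_lt_of_le hj hnk)]
      exact hv j hj
  rw [h]
  exact MeasurableSet.biUnion (Set.to_countable _)
    fun v _ => MeasurableSpace.measurableSet_generateFrom ⟨e v, rfl⟩

/-- The filtration of `G_m` whose `n`-th `σ`-algebra is generated by the intervals `I_n(x)`. -/
def filtration (m : ℕ → ℕ) [∀ k, NeZero (m k)] :
    Filtration ℕ (MeasurableSpace.pi : MeasurableSpace (Gm m)) where
  seq := intervalAlgebra m
  mono' := intervalAlgebra_mono m
  le' := intervalAlgebra_le m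

/-- The generalized powers `M_0 = 1`, `M_{k+1} = m_k M_k`. -/
def M (m : ℕ → ℕ) : ℕ → ℕ
  | 0 => 1
  | k + 1 => m k * M m k

/-- The digit `n_k ∈ {0, …, m_k - 1}` in the expansion `n = ∑ n_k M_k`. -/
def digit (m : ℕ → ℕ) (n k : ℕ) : ℕ := n / M m k % m k

/-- The generalized Rademacher function `r_k(x) = exp(2 π i x_k / m_k)`. -/
noncomputable def rademacher (m : ℕ → ℕ) (k : ℕ) (x : Gm m) : ℂ :=
  Complex.exp (2 * Real.pi * Complex.I * (x k).val / m k)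

/-- The Vilenkin function `ψ_n = ∏_k r_k ^ n_k`; when all `m_k ≥ 2`, only finitely many digits
`n_k` are nonzero. -/
noncomputable def psi (m : ℕ → ℕ) (n : ℕ) (x : Gm m) : ℂ :=
  ∏ᶠ k : ℕ, rademacher m k x ^ digit m n k

/-- The Vilenkin-Fourier coefficient of a martingale,
`lim_k ∫ f^{(k)} conj(ψ_i) dμ`; the sequence is eventually constant. -/
noncomputable def vilenkinCoeff (m : ℕ → ℕ) [∀ k, NeZero (m k)]
    (f : ℕ → Gm m → ℂ) (i : ℕ) : ℂ :=
  limUnder atTop fun k : ℕ => ∫ x, f k x * (starRingEnd ℂ) (psi m i x) ∂(haar m)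

/-- The partial sum `S_n f = ∑_{k < n} f̂(k) ψ_k`. -/
noncomputable def partialSum (m : ℕ → ℕ) [∀ k, NeZero (m k)] (n : ℕ)
    (f : ℕ → Gm m → ℂ) (x : Gm m) : ℂ :=
  ∑ k ∈ Finset.range n, vilenkinCoeff m f k * psi m k x

/-- The Riesz logarithmic mean `R_n f = (1 / l_n) ∑_{k=1}^n S_k f / k`,
where `l_n = ∑_{k=1}^n 1 / k`. -/
noncomputable def rieszMean (m : ℕ → ℕ) [∀ k, NeZero (m k)] (n : ℕ)
    (f : ℕ → Gm m → ℂ) (x : Gm m) : ℂ :=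
  (∑ k ∈ Finset.Icc 1 n, (1 : ℂ) / k)⁻¹ * ∑ k ∈ Finset.Icc 1 n, partialSum m k f x / k

/-- The weighted maximal operator `f ↦ sup_{n ≥ 1} |R_n f| / w(n)`, for positive weights `w`. -/
noncomputable def weightedRieszMax (m : ℕ → ℕ) [∀ k, NeZero (m k)] (w : ℕ+ → ℝ)
    (f : ℕ → Gm m → ℂ) (x : Gm m) : ℝ≥0∞ :=
  ⨆ n : ℕ+, ‖rieszMean m n f x‖ₑ / ENNReal.ofReal (w n)

/-- The maximal function `f^* = sup_n |f^{(n)}|` of a martingale. -/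
noncomputable def maximalFunction (m : ℕ → ℕ) (f : ℕ → Gm m → ℂ) (x : Gm m) : ℝ≥0∞ :=
  ⨆ n : ℕ, ‖f n x‖ₑ

/-- The quasi-norm `‖f‖_p = (∫ |f|^p dμ)^(1/p)` of a `[0, ∞]`-valued function on `G_m`. -/
noncomputable def lpQuasiNorm (m : ℕ → ℕ) [∀ k, NeZero (m k)] (p : ℝ)
    (F : Gm m → ℝ≥0∞) : ℝ≥0∞ :=
  (∫⁻ x, F x ^ p ∂(haar m)) ^ (1 / p)

/-- The Hardy quasi-norm `‖f‖_{H_p} = ‖f^*‖_p`. -/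
noncomputable def hardyNorm (m : ℕ → ℕ) [∀ k, NeZero (m k)] (p : ℝ)
    (f : ℕ → Gm m → ℂ) : ℝ≥0∞ :=
  lpQuasiNorm m p (maximalFunction m f)

/-- The martingale Hardy space `H_p(G_m)`. -/
def MemHardy (m : ℕ → ℕ) [∀ k, NeZero (m k)] (p : ℝ) (f : ℕ → Gm m → ℂ) : Prop :=
  Martingale f (filtration m) (haar m) ∧ hardyNorm m p f < ∞

/-- The operator `T` is bounded from `H_p(G_m)` to `L_p(G_m)`. -/
def IsBoundedHardyLp (m : ℕ → ℕ) [∀ k, NeZero (m k)] (p : ℝ)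
    (T : (ℕ → Gm m → ℂ) → Gm m → ℝ≥0∞) : Prop :=
  ∃ C : ℝ≥0, ∀ f : ℕ → Gm m → ℂ, MemHardy m p f → lpQuasiNorm m p (T f) ≤ C * hardyNorm m p f

end Vilenkin

/-! Part (a) is proved on atoms, i.e. functions `g` with `|g| ≤ r`, supported in one interval
`I_N(y)` and of mean zero, and then carried over to martingales.

Summation by parts expresses the kernel `∑ D_k / k` through Fejér sums `fejerSum`, and these are
majorized by explicit step functions: `spikeSum m N` when the index is `M_N` (`norm_fejerSum_M_le`),
and the sum over scales `spikeTotal m N` for every index up to `M_N` (`norm_fejerSum_le`). The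
square root of `spikeSum m N` has integral `O(1)`, while that of `spikeTotal m N` only has integral
`O(N + 1)`. Outside `I_N(y)` the sum over `k` splits into blocks of length `M_N`. The block `j = 0`
vanishes because `g` has mean zero, the `spikeSum` terms carry `∑ 1/j = O(log n)`, and the
`spikeTotal` terms carry a convergent series. Only `n ≥ M_N` matters, so `N + 1 = O(log n)`. The two
logarithms available, one from `l_n` and one from the weight, turn the second contribution into
`spikeTotal / (N + 1)^2`; under the square root this gives `(N + 1)⁻¹`, which exactly cancels the
loss `N + 1`. Hence the atomic estimate `lintegral_rpow_rieszMax_atom_le`.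

A martingale is stopped predictably at the levels `4^k r`. Differences of consecutive stopped
martingales split into atoms on intervals whose total measure is at most `b μ{f* > 4^k r}`
(`sum_haar_exit_le`). Subadditivity of the square root and a dyadic layer-cake sum then give the
bound by `∫ (f*)^{1/2}`.

For part (b) the test martingale has terminal value `ψ_{M_N}` on `I_N(0)` and Hardy quasi-norm at
most `M_N⁻²`. On `I_s(0)`, `s < N`, its mean of index `M_N + M_s` is at least a constant times `M_s²
/ (M_N² log M_{N+1})`. The square roots of these bounds contribute equally from `N` disjoint sets,
one for each `s`. Boundedness would thus force `N² ≤ C log(M_{N+1}) φ(M_{N+1})`, hence `log(n + 1) =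
O(φ(n))`. -/

namespace Vilenkin

/-! ### Generalized powers, digits and Vilenkin functions -/

theorem M_pos (m : ℕ → ℕ) [∀ k, NeZero (m k)] (k : ℕ) : 0 < M m k := by
  induction k with
  | zero => simp [M]
  | succ k ih => exact Nat.mul_pos (Nat.pos_of_ne_zero (NeZero.ne _)) ih

theorem M_dvd (m : ℕ → ℕ) {k n : ℕ} (h : k ≤ n) : M m k ∣ M m n := by
  induction n, h using Nat.le_induction with
  | base => exact dvd_rfl
  | succ n _ ih => exact ih.mul_left _

theorem M_mono (m : ℕ → ℕ) [∀ k, NeZero (m k)] : Monotone (M m) := fun _ n h =>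
  Nat.le_of_dvd (M_pos m n) (M_dvd m h)

theorem two_pow_mul_M_le (m : ℕ → ℕ) (hm : ∀ k, 2 ≤ m k) (s d : ℕ) :
    2 ^ d * M m s ≤ M m (s + d) := by
  induction d with
  | zero => simp
  | succ d ih =>
    calc 2 ^ (d + 1) * M m s = 2 * (2 ^ d * M m s) := by ring
      _ ≤ m (s + d) * M m (s + d) := Nat.mul_le_mul (hm _) ih

theorem two_pow_le_M (m : ℕ → ℕ) (hm : ∀ k, 2 ≤ m k) (k : ℕ) : 2 ^ k ≤ M m k := by
  simpa [M] using two_pow_mul_M_le m hm 0 k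

theorem lt_M (m : ℕ → ℕ) (hm : ∀ k, 2 ≤ m k) (n : ℕ) : n < M m n :=
  n.lt_two_pow_self.trans_le (two_pow_le_M m hm n)

theorem digit_eq_zero_of_lt (m : ℕ → ℕ) [∀ k, NeZero (m k)] {n k : ℕ} (h : n < M m k) :
    digit m n k = 0 := by
  simp [digit, Nat.div_eq_of_lt h]

theorem digit_mul_M_of_lt (m : ℕ → ℕ) [∀ k, NeZero (m k)] (j : ℕ) {A k : ℕ} (h : k < A) :
    digit m (j * M m A) k = 0 := by
  obtain ⟨c, hc⟩ := M_dvd m (Nat.succ_le_of_lt h)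
  rw [digit, hc]
  rw [show j * (M m (k + 1) * c) = M m k * (m k * (j * c)) by simp only [M]; ring,
    Nat.mul_div_cancel_left _ (M_pos m k), Nat.mul_mod_right]

/-- Adding `i < M m A` to a multiple of `M m A` produces no carry. This is what makes `psi_add`
multiplicative on blocks of length `M m A`. -/
theorem digit_add (m : ℕ → ℕ) [∀ k, NeZero (m k)] (j : ℕ) {A i : ℕ} (hi : i < M m A) (k : ℕ) :
    digit m (j * M m A + i) k = digit m (j * M m A) k + digit m i k := by
  rcases lt_or_ge k A with h | h
  · rw [digit_mul_M_of_lt m j h, zero_add]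
    obtain ⟨c, hc⟩ := M_dvd m (Nat.succ_le_of_lt h)
    rw [digit, digit, hc,
      show j * (M m (k + 1) * c) + i = i + M m k * (m k * (j * c)) by simp only [M]; ring,
      Nat.add_mul_div_left _ _ (M_pos m k), Nat.add_mul_mod_self_left]
  · rw [digit_eq_zero_of_lt m (hi.trans_le (M_mono m h)), add_zero, digit, digit]
    obtain ⟨c, hc⟩ := M_dvd m h
    rw [hc, ← Nat.div_div_eq_div_mul, ← Nat.div_div_eq_div_mul, Nat.add_comm,
      Nat.add_mul_div_right _ _ (M_pos m A), Nat.div_eq_of_lt hi, zero_add,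
      Nat.mul_div_cancel _ (M_pos m A)]

theorem digit_mul_M (m : ℕ → ℕ) [∀ k, NeZero (m k)] {A j : ℕ} (hj : j < m A) (k : ℕ) :
    digit m (j * M m A) k = if k = A then j else 0 := by
  split_ifs with h
  · subst h
    rw [digit, Nat.mul_div_cancel _ (M_pos m k), Nat.mod_eq_of_lt hj]
  · rcases lt_or_gt_of_ne h with h | h
    · exact digit_mul_M_of_lt m j h
    · refine digit_eq_zero_of_lt m (lt_of_lt_of_le ?_ (M_mono m (Nat.succ_le_of_lt h)))
      exact Nat.mul_lt_mul_of_pos_right hj (M_pos m A)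

theorem psi_eq_prod (m : ℕ → ℕ) [∀ k, NeZero (m k)] {n N : ℕ} (h : n < M m N) (x : Gm m) :
    psi m n x = ∏ k ∈ Finset.range N, rademacher m k x ^ digit m n k := by
  refine finprod_eq_prod_of_mulSupport_subset _ fun k hk => ?_
  by_contra hkN
  rw [Finset.mem_coe, Finset.mem_range, not_lt] at hkN
  refine hk ?_
  simp only
  rw [digit_eq_zero_of_lt m (h.trans_le (M_mono m hkN)), pow_zero]

theorem psi_add (m : ℕ → ℕ) [∀ k, NeZero (m k)] (hm : ∀ k, 2 ≤ m k) (j : ℕ) {A i : ℕ}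
    (hi : i < M m A) (x : Gm m) :
    psi m (j * M m A + i) x = psi m (j * M m A) x * psi m i x := by
  have h := lt_M m hm (j * M m A + i)
  rw [psi_eq_prod m h, psi_eq_prod m (lt_of_le_of_lt (Nat.le_add_right _ _) h),
    psi_eq_prod m (lt_of_le_of_lt (Nat.le_add_left _ _) h), ← Finset.prod_mul_distrib]
  simp_rw [digit_add m j hi, pow_add]

theorem psi_mul_M (m : ℕ → ℕ) [∀ k, NeZero (m k)] {A j : ℕ} (hj : j < m A) (x : Gm m) :
    psi m (j * M m A) x = rademacher m A x ^ j := by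
  unfold psi
  simp_rw [digit_mul_M m hj]
  rw [finprod_eq_single _ A fun k hk => by simp [hk]]
  simp

theorem psi_zero (m : ℕ → ℕ) [∀ k, NeZero (m k)] (x : Gm m) : psi m 0 x = 1 := by
  simpa [M] using psi_eq_prod m (n := 0) (N := 0) (by simp [M]) x

theorem rademacher_eq (m : ℕ → ℕ) [∀ k, NeZero (m k)] (k : ℕ) (x : Gm m) :
    rademacher m k x = ZMod.toCircle (x k) := by
  rw [rademacher, ZMod.toCircle_apply]

theorem norm_rademacher (m : ℕ → ℕ) [∀ k, NeZero (m k)] (k : ℕ) (x : Gm m) :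
    ‖rademacher m k x‖ = 1 := by
  rw [rademacher_eq, Circle.norm_coe]

theorem rademacher_sub (m : ℕ → ℕ) [∀ k, NeZero (m k)] (k : ℕ) (x t : Gm m) :
    rademacher m k (x - t) = rademacher m k x * (starRingEnd ℂ) (rademacher m k t) := by
  rw [rademacher_eq, rademacher_eq, rademacher_eq, Pi.sub_apply, sub_eq_add_neg,
    AddChar.map_add_eq_mul, AddChar.map_neg_eq_inv, Circle.coe_mul, Circle.coe_inv_eq_conj]

theorem psi_sub (m : ℕ → ℕ) [∀ k, NeZero (m k)] (hm : ∀ k, 2 ≤ m k) (n : ℕ) (x t : Gm m) :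
    psi m n (x - t) = psi m n x * (starRingEnd ℂ) (psi m n t) := by
  have h := lt_M m hm n
  rw [psi_eq_prod m h, psi_eq_prod m h, psi_eq_prod m h, map_prod, ← Finset.prod_mul_distrib]
  simp_rw [rademacher_sub, mul_pow, map_pow]

theorem norm_psi (m : ℕ → ℕ) [∀ k, NeZero (m k)] (hm : ∀ k, 2 ≤ m k) (n : ℕ) (x : Gm m) :
    ‖psi m n x‖ = 1 := by
  rw [psi_eq_prod m (lt_M m hm n), norm_prod]
  simp [norm_rademacher]

theorem psi_congr (m : ℕ → ℕ) [∀ k, NeZero (m k)] {n N : ℕ} (h : n < M m N) {x y : Gm m}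
    (hy : y ∈ interval m N x) : psi m n y = psi m n x := by
  rw [psi_eq_prod m h, psi_eq_prod m h]
  refine Finset.prod_congr rfl fun k hk => ?_
  rw [rademacher, rademacher, hy k (Finset.mem_range.1 hk)]

theorem sum_rademacher_pow (m : ℕ → ℕ) [∀ k, NeZero (m k)] (A : ℕ) (x : Gm m) :
    ∑ j ∈ Finset.range (m A), rademacher m A x ^ j = if x A = 0 then (m A : ℂ) else 0 := by
  split_ifs with h
  · simp [rademacher_eq, h]
  · have h1 : rademacher m A x ≠ 1 := by
      rw [rademacher_eq, ne_eq, Circle.coe_eq_one]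
      intro h'
      exact h (ZMod.injective_toCircle (h'.trans (AddChar.map_zero_eq_one _).symm))
    rw [geom_sum_eq h1, rademacher_eq, ← Circle.coe_pow, ← AddChar.map_nsmul_eq_pow]
    simp

/-! ### Dirichlet and Fejér kernels and their pointwise majorants -/

/-- The Dirichlet kernel. -/
noncomputable def dirichlet (m : ℕ → ℕ) (n : ℕ) (x : Gm m) : ℂ :=
  ∑ k ∈ Finset.range n, psi m k x

/-- `n` times the `n`-th Fejér kernel. -/
noncomputable def fejerSum (m : ℕ → ℕ) (n : ℕ) (x : Gm m) : ℂ :=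
  ∑ k ∈ Finset.range (n + 1), dirichlet m k x

section kernels
variable (m : ℕ → ℕ)

theorem dirichlet_zero (x : Gm m) : dirichlet m 0 x = 0 := by simp [dirichlet]

theorem fejerSum_zero (x : Gm m) : fejerSum m 0 x = 0 := by simp [fejerSum, dirichlet_zero]

theorem fejerSum_succ (n : ℕ) (x : Gm m) :
    fejerSum m (n + 1) x = fejerSum m n x + dirichlet m (n + 1) x := by
  rw [fejerSum, Finset.sum_range_succ, fejerSum]

/-- The points whose coordinates of index less than `A` vanish, except possibly the one of
index `s`. -/
def spike (s A : ℕ) : Set (Gm m) := {x | ∀ j < A, j ≠ s → x j = 0}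

/-- The pointwise majorant of `fejerSum m (M m A)`, up to a constant. -/
noncomputable def spikeSum (A : ℕ) (x : Gm m) : ℝ :=
  ∑ s ∈ Finset.range (A + 1), (spike m s A).indicator (fun _ => (M m s * M m A : ℝ)) x

/-- The pointwise majorant of `fejerSum m n` for `n ≤ M m N`, up to a constant. -/
noncomputable def spikeTotal (N : ℕ) (x : Gm m) : ℝ :=
  ∑ A ∈ Finset.range (N + 1), spikeSum m A x

theorem spikeSum_nonneg (A : ℕ) (x : Gm m) : 0 ≤ spikeSum m A x :=
  Finset.sum_nonneg fun _ _ => Set.indicator_nonneg (fun _ _ => by positivity) _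

theorem spikeTotal_nonneg (A : ℕ) (x : Gm m) : 0 ≤ spikeTotal m A x :=
  Finset.sum_nonneg fun _ _ => spikeSum_nonneg m _ _

theorem spikeSum_le_spikeTotal (N : ℕ) (x : Gm m) : spikeSum m N x ≤ spikeTotal m N x :=
  Finset.single_le_sum (f := fun A => spikeSum m A x) (fun _ _ => spikeSum_nonneg m _ _)
    (Finset.mem_range.2 (Nat.lt_succ_self N))

theorem indicator_sq_le_spikeSum (A : ℕ) (x : Gm m) :
    (interval m A 0).indicator (fun _ => (M m A : ℝ) ^ 2) x ≤ spikeSum m A x := by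
  refine le_trans ?_ (Finset.single_le_sum
    (f := fun s => (spike m s A).indicator (fun _ => (M m s * M m A : ℝ)) x)
    (fun _ _ => Set.indicator_nonneg (fun _ _ => by positivity) _)
    (Finset.mem_range.2 (Nat.lt_succ_self A)))
  have hsub : interval m A 0 ⊆ spike m A A := fun y hy j hj _ => hy j hj
  rw [pow_two]
  exact Set.indicator_le_indicator_of_subset hsub (fun _ => by positivity) x

variable [∀ k, NeZero (m k)]

theorem dirichlet_add (hm : ∀ k, 2 ≤ m k) (j : ℕ) {A i : ℕ} (hi : i ≤ M m A) (x : Gm m) :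
    dirichlet m (j * M m A + i) x
      = dirichlet m (j * M m A) x + psi m (j * M m A) x * dirichlet m i x := by
  rw [dirichlet, Finset.sum_range_add, dirichlet, dirichlet, Finset.mul_sum]
  congr 1
  refine Finset.sum_congr rfl fun k hk => ?_
  exact psi_add m hm j ((Finset.mem_range.1 hk).trans_le hi) x

theorem dirichlet_mul_M (hm : ∀ k, 2 ≤ m k) (j A : ℕ) (x : Gm m) :
    dirichlet m (j * M m A) x
      = (∑ l ∈ Finset.range j, psi m (l * M m A) x) * dirichlet m (M m A) x := by
  induction j with
  | zero => simp [dirichlet_zero]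
  | succ j ih =>
    rw [add_mul, one_mul, dirichlet_add m hm j le_rfl, ih, Finset.sum_range_succ, add_mul]

/-- Each step multiplies the kernel by the geometric sum of the powers of `r_A`, which is `m_A`
where `x_A = 0` and zero elsewhere. -/
theorem dirichlet_M (hm : ∀ k, 2 ≤ m k) (A : ℕ) (x : Gm m) :
    dirichlet m (M m A) x = (interval m A 0).indicator (fun _ => (M m A : ℂ)) x := by
  classical
  induction A with
  | zero => simp [M, interval, dirichlet, psi_zero]
  | succ A ih =>
    have hsum : ∑ l ∈ Finset.range (m A), psi m (l * M m A) x
        = if x A = 0 then (m A : ℂ) else 0 := by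
      rw [← sum_rademacher_pow]
      exact Finset.sum_congr rfl fun l hl => psi_mul_M m (Finset.mem_range.1 hl) x
    rw [M, dirichlet_mul_M m hm, ih, hsum]
    have hiff : x ∈ interval m (A + 1) 0 ↔ x A = 0 ∧ x ∈ interval m A 0 := by
      constructor
      · exact fun h => ⟨h A (Nat.lt_succ_self A), fun j hj => h j (hj.trans (Nat.lt_succ_self A))⟩
      · rintro ⟨h1, h2⟩ j hj
        rcases Nat.lt_succ_iff_lt_or_eq.1 hj with h | rfl
        · exact h2 j h
        · exact h1
    by_cases h1 : x A = 0 <;> by_cases h2 : x ∈ interval m A 0 <;>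
      simp [Set.indicator, hiff, h1, h2]

theorem norm_dirichlet_mul_M_le (hm : ∀ k, 2 ≤ m k) (j A : ℕ) (x : Gm m) :
    ‖dirichlet m (j * M m A) x‖ ≤ j * (interval m A 0).indicator (fun _ => (M m A : ℝ)) x := by
  rw [dirichlet_mul_M m hm, norm_mul]
  refine mul_le_mul ?_ (le_of_eq ?_) (norm_nonneg _) (Nat.cast_nonneg _)
  · refine (norm_sum_le _ _).trans (le_of_eq ?_)
    simp [norm_psi m hm]
  · rw [dirichlet_M m hm, norm_indicator_eq_indicator_norm]
    simp

theorem fejerSum_add (hm : ∀ k, 2 ≤ m k) (j : ℕ) {A i : ℕ} (hi : i ≤ M m A) (x : Gm m) :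
    fejerSum m (j * M m A + i) x = fejerSum m (j * M m A) x
      + i * dirichlet m (j * M m A) x + psi m (j * M m A) x * fejerSum m i x := by
  induction i with
  | zero => simp [fejerSum_zero]
  | succ i ih =>
    rw [← add_assoc, fejerSum_succ, ih (by omega), fejerSum_succ, add_assoc (j * M m A),
      dirichlet_add m hm j hi]
    push_cast
    ring

theorem fejerSum_mul_M (hm : ∀ k, 2 ≤ m k) (j A : ℕ) (x : Gm m) :
    fejerSum m (j * M m A) x = (∑ l ∈ Finset.range j, (M m A : ℂ) * dirichlet m (l * M m A) x)
      + (∑ l ∈ Finset.range j, psi m (l * M m A) x) * fejerSum m (M m A) x := by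
  induction j with
  | zero => simp [fejerSum_zero]
  | succ j ih =>
    rw [add_mul, one_mul, fejerSum_add m hm j le_rfl, ih, Finset.sum_range_succ,
      Finset.sum_range_succ]
    ring

/-- This is the recursion that the majorant needs to follow `fejerSum_mul_M` at `j = m A`. Imposing
`x_A = 0` on a spike of order `A` gives a spike of order `A + 1`, and the factor `m_A` turns `M_A`
into `M_{A+1}`. The interval term is absorbed by the new spike at index `A`, and the old term `s =
A` passes into `s = A + 1`. -/
theorem mul_indicator_spikeSum_le (A : ℕ) (x : Gm m) :
    (m A : ℝ) * {y : Gm m | y A = 0}.indicator (spikeSum m A) x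
      + (interval m A 0).indicator (fun _ => (M m A : ℝ) ^ 2) x ≤ spikeSum m (A + 1) x := by
  classical
  have hmA : (1 : ℝ) ≤ m A := by exact_mod_cast Nat.one_le_iff_ne_zero.2 (NeZero.ne (m A))
  have hM : (0 : ℝ) ≤ M m A := Nat.cast_nonneg _
  have hM' : (M m (A + 1) : ℝ) = m A * M m A := by simp [M]
  have hlow : ∀ s ∈ Finset.range A,
      (m A : ℝ) * {y : Gm m | y A = 0}.indicator
          (fun x => (spike m s A).indicator (fun _ => (M m s * M m A : ℝ)) x) x
        ≤ (spike m s (A + 1)).indicator (fun _ => (M m s * M m (A + 1) : ℝ)) x := by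
    intro s hs
    by_cases h : x A = 0 ∧ x ∈ spike m s A
    · have : x ∈ spike m s (A + 1) := fun j hj hjs => by
        rcases Nat.lt_succ_iff_lt_or_eq.1 hj with h' | rfl
        · exact h.2 j h' hjs
        · exact h.1
      rw [Set.indicator_of_mem this, Set.indicator_of_mem (show x ∈ {y : Gm m | y A = 0} from h.1),
        Set.indicator_of_mem h.2, hM']
      exact le_of_eq (by ring)
    · have : (m A : ℝ) * {y : Gm m | y A = 0}.indicator
          (fun x => (spike m s A).indicator (fun _ => (M m s * M m A : ℝ)) x) x = 0 := by
        simp only [Set.indicator, Set.mem_ofPred_eq]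
        split_ifs with h1 h2
        · exact absurd ⟨h1, h2⟩ h
        · simp
        · simp
      rw [this]
      exact Set.indicator_nonneg (fun _ _ => by positivity) _
  have hA : (interval m A 0).indicator (fun _ => (M m A : ℝ) ^ 2) x
      ≤ (spike m A (A + 1)).indicator (fun _ => (M m A * M m (A + 1) : ℝ)) x := by
    by_cases h : x ∈ interval m A 0
    · have : x ∈ spike m A (A + 1) := fun j hj hjs => h j (by omega)
      rw [Set.indicator_of_mem this, Set.indicator_of_mem h, hM']
      nlinarith [mul_nonneg hM hM]
    · rw [Set.indicator_of_notMem h]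
      exact Set.indicator_nonneg (fun _ _ => by positivity) _
  have hA1 : (m A : ℝ) * {y : Gm m | y A = 0}.indicator
        (fun x => (spike m A A).indicator (fun _ => (M m A * M m A : ℝ)) x) x
      ≤ (spike m (A + 1) (A + 1)).indicator (fun _ => (M m (A + 1) * M m (A + 1) : ℝ)) x := by
    by_cases h : x A = 0 ∧ x ∈ spike m A A
    · have : x ∈ spike m (A + 1) (A + 1) := fun j hj _ => by
        rcases Nat.lt_succ_iff_lt_or_eq.1 hj with h' | rfl
        · exact h.2 j h' h'.ne
        · exact h.1
      rw [Set.indicator_of_mem this, Set.indicator_of_mem (show x ∈ {y : Gm m | y A = 0} from h.1),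
        Set.indicator_of_mem h.2, hM']
      have := mul_nonneg hM hM
      nlinarith [mul_nonneg this (by linarith : (0 : ℝ) ≤ m A)]
    · have : (m A : ℝ) * {y : Gm m | y A = 0}.indicator
          (fun x => (spike m A A).indicator (fun _ => (M m A * M m A : ℝ)) x) x = 0 := by
        simp only [Set.indicator, Set.mem_ofPred_eq]
        split_ifs with h1 h2
        · exact absurd ⟨h1, h2⟩ h
        · simp
        · simp
      rw [this]
      exact Set.indicator_nonneg (fun _ _ => by positivity) _
  have hexp : (m A : ℝ) * {y : Gm m | y A = 0}.indicator (spikeSum m A) x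
      = (∑ s ∈ Finset.range A, (m A : ℝ) * {y : Gm m | y A = 0}.indicator
          (fun x => (spike m s A).indicator (fun _ => (M m s * M m A : ℝ)) x) x)
        + (m A : ℝ) * {y : Gm m | y A = 0}.indicator
        (fun x => (spike m A A).indicator (fun _ => (M m A * M m A : ℝ)) x) x := by
    rw [← Finset.sum_range_succ (fun s => (m A : ℝ) * {y : Gm m | y A = 0}.indicator
          (fun x => (spike m s A).indicator (fun _ => (M m s * M m A : ℝ)) x) x), ← Finset.mul_sum]
    congr 1
    by_cases h : x A = 0
    · simp [spikeSum, Set.indicator, h]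
    · simp [Set.indicator, h]
  rw [hexp, spikeSum, Finset.sum_range_succ, Finset.sum_range_succ]
  have := Finset.sum_le_sum hlow
  linarith

variable {m}

theorem norm_fejerSum_mul_M_le (hm : ∀ k, 2 ≤ m k) {j A : ℕ} (hj : j ≤ m A) (x : Gm m) :
    ‖fejerSum m (j * M m A) x‖
      ≤ (m A : ℝ) ^ 2 * (interval m A 0).indicator (fun _ => (M m A : ℝ) ^ 2) x
        + ‖∑ l ∈ Finset.range j, psi m (l * M m A) x‖ * ‖fejerSum m (M m A) x‖ := by
  rw [fejerSum_mul_M m hm]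
  refine (norm_add_le _ _).trans (add_le_add ?_ (norm_mul_le _ _))
  refine (norm_sum_le _ _).trans ?_
  have hjr : (j : ℝ) ≤ m A := by exact_mod_cast hj
  have key : ∀ l ∈ Finset.range j, ‖(M m A : ℂ) * dirichlet m (l * M m A) x‖
      ≤ (m A : ℝ) * (interval m A 0).indicator (fun _ => (M m A : ℝ) ^ 2) x := by
    intro l hl
    have hl' : (l : ℝ) ≤ m A := by exact_mod_cast (Finset.mem_range.1 hl).le.trans hj
    rw [norm_mul, Complex.norm_natCast]
    refine (mul_le_mul_of_nonneg_left (norm_dirichlet_mul_M_le m hm l A x)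
      (Nat.cast_nonneg _)).trans ?_
    by_cases h : x ∈ interval m A 0
    · rw [Set.indicator_of_mem h, Set.indicator_of_mem h]
      nlinarith [mul_nonneg (sq_nonneg (M m A : ℝ)) (sub_nonneg.2 hl')]
    · simp [Set.indicator_of_notMem h]
  refine (Finset.sum_le_sum key).trans ?_
  rw [Finset.sum_const, Finset.card_range, nsmul_eq_mul, pow_two (m A : ℝ), ← mul_assoc]
  have h0 : 0 ≤ (interval m A 0).indicator (fun _ => (M m A : ℝ) ^ 2) x :=
    Set.indicator_nonneg (fun _ _ => by positivity) _
  gcongr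

/-- For `j = m A` the character sum in front of the previous Fejér sum vanishes unless `x_A = 0`.
The earlier scales therefore do not accumulate, and one `spikeSum` suffices instead of a sum over
scales. -/
theorem norm_fejerSum_M_le (hm : ∀ k, 2 ≤ m k) {b : ℕ} (hb : ∀ k, m k ≤ b) (A : ℕ) (x : Gm m) :
    ‖fejerSum m (M m A) x‖ ≤ (b : ℝ) ^ 2 * spikeSum m A x := by
  classical
  induction A with
  | zero =>
    have hb1 : (1 : ℝ) ≤ b := by exact_mod_cast (by linarith [hm 0, hb 0] : 1 ≤ b)
    have : spikeSum m 0 x = 1 := by simp [spikeSum, spike, M]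
    rw [this]
    simp only [fejerSum, M, dirichlet, Finset.sum_range_succ, Finset.range_zero, Finset.sum_empty,
      zero_add, norm_psi m hm]
    nlinarith
  | succ A ih =>
    have hbA : (m A : ℝ) ≤ b := by exact_mod_cast hb A
    have h1 := norm_fejerSum_mul_M_le hm (le_refl (m A)) x
    have hsum : ∑ l ∈ Finset.range (m A), psi m (l * M m A) x
        = if x A = 0 then (m A : ℂ) else 0 := by
      rw [← sum_rademacher_pow]
      exact Finset.sum_congr rfl fun l hl => psi_mul_M m (Finset.mem_range.1 hl) x
    have h0 : 0 ≤ (interval m A 0).indicator (fun _ => (M m A : ℝ) ^ 2) x :=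
      Set.indicator_nonneg (fun _ _ => by positivity) _
    have h2 : ‖∑ l ∈ Finset.range (m A), psi m (l * M m A) x‖ * ‖fejerSum m (M m A) x‖
        ≤ (b : ℝ) ^ 2 * ((m A : ℝ) * {y : Gm m | y A = 0}.indicator (spikeSum m A) x) := by
      rw [hsum]
      by_cases h : x A = 0
      · simp only [h, if_true, Complex.norm_natCast, Set.indicator, Set.mem_ofPred_eq]
        calc (m A : ℝ) * ‖fejerSum m (M m A) x‖ ≤ m A * (b ^ 2 * spikeSum m A x) := by gcongr
          _ = _ := by ring
      · simp [h, Set.indicator]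
    calc ‖fejerSum m (M m (A + 1)) x‖ ≤ _ := h1
      _ ≤ (b : ℝ) ^ 2 * (interval m A 0).indicator (fun _ => (M m A : ℝ) ^ 2) x
          + (b : ℝ) ^ 2 * ((m A : ℝ) * {y : Gm m | y A = 0}.indicator (spikeSum m A) x) := by
        refine add_le_add ?_ h2
        gcongr
      _ = (b : ℝ) ^ 2 * ((m A : ℝ) * {y : Gm m | y A = 0}.indicator (spikeSum m A) x
          + (interval m A 0).indicator (fun _ => (M m A : ℝ) ^ 2) x) := by ring
      _ ≤ _ := by
        gcongr
        exact mul_indicator_spikeSum_le m A x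

/-- Write `n = j M_A + i` with `j` the leading digit. The first two terms of `fejerSum_add` live at
scale `A`; the third has the modulus of the Fejér sum of index `i < M_A`, to which induction
applies. Since `j` may be smaller than `m_A`, the character sum need not vanish off `x_A = 0`, and
the scales add up. -/
theorem norm_fejerSum_le_sum (hm : ∀ k, 2 ≤ m k) {b : ℕ} (hb : ∀ k, m k ≤ b) {N n : ℕ}
    (hn : n < M m N) (x : Gm m) :
    ‖fejerSum m n x‖ ≤ (3 * b ^ 3 : ℝ) * ∑ A ∈ Finset.range N, spikeSum m A x := by
  have hb1 : (1 : ℝ) ≤ b := by exact_mod_cast (by linarith [hm 0, hb 0] : 1 ≤ b)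
  induction N generalizing n with
  | zero =>
    obtain rfl : n = 0 := by simpa [M] using hn
    simp [fejerSum_zero]
  | succ A ih =>
    set j := n / M m A with hj
    set i := n % M m A with hi
    have hnj : n = j * M m A + i := (Nat.div_add_mod' n (M m A)).symm
    have hiM : i < M m A := Nat.mod_lt _ (M_pos m A)
    have hjm : j ≤ m A := by
      rw [hj]; exact Nat.div_le_of_le_mul (by rw [mul_comm]; exact hn.le)
    have hbA : (m A : ℝ) ≤ b := by exact_mod_cast hb A
    have hjb : (j : ℝ) ≤ b := le_trans (by exact_mod_cast hjm) hbA
    have hiM' : (i : ℝ) ≤ M m A := by exact_mod_cast hiM.le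
    set S := spikeSum m A x
    set I := (interval m A 0).indicator (fun _ => (M m A : ℝ) ^ 2) x with hI
    have hIS : I ≤ S := indicator_sq_le_spikeSum m A x
    have hI0 : 0 ≤ I := Set.indicator_nonneg (fun _ _ => by positivity) _
    have hS0 : 0 ≤ S := spikeSum_nonneg m A x
    have e1 : ‖fejerSum m (j * M m A) x‖ ≤ b ^ 2 * S + b * (b ^ 2 * S) := by
      refine (norm_fejerSum_mul_M_le hm hjm x).trans (add_le_add ?_ ?_)
      · gcongr
      · refine mul_le_mul ?_ (norm_fejerSum_M_le hm hb A x) (norm_nonneg _) (by positivity)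
        refine (norm_sum_le _ _).trans ?_
        simpa [norm_psi m hm] using hjb
    have e2 : ‖(i : ℂ) * dirichlet m (j * M m A) x‖ ≤ b * S := by
      rw [norm_mul, Complex.norm_natCast]
      refine le_trans ?_ (mul_le_mul_of_nonneg_left hIS (by positivity))
      refine (mul_le_mul hiM' (norm_dirichlet_mul_M_le m hm j A x) (norm_nonneg _)
        (by positivity)).trans ?_
      by_cases h : x ∈ interval m A 0
      · rw [hI, Set.indicator_of_mem h, Set.indicator_of_mem h]
        nlinarith [mul_nonneg (sq_nonneg (M m A : ℝ)) (sub_nonneg.2 hjb)]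
      · simp [hI, Set.indicator_of_notMem h]
    have e3 := ih hiM
    have hb2 : (b : ℝ) ^ 2 ≤ b ^ 3 := pow_le_pow_right₀ hb1 (by norm_num)
    have hb3 : (b : ℝ) ≤ b ^ 3 := by simpa using pow_le_pow_right₀ hb1 (show 1 ≤ 3 by norm_num)
    rw [hnj, fejerSum_add m hm j hiM.le]
    refine (norm_add₃_le).trans ?_
    rw [norm_mul (psi m _ x), norm_psi m hm, one_mul]
    rw [Finset.sum_range_succ]
    calc _ ≤ b ^ 2 * S + b * (b ^ 2 * S) + b * S
          + 3 * b ^ 3 * ∑ A ∈ Finset.range A, spikeSum m A x := by gcongr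
      _ ≤ _ := by nlinarith

theorem norm_fejerSum_le (hm : ∀ k, 2 ≤ m k) {b : ℕ} (hb : ∀ k, m k ≤ b) {N n : ℕ}
    (hn : n ≤ M m N) (x : Gm m) :
    ‖fejerSum m n x‖ ≤ (3 * b ^ 3 : ℝ) * spikeTotal m N x := by
  have hb1 : (1 : ℝ) ≤ b := by exact_mod_cast (by linarith [hm 0, hb 0] : 1 ≤ b)
  have hS0 := spikeSum_nonneg m N x
  rcases hn.lt_or_eq with h | rfl
  · refine (norm_fejerSum_le_sum hm hb h x).trans ?_
    rw [spikeTotal, Finset.sum_range_succ]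
    gcongr
    linarith
  · refine (norm_fejerSum_M_le hm hb N x).trans ?_
    have hb2 : (b : ℝ) ^ 2 ≤ b ^ 3 := pow_le_pow_right₀ hb1 (by norm_num)
    refine mul_le_mul (by nlinarith [sq_nonneg (b : ℝ)]) (spikeSum_le_spikeTotal m N x) hS0
      (by positivity)

end kernels

/-! ### Intervals and functions of finitely many coordinates -/

theorem mem_interval_self (m : ℕ → ℕ) (n : ℕ) (x : Gm m) : x ∈ interval m n x := fun _ _ => rfl

theorem mem_interval_comm {m : ℕ → ℕ} {n : ℕ} {x y : Gm m} :
    y ∈ interval m n x ↔ x ∈ interval m n y :=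
  ⟨fun h j hj => (h j hj).symm, fun h j hj => (h j hj).symm⟩

theorem interval_anti (m : ℕ → ℕ) (x : Gm m) {n k : ℕ} (h : n ≤ k) :
    interval m k x ⊆ interval m n x := fun _ hy j hj => hy j (hj.trans_le h)

theorem interval_eq_of_mem {m : ℕ → ℕ} {n : ℕ} {x y : Gm m} (h : y ∈ interval m n x) :
    interval m n y = interval m n x := by
  ext z
  exact ⟨fun hz j hj => (hz j hj).trans (h j hj), fun hz j hj => (hz j hj).trans (h j hj).symm⟩

theorem measurableSet_interval (m : ℕ → ℕ) (n : ℕ) (x : Gm m) :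
    MeasurableSet (interval m n x) :=
  intervalAlgebra_le m n _ (MeasurableSpace.measurableSet_generateFrom ⟨x, rfl⟩)

/-- The function `g` depends only on the first `n` coordinates. -/
def DependsOnFirst (m : ℕ → ℕ) {α : Type*} (n : ℕ) (g : Gm m → α) : Prop :=
  ∀ x, ∀ y ∈ interval m n x, g y = g x

namespace DependsOnFirst
variable {m : ℕ → ℕ} {α β : Type*} {n k : ℕ}

theorem mono {g : Gm m → α} (hg : DependsOnFirst m n g) (h : n ≤ k) : DependsOnFirst m k g :=
  fun x _ hy => hg x _ (interval_anti m x h hy)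

theorem comp {g : Gm m → α} (hg : DependsOnFirst m n g) (φ : α → β) :
    DependsOnFirst m n fun x => φ (g x) := fun x y hy => congrArg φ (hg x y hy)

theorem comp₂ {γ : Type*} {g : Gm m → α} {h : Gm m → β} (hg : DependsOnFirst m n g)
    (hh : DependsOnFirst m n h) (φ : α → β → γ) : DependsOnFirst m n fun x => φ (g x) (h x) :=
  fun x y hy => congrArg₂ φ (hg x y hy) (hh x y hy)

theorem sum {ι : Type*} [AddCommMonoid α] {s : Finset ι} {g : ι → Gm m → α}
    (hg : ∀ i ∈ s, DependsOnFirst m n (g i)) : DependsOnFirst m n fun x => ∑ i ∈ s, g i x :=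
  fun x y hy => Finset.sum_congr rfl fun i hi => hg i hi x y hy

theorem indicator [Zero α] {S : Set (Gm m)} {g : Gm m → α} (hS : DependsOnFirst m n (· ∈ S))
    (hg : DependsOnFirst m n g) : DependsOnFirst m n (S.indicator g) := by
  classical
  intro x y hy
  have h1 : (y ∈ S) = (x ∈ S) := hS x y hy
  simp only [Set.indicator, h1, hg x y hy]

end DependsOnFirst

theorem dependsOnFirst_interval (m : ℕ → ℕ) (n : ℕ) (x : Gm m) :
    DependsOnFirst m n (· ∈ interval m n x) := by
  intro y z hz
  simp only [eq_iff_iff]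
  rw [mem_interval_comm (x := x), mem_interval_comm (x := x), interval_eq_of_mem hz]

theorem dependsOnFirst_of_measurableSet {m : ℕ → ℕ} {n : ℕ} {S : Set (Gm m)}
    (hS : MeasurableSet[intervalAlgebra m n] S) : DependsOnFirst m n (· ∈ S) := by
  induction S, hS using MeasurableSpace.generateFrom_induction with
  | hC t ht _ =>
    obtain ⟨x, rfl⟩ := ht
    exact dependsOnFirst_interval m n x
  | empty => exact fun _ _ _ => rfl
  | compl t _ ih => exact fun x y hy => congrArg Not (ih x y hy)
  | iUnion f _ ih =>
    intro x y hy
    simp only [Set.mem_iUnion, eq_iff_iff]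
    exact exists_congr fun i => iff_of_eq (ih i x y hy)

/-- Together with `DependsOnFirst.measurable'` this replaces measurability with respect to the
`n`-th σ-algebra by constancy on intervals of order `n`, the only form used in the estimates. -/
theorem dependsOnFirst_of_measurable {m : ℕ → ℕ} {n : ℕ} {α : Type*} [MeasurableSpace α]
    [MeasurableSingletonClass α] {g : Gm m → α} (hg : Measurable[intervalAlgebra m n] g) :
    DependsOnFirst m n g := by
  intro x y hy
  have h := dependsOnFirst_of_measurableSet (hg (measurableSet_singleton (g x))) x y hy
  have h' : (g y = g x) = (g x = g x) := h
  exact h'.mpr rfl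

/-- The finitely many intervals of order `n`. -/
abbrev Prefix (m : ℕ → ℕ) (n : ℕ) : Type := (j : Fin n) → ZMod (m j)

/-- The extension of a prefix by zeros. -/
def extend (m : ℕ → ℕ) (n : ℕ) (v : Prefix m n) : Gm m :=
  fun j => if h : j < n then v ⟨j, h⟩ else 0

theorem mem_interval_extend {m : ℕ → ℕ} {n : ℕ} {v : Prefix m n} {x : Gm m} :
    x ∈ interval m n (extend m n v) ↔ (fun j : Fin n => x j) = v := by
  constructor
  · intro h
    ext j
    have := h j j.2
    simpa [extend] using this
  · rintro rfl j hj
    simp [extend, hj]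

theorem self_mem_interval_extend {m : ℕ → ℕ} {n : ℕ} (x : Gm m) :
    x ∈ interval m n (extend m n fun j => x j) := mem_interval_extend.2 rfl

theorem M_eq_prod (m : ℕ → ℕ) (n : ℕ) : M m n = ∏ j ∈ Finset.range n, m j := by
  induction n with
  | zero => simp [M]
  | succ n ih => rw [M, Finset.prod_range_succ, ih, mul_comm]

/-! ### Haar measure and integrals of the majorants -/

section
variable {m : ℕ → ℕ}

theorem neg_mem_spike {s A : ℕ} {x : Gm m} : -x ∈ spike m s A ↔ x ∈ spike m s A :=
  forall_congr' fun _ => forall_congr' fun _ => forall_congr' fun _ => neg_eq_zero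

theorem sum_M_le (hm : ∀ k, 2 ≤ m k) (N : ℕ) : ∑ s ∈ Finset.range (N + 1), M m s ≤ 2 * M m N := by
  induction N with
  | zero => simp [M]
  | succ N ih =>
    rw [Finset.sum_range_succ]
    have : 2 * M m N ≤ M m (N + 1) := by simpa using two_pow_mul_M_le m hm N 1
    omega

theorem spikeSum_neg (A : ℕ) (x : Gm m) : spikeSum m A (-x) = spikeSum m A x := by
  classical
  unfold spikeSum
  simp only [Set.indicator, neg_mem_spike]

theorem spikeTotal_neg (A : ℕ) (x : Gm m) : spikeTotal m A (-x) = spikeTotal m A x := by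
  simp only [spikeTotal, spikeSum_neg]

theorem ofReal_spikeSum (A : ℕ) (x : Gm m) : ENNReal.ofReal (spikeSum m A x)
    = ∑ s ∈ Finset.range (A + 1),
      (spike m s A).indicator (fun _ => (M m s * M m A : ℝ≥0∞)) x := by
  classical
  rw [spikeSum, ENNReal.ofReal_sum_of_nonneg
    fun _ _ => Set.indicator_nonneg (fun _ _ => by positivity) _]
  refine Finset.sum_congr rfl fun s _ => ?_
  simp only [Set.indicator]
  split_ifs
  · rw [ENNReal.ofReal_mul (Nat.cast_nonneg _), ENNReal.ofReal_natCast, ENNReal.ofReal_natCast]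
  · simp

end

section finite
variable {m : ℕ → ℕ} [∀ k, NeZero (m k)]

/-- Such a function takes finitely many values, one on each interval of order `n`, so every preimage
is a finite union of intervals. -/
theorem DependsOnFirst.measurable' {α : Type*} [MeasurableSpace α] {n : ℕ} {g : Gm m → α}
    (hg : DependsOnFirst m n g) : Measurable[intervalAlgebra m n] g := by
  intro T _
  have : g ⁻¹' T = ⋃ v ∈ {v : Prefix m n | g (extend m n v) ∈ T},
      interval m n (extend m n v) := by
    ext x
    simp only [Set.mem_preimage, Set.mem_iUnion, Set.mem_ofPred_eq, exists_prop]
    constructor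
    · intro hx
      refine ⟨fun j => x j, ?_, self_mem_interval_extend x⟩
      rwa [← hg _ x (self_mem_interval_extend x)]
    · rintro ⟨v, hv, hx⟩
      rwa [hg _ x hx]
  rw [this]
  exact MeasurableSet.biUnion (Set.to_countable _)
    fun v _ => MeasurableSpace.measurableSet_generateFrom ⟨_, rfl⟩

theorem DependsOnFirst.measurable {α : Type*} [MeasurableSpace α] {n : ℕ} {g : Gm m → α}
    (hg : DependsOnFirst m n g) : Measurable g :=
  hg.measurable'.mono (intervalAlgebra_le m n) le_rfl

theorem DependsOnFirst.measurableSet' {n : ℕ} {S : Set (Gm m)}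
    (hS : DependsOnFirst m n (· ∈ S)) : MeasurableSet[intervalAlgebra m n] S := by
  have h := hS.measurable' (measurableSet_singleton True)
  have e : (fun x => x ∈ S) ⁻¹' {True} = S := by ext x; simp
  rwa [e] at h

theorem DependsOnFirst.exists_norm_le {n : ℕ} {g : Gm m → ℂ} (hg : DependsOnFirst m n g) :
    ∃ C : ℝ, ∀ x, ‖g x‖ ≤ C := by
  obtain ⟨C, hC⟩ := (Set.finite_range fun v : Prefix m n => ‖g (extend m n v)‖).bddAbove
  refine ⟨C, fun x => ?_⟩
  rw [hg _ x (self_mem_interval_extend x)]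
  exact hC ⟨_, rfl⟩

instance haar_isProbability : IsProbabilityMeasure (haar m) := by
  unfold haar; infer_instance

theorem DependsOnFirst.integrable {n : ℕ} {g : Gm m → ℂ} (hg : DependsOnFirst m n g) :
    Integrable g (haar m) := by
  obtain ⟨C, hC⟩ := hg.exists_norm_le
  exact Integrable.of_bound hg.measurable.aestronglyMeasurable C (ae_of_all _ hC)

theorem haar_interval (n : ℕ) (x : Gm m) : haar m (interval m n x) = (M m n : ℝ≥0∞)⁻¹ := by
  have h : interval m n x = (Finset.range n : Set ℕ).pi fun j => {x j} := by
    ext y; simp [interval, Set.mem_pi]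
  rw [h, haar, Measure.infinitePi_pi _ (fun _ _ => measurableSet_singleton _), M_eq_prod]
  push_cast
  rw [ENNReal.prod_inv_distrib]
  · refine Finset.prod_congr rfl fun j _ => ?_
    rw [uniformOn_univ]
    simp [ZMod.card]
  · intro i _ j _ _
    exact Or.inr (by simp)

theorem haar_real_interval (n : ℕ) (x : Gm m) :
    (haar m).real (interval m n x) = (M m n : ℝ)⁻¹ := by
  simp [measureReal_def, haar_interval]


theorem pairwise_disjoint_interval (m : ℕ → ℕ) [∀ k, NeZero (m k)] (n : ℕ) :
    Pairwise (Function.onFun Disjoint fun v : Prefix m n => interval m n (extend m n v)) := by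
  intro v w hvw
  refine Set.disjoint_left.2 fun x hx hx' => hvw ?_
  rw [← mem_interval_extend.1 hx, ← mem_interval_extend.1 hx']

theorem iUnion_interval (m : ℕ → ℕ) [∀ k, NeZero (m k)] (n : ℕ) :
    ⋃ v : Prefix m n, interval m n (extend m n v) = Set.univ :=
  Set.eq_univ_of_forall fun x => Set.mem_iUnion.2 ⟨_, self_mem_interval_extend x⟩

theorem lintegral_eq_sum_interval (n : ℕ) (g : Gm m → ℝ≥0∞) :
    ∫⁻ x, g x ∂haar m = ∑ v : Prefix m n, ∫⁻ x in interval m n (extend m n v), g x ∂haar m := by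
  rw [← tsum_fintype (L := .unconditional _),
    ← lintegral_iUnion (fun v => measurableSet_interval m n _) (pairwise_disjoint_interval m n),
    iUnion_interval, setLIntegral_univ]

theorem integral_eq_sum_interval (n : ℕ) {g : Gm m → ℂ} (hg : Integrable g (haar m)) :
    ∫ x, g x ∂haar m = ∑ v : Prefix m n, ∫ x in interval m n (extend m n v), g x ∂haar m := by
  rw [← integral_iUnion_fintype (fun v => measurableSet_interval m n _)
    (pairwise_disjoint_interval m n) (fun v => hg.integrableOn), iUnion_interval,
    setIntegral_univ]

theorem integral_mul_eq_zero {n : ℕ} {u g : Gm m → ℂ} (hu : Integrable u (haar m))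
    (hu0 : ∀ y, ∫ x in interval m n y, u x ∂haar m = 0) (hg : DependsOnFirst m n g) :
    ∫ x, u x * g x ∂haar m = 0 := by
  obtain ⟨C, hC⟩ := hg.exists_norm_le
  rw [integral_eq_sum_interval n
    (hu.mul_bdd hg.measurable.aestronglyMeasurable (ae_of_all _ hC))]
  refine Finset.sum_eq_zero fun v _ => ?_
  rw [setIntegral_congr_fun (g := fun x => u x * g (extend m n v)) (measurableSet_interval m n _)
    (fun x hx => by simp only [hg _ x hx]), integral_mul_const, hu0, zero_mul]

/-- The free coordinate `s` takes `m_s ≤ b` values, and fixing it leaves a subset of one interval of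
order `A`. -/
theorem haar_spike_shift_le {b : ℕ} (hb : ∀ k, m k ≤ b) (s A : ℕ) (y : Gm m) :
    haar m {x | x - y ∈ spike m s A} ≤ b * (M m A : ℝ≥0∞)⁻¹ := by
  have hsub : {x | x - y ∈ spike m s A}
      ⊆ ⋃ c : ZMod (m s), interval m A (Function.update y s c) := by
    intro x hx
    refine Set.mem_iUnion.2 ⟨x s, fun j hj => ?_⟩
    by_cases h : j = s
    · subst h; simp
    · rw [Function.update_of_ne h]
      exact sub_eq_zero.1 (hx j hj h)
  refine (measure_mono hsub).trans ((measure_iUnion_le _).trans ?_)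
  simp_rw [haar_interval]
  rw [tsum_fintype, Finset.sum_const, Finset.card_univ, ZMod.card, nsmul_eq_mul]
  gcongr
  exact_mod_cast hb s

theorem measurableSet_spike_shift (s A : ℕ) (y : Gm m) :
    MeasurableSet {x | x - y ∈ spike m s A} := by
  refine intervalAlgebra_le m A _ (DependsOnFirst.measurableSet' ?_)
  intro x z hz
  refine propext (forall_congr' fun j => forall_congr' fun hj => forall_congr' fun _ => ?_)
  rw [Pi.sub_apply, Pi.sub_apply, hz j hj]

theorem lintegral_indicator_spike_shift_le {b : ℕ} (hb : ∀ k, m k ≤ b) (s A : ℕ) (y : Gm m)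
    (c : ℝ≥0∞) :
    ∫⁻ x, (spike m s A).indicator (fun _ => c) (x - y) ∂haar m
      ≤ c * (b * (M m A : ℝ≥0∞)⁻¹) := by
  have : ∀ x, (spike m s A).indicator (fun _ => c) (x - y)
      = {x | x - y ∈ spike m s A}.indicator (fun _ => c) x := fun x => rfl
  simp_rw [this]
  rw [lintegral_indicator_const (measurableSet_spike_shift s A y)]
  gcongr
  exact haar_spike_shift_le hb s A y

theorem measurable_spike_shift (s A : ℕ) (y : Gm m) (c : ℝ≥0∞) :
    Measurable fun x => (spike m s A).indicator (fun _ => c) (x - y) := by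
  have : ∀ x, (spike m s A).indicator (fun _ => c) (x - y)
      = {x | x - y ∈ spike m s A}.indicator (fun _ => c) x := fun x => rfl
  simp_rw [this]
  exact measurable_const.indicator (measurableSet_spike_shift s A y)

/-- A spike of height `M_s M_A` and measure at most `b / M_A` contributes at most `b M_s`. The sums
over `s` and then over `A` are dominated by geometric ones, each costing a factor 2. -/
theorem lintegral_spikeTotal_shift_le (hm : ∀ k, 2 ≤ m k) {b : ℕ} (hb : ∀ k, m k ≤ b) (N : ℕ)
    (y : Gm m) :
    ∫⁻ x, ENNReal.ofReal (spikeTotal m N (x - y)) ∂haar m ≤ 4 * b * M m N := by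
  have h : ∀ x, ENNReal.ofReal (spikeTotal m N (x - y)) = ∑ A ∈ Finset.range (N + 1),
      ∑ s ∈ Finset.range (A + 1),
        (spike m s A).indicator (fun _ => (M m s * M m A : ℝ≥0∞)) (x - y) := by
    intro x
    rw [spikeTotal, ENNReal.ofReal_sum_of_nonneg fun _ _ => spikeSum_nonneg m _ _]
    simp_rw [ofReal_spikeSum]
  simp_rw [h]
  rw [lintegral_finsetSum _ fun A _ =>
    Finset.measurable_fun_sum _ fun s _ => measurable_spike_shift s A y _]
  calc _ ≤ ∑ A ∈ Finset.range (N + 1), ∑ s ∈ Finset.range (A + 1), (b * M m s : ℝ≥0∞) := by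
        refine Finset.sum_le_sum fun A _ => ?_
        rw [lintegral_finsetSum _ fun s _ => measurable_spike_shift s A y _]
        refine Finset.sum_le_sum fun s _ =>
          (lintegral_indicator_spike_shift_le hb s A y _).trans (le_of_eq ?_)
        have h1 : (M m A : ℝ≥0∞) * (M m A : ℝ≥0∞)⁻¹ = 1 := ENNReal.mul_inv_cancel
          (by exact_mod_cast (M_pos m A).ne') (ENNReal.natCast_ne_top _)
        calc _ = (M m s * b : ℝ≥0∞) * ((M m A : ℝ≥0∞) * (M m A : ℝ≥0∞)⁻¹) := by ring
          _ = _ := by rw [h1, mul_one, mul_comm]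
    _ = ((b * ∑ A ∈ Finset.range (N + 1), ∑ s ∈ Finset.range (A + 1), M m s : ℕ) : ℝ≥0∞) := by
        push_cast
        simp_rw [Finset.mul_sum]
    _ ≤ ((4 * b * M m N : ℕ) : ℝ≥0∞) := by
        refine Nat.cast_le.2 ?_
        calc _ ≤ b * ∑ A ∈ Finset.range (N + 1), 2 * M m A :=
              Nat.mul_le_mul_left _ (Finset.sum_le_sum fun A _ => sum_M_le hm A)
          _ ≤ b * (2 * (2 * M m N)) := by
              rw [← Finset.mul_sum]
              exact Nat.mul_le_mul_left _ (Nat.mul_le_mul_left _ (sum_M_le hm N))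
          _ = _ := by ring
    _ = _ := by push_cast; ring

theorem rpow_half_sum_le {ι : Type*} (s : Finset ι) (f : ι → ℝ≥0∞) :
    (∑ i ∈ s, f i) ^ (1 / 2 : ℝ) ≤ ∑ i ∈ s, f i ^ (1 / 2 : ℝ) := by
  classical
  induction s using Finset.induction_on with
  | empty => simp
  | insert i s hi ih =>
    rw [Finset.sum_insert hi, Finset.sum_insert hi]
    exact (ENNReal.rpow_add_le_add_rpow _ _ (by norm_num) (by norm_num)).trans
      (add_le_add le_rfl ih)

theorem sum_rpow_half_mul_inv_le (hm : ∀ k, 2 ≤ m k) (A : ℕ) :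
    ∑ s ∈ Finset.range (A + 1), (M m s * M m A : ℝ≥0∞) ^ (1 / 2 : ℝ) * (M m A : ℝ≥0∞)⁻¹ ≤ 4 := by
  have hM : ∀ k, (0 : ℝ) < M m k := fun k => by exact_mod_cast M_pos m k
  -- The term is `(M_s / M_A)^{1/2} ≤ 2^{-(A-s)/2}`. The rational ratio `3/4` dominates `2^{-1/2}`,
  -- because `2 (3/4)² ≥ 1`, and its geometric series sums to 4.
  have hterm : ∀ s ∈ Finset.range (A + 1),
      (M m s * M m A : ℝ≥0∞) ^ (1 / 2 : ℝ) * (M m A : ℝ≥0∞)⁻¹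
        ≤ ENNReal.ofReal ((3 / 4 : ℝ) ^ (A - s)) := by
    intro s hs
    obtain ⟨d, rfl⟩ := Nat.exists_eq_add_of_le (Nat.lt_succ_iff.1 (Finset.mem_range.1 hs))
    have e : (M m s * M m (s + d) : ℝ≥0∞) ^ (1 / 2 : ℝ) * (M m (s + d) : ℝ≥0∞)⁻¹
        = ENNReal.ofReal (√(M m s * M m (s + d)) * (M m (s + d) : ℝ)⁻¹) := by
      rw [ENNReal.ofReal_mul (Real.sqrt_nonneg _), ENNReal.ofReal_inv_of_pos (hM _),
        ENNReal.ofReal_natCast, Real.sqrt_eq_rpow,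
        ← ENNReal.ofReal_rpow_of_nonneg (by positivity) (by norm_num),
        ENNReal.ofReal_mul (hM _).le, ENNReal.ofReal_natCast, ENNReal.ofReal_natCast]
    rw [e, Nat.add_sub_cancel_left]
    refine ENNReal.ofReal_le_ofReal ?_
    rw [← div_eq_mul_inv, div_le_iff₀ (hM _)]
    refine Real.sqrt_le_iff.2 ⟨by have := hM (s + d); positivity, ?_⟩
    have h2 : (2 : ℝ) ^ d * M m s ≤ M m (s + d) := by exact_mod_cast two_pow_mul_M_le m hm s d
    have h3 : (M m s : ℝ) ≤ ((3 / 4 : ℝ) ^ d) ^ 2 * M m (s + d) := by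
      have h4 : (1 : ℝ) ≤ ((3 / 4 : ℝ) ^ d) ^ 2 * 2 ^ d := by
        rw [← pow_mul, mul_comm d 2, pow_mul, ← mul_pow]
        exact one_le_pow₀ (by norm_num)
      calc (M m s : ℝ) ≤ (((3 / 4 : ℝ) ^ d) ^ 2 * 2 ^ d) * M m s :=
            le_mul_of_one_le_left (hM s).le h4
        _ = ((3 / 4 : ℝ) ^ d) ^ 2 * (2 ^ d * M m s) := by ring
        _ ≤ _ := by gcongr
    calc (M m s * M m (s + d) : ℝ) ≤ ((3 / 4 : ℝ) ^ d) ^ 2 * M m (s + d) * M m (s + d) := by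
          gcongr
      _ = _ := by ring
  refine (Finset.sum_le_sum hterm).trans ?_
  rw [← ENNReal.ofReal_sum_of_nonneg fun _ _ => by positivity]
  have h4 : (4 : ℝ≥0∞) = ENNReal.ofReal 4 := by simp
  rw [h4]
  refine ENNReal.ofReal_le_ofReal ?_
  have h5 := Finset.sum_range_reflect (fun j => (3 / 4 : ℝ) ^ j) (A + 1)
  rw [Nat.add_sub_cancel] at h5
  rw [h5, geom_sum_eq (by norm_num)]
  have : (0 : ℝ) ≤ (3 / 4) ^ (A + 1) := by positivity
  rw [div_le_iff_of_neg (by norm_num)]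
  linarith

theorem lintegral_rpow_spikeSum_shift_le (hm : ∀ k, 2 ≤ m k) {b : ℕ} (hb : ∀ k, m k ≤ b) (A : ℕ)
    (y : Gm m) :
    ∫⁻ x, ENNReal.ofReal (spikeSum m A (x - y)) ^ (1 / 2 : ℝ) ∂haar m ≤ 4 * b := by
  classical
  calc _ ≤ ∫⁻ x, ∑ s ∈ Finset.range (A + 1), (spike m s A).indicator
        (fun _ => (M m s * M m A : ℝ≥0∞) ^ (1 / 2 : ℝ)) (x - y) ∂haar m := by
        refine lintegral_mono fun x => ?_
        rw [ofReal_spikeSum]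
        refine (rpow_half_sum_le _ _).trans (Finset.sum_le_sum fun s _ => ?_)
        simp only [Set.indicator]
        split_ifs
        · rfl
        · simp
    _ ≤ ∑ s ∈ Finset.range (A + 1),
        (M m s * M m A : ℝ≥0∞) ^ (1 / 2 : ℝ) * (b * (M m A : ℝ≥0∞)⁻¹) := by
        rw [lintegral_finsetSum _ fun s _ => measurable_spike_shift s A y _]
        exact Finset.sum_le_sum fun s _ => lintegral_indicator_spike_shift_le hb s A y _
    _ = (∑ s ∈ Finset.range (A + 1),
        (M m s * M m A : ℝ≥0∞) ^ (1 / 2 : ℝ) * (M m A : ℝ≥0∞)⁻¹) * b := by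
        rw [Finset.sum_mul]
        exact Finset.sum_congr rfl fun s _ => by ring
    _ ≤ _ := by
        gcongr
        exact sum_rpow_half_mul_inv_le hm A

/-- Each scale costs a bounded amount, whence the factor `N + 1`. This is the loss that the
logarithmic weight has to compensate. -/
theorem lintegral_rpow_spikeTotal_shift_le (hm : ∀ k, 2 ≤ m k) {b : ℕ} (hb : ∀ k, m k ≤ b)
    (N : ℕ) (y : Gm m) :
    ∫⁻ x, ENNReal.ofReal (spikeTotal m N (x - y)) ^ (1 / 2 : ℝ) ∂haar m ≤ 4 * b * (N + 1) := by
  have hmeas : ∀ A, Measurable fun x => ENNReal.ofReal (spikeSum m A (x - y)) ^ (1 / 2 : ℝ) := by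
    intro A
    simp_rw [ofReal_spikeSum]
    exact (Finset.measurable_fun_sum _ fun s _ => measurable_spike_shift s A y _).pow_const _
  calc _ ≤ ∫⁻ x, ∑ A ∈ Finset.range (N + 1),
        ENNReal.ofReal (spikeSum m A (x - y)) ^ (1 / 2 : ℝ) ∂haar m := by
        refine lintegral_mono fun x => ?_
        rw [spikeTotal, ENNReal.ofReal_sum_of_nonneg fun _ _ => spikeSum_nonneg m _ _]
        exact rpow_half_sum_le _ _
    _ ≤ ∑ A ∈ Finset.range (N + 1), (4 * b : ℝ≥0∞) := by
        rw [lintegral_finsetSum _ fun A _ => hmeas A]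
        exact Finset.sum_le_sum fun A _ => lintegral_rpow_spikeSum_shift_le hm hb A y
    _ = _ := by
        rw [Finset.sum_const, Finset.card_range, nsmul_eq_mul]
        push_cast
        ring

end finite

/-! ### The Riesz logarithmic kernel and pointwise estimates for atoms -/

/-- The kernel `∑_{k=1}^n D_k / k` of the non-normalized Riesz logarithmic sum. -/
noncomputable def rieszKernel (m : ℕ → ℕ) (n : ℕ) (x : Gm m) : ℂ :=
  ∑ k ∈ Finset.range (n + 1), dirichlet m k x / k

/-- The convolution of an integrable function with the kernel `∑_{k=1}^n D_k / k`. -/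
noncomputable def rieszSum (m : ℕ → ℕ) [∀ k, NeZero (m k)] (n : ℕ) (g : Gm m → ℂ) (x : Gm m) : ℂ :=
  ∫ t, g t * rieszKernel m n (x - t) ∂haar m

/-- Summation by parts. The shift `c` serves the blocks starting at multiples of `M_N`; for `c = 0`
the terms with denominator zero vanish together with `dirichlet m 0` and `fejerSum m 0`. -/
theorem sum_dirichlet_div (m : ℕ → ℕ) (c r : ℕ) (x : Gm m) :
    ∑ i ∈ Finset.range (r + 1), dirichlet m i x / ((c + i : ℕ) : ℂ)
      = fejerSum m r x / ((c + r : ℕ) : ℂ) + ∑ i ∈ Finset.range r,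
        fejerSum m i x * (1 / ((c + i : ℕ) : ℂ) - 1 / ((c + (i + 1) : ℕ) : ℂ)) := by
  induction r with
  | zero => simp [fejerSum]
  | succ r ih =>
    rw [Finset.sum_range_succ, ih, fejerSum_succ, Finset.sum_range_succ _ r]
    ring

theorem norm_inv_sub_inv_succ {a : ℕ} (ha : 1 ≤ a) :
    ‖1 / (a : ℂ) - 1 / ((a + 1 : ℕ) : ℂ)‖ = 1 / ((a : ℝ) * (a + 1)) := by
  have h1 : (a : ℂ) ≠ 0 := by exact_mod_cast (by omega : a ≠ 0)
  have h2 : ((a + 1 : ℕ) : ℂ) ≠ 0 := by exact_mod_cast a.succ_ne_zero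
  have : 1 / (a : ℂ) - 1 / ((a + 1 : ℕ) : ℂ) = 1 / (((a * (a + 1) : ℕ)) : ℂ) := by
    push_cast at h2 ⊢
    field_simp
    ring
  rw [this, norm_div, norm_one, Complex.norm_natCast]
  push_cast
  rfl

theorem rieszKernel_eq (m : ℕ → ℕ) (n : ℕ) (x : Gm m) :
    rieszKernel m n x = fejerSum m n x / n + ∑ i ∈ Finset.range n,
      fejerSum m i x * (1 / (i : ℂ) - 1 / ((i + 1 : ℕ) : ℂ)) := by
  rw [rieszKernel]
  simpa using sum_dirichlet_div m 0 n x

theorem half_le_log_succ {n : ℕ} (hn : 1 ≤ n) : 1 / 2 ≤ Real.log ((n : ℝ) + 1) := by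
  have h1 : (2 : ℝ) ≤ (n : ℝ) + 1 := by
    have : (1 : ℝ) ≤ n := by exact_mod_cast hn
    linarith
  linarith [Real.log_two_gt_d9, Real.log_le_log (by norm_num) h1]

theorem sum_inv_le_log {n : ℕ} (hn : 1 ≤ n) :
    ∑ i ∈ Finset.range n, 1 / ((i : ℝ) + 1) ≤ 3 * Real.log ((n : ℝ) + 1) := by
  have h := harmonic_le_one_add_log n
  have h2 : ((harmonic n : ℚ) : ℝ) = ∑ i ∈ Finset.range n, 1 / ((i : ℝ) + 1) := by
    simp [harmonic]
  have h3 : Real.log n ≤ Real.log ((n : ℝ) + 1) :=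
    Real.log_le_log (by exact_mod_cast hn) (by linarith)
  linarith [half_le_log_succ hn]

theorem sum_range_mul_eq {α : Type*} [AddCommMonoid α] (f : ℕ → α) (J L : ℕ) :
    ∑ k ∈ Finset.range (J * L), f k
      = ∑ j ∈ Finset.range J, ∑ i ∈ Finset.range L, f (j * L + i) := by
  induction J with
  | zero => simp
  | succ J ih => rw [add_mul, one_mul, Finset.sum_range_add, ih, Finset.sum_range_succ]

theorem sum_inv_sq_le (n : ℕ) : ∑ i ∈ Finset.range n, 1 / ((i : ℝ) + 1) ^ 2 ≤ 2 - 1 / (n : ℝ) := by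
  induction n with
  | zero => simp
  | succ n ih =>
    rw [Finset.sum_range_succ]
    rcases Nat.eq_zero_or_pos n with rfl | hn
    · norm_num
    have hn0 : (0 : ℝ) < n := by exact_mod_cast hn
    have h : 1 / ((n : ℝ) + 1) ^ 2 ≤ 1 / (n : ℝ) - 1 / (n + 1) := by
      rw [div_sub_div _ _ hn0.ne' (by positivity), div_le_div_iff₀ (by positivity) (by positivity)]
      nlinarith
    push_cast
    linarith

theorem DependsOnFirst.shift {m : ℕ → ℕ} {α : Type*} {n : ℕ} {g : Gm m → α}
    (hg : DependsOnFirst m n g) (x : Gm m) : DependsOnFirst m n fun t => g (x - t) :=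
  fun t t' h => hg _ _ fun j hj => by rw [Pi.sub_apply, Pi.sub_apply, h j hj]

section
variable {m : ℕ → ℕ} [∀ k, NeZero (m k)]

theorem dependsOnFirst_psi {n N : ℕ} (h : n < M m N) : DependsOnFirst m N (psi m n) :=
  fun _ _ hy => psi_congr m h hy

theorem dependsOnFirst_dirichlet {n N : ℕ} (h : n ≤ M m N) :
    DependsOnFirst m N (dirichlet m n) :=
  DependsOnFirst.sum fun _ hk => dependsOnFirst_psi ((Finset.mem_range.1 hk).trans_le h)

theorem dependsOnFirst_fejerSum {n N : ℕ} (h : n ≤ M m N) :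
    DependsOnFirst m N (fejerSum m n) :=
  DependsOnFirst.sum fun _ hk => dependsOnFirst_dirichlet
    ((Nat.lt_succ_iff.1 (Finset.mem_range.1 hk)).trans h)

theorem dependsOnFirst_rieszKernel {n N : ℕ} (h : n ≤ M m N) :
    DependsOnFirst m N (rieszKernel m n) :=
  DependsOnFirst.sum fun k hk => (dependsOnFirst_dirichlet
    ((Nat.lt_succ_iff.1 (Finset.mem_range.1 hk)).trans h)).comp (· / (k : ℂ))

/-- With `M_N ≤ n < M_{N+1} ≤ b n`, the majorant at order `N + 1` has integral at most `4 b · b n`.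
The pointwise constant `3 b³` then gives `12 b⁵ n`. -/
theorem integral_norm_fejerSum_le (hm : ∀ k, 2 ≤ m k) {b : ℕ} (hb : ∀ k, m k ≤ b) (n : ℕ)
    (x : Gm m) : ∫ t, ‖fejerSum m n (x - t)‖ ∂haar m ≤ 12 * b ^ 5 * n := by
  rcases Nat.eq_zero_or_pos n with rfl | hn
  · simp [fejerSum_zero]
  have hex : ∃ N, n < M m N := ⟨n, lt_M m hm n⟩
  classical
  obtain ⟨N, hN⟩ : ∃ N, Nat.find hex = N + 1 := by
    refine Nat.exists_eq_succ_of_ne_zero fun h0 => ?_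
    have := Nat.find_spec hex
    rw [h0, M] at this
    omega
  have h1 : n < M m (N + 1) := hN ▸ Nat.find_spec hex
  have h2 : M m N ≤ n := not_lt.1 (Nat.find_min hex (by omega))
  have h3 : M m (N + 1) ≤ b * n := Nat.mul_le_mul (hb N) h2
  have hint : Integrable (fun t => fejerSum m n (x - t)) (haar m) :=
    ((dependsOnFirst_fejerSum h1.le).shift x).integrable
  have key : ENNReal.ofReal (∫ t, ‖fejerSum m n (x - t)‖ ∂haar m)
      ≤ ENNReal.ofReal (12 * b ^ 5 * n) := by
    rw [ofReal_integral_norm_eq_lintegral_enorm hint]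
    have hb' : (4 * b * M m (N + 1) : ℝ≥0∞) ≤ ENNReal.ofReal (4 * b * (b * n)) := by
      have : (4 * b * M m (N + 1) : ℝ≥0∞) = ((4 * b * M m (N + 1) : ℕ) : ℝ≥0∞) := by push_cast; rfl
      rw [this, ← ENNReal.ofReal_natCast]
      refine ENNReal.ofReal_le_ofReal ?_
      push_cast
      gcongr
      exact_mod_cast h3
    have hb1 : (1 : ℝ) ≤ b := by exact_mod_cast (by linarith [hm 0, hb 0] : 1 ≤ b)
    calc ∫⁻ t, ‖fejerSum m n (x - t)‖ₑ ∂haar m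
        ≤ ∫⁻ t, ENNReal.ofReal (3 * b ^ 3) * ENNReal.ofReal (spikeTotal m (N + 1) (t - x))
            ∂haar m := by
          refine lintegral_mono fun t => ?_
          rw [← ENNReal.ofReal_mul (by positivity), ← ofReal_norm,
            ← neg_sub x t, spikeTotal_neg]
          exact ENNReal.ofReal_le_ofReal (norm_fejerSum_le hm hb h1.le _)
      _ = ENNReal.ofReal (3 * b ^ 3)
            * ∫⁻ t, ENNReal.ofReal (spikeTotal m (N + 1) (t - x)) ∂haar m :=
          lintegral_const_mul' _ _ ENNReal.ofReal_ne_top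
      _ ≤ ENNReal.ofReal (3 * b ^ 3) * ENNReal.ofReal (4 * b * (b * n)) := by
          gcongr
          exact (lintegral_spikeTotal_shift_le hm hb _ _).trans hb'
      _ = ENNReal.ofReal (12 * b ^ 5 * n) := by
          rw [← ENNReal.ofReal_mul (by positivity)]
          congr 1
          ring
  exact (ENNReal.ofReal_le_ofReal_iff (by positivity)).1 key

theorem integral_norm_rieszKernel_le (hm : ∀ k, 2 ≤ m k) {b : ℕ} (hb : ∀ k, m k ≤ b) {n : ℕ}
    (hn : 1 ≤ n) (x : Gm m) :
    ∫ t, ‖rieszKernel m n (x - t)‖ ∂haar m ≤ 60 * b ^ 5 * Real.log ((n : ℝ) + 1) := by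
  have hnM := (lt_M m hm n).le
  have hE : ∀ i ≤ n, Integrable (fun t => ‖fejerSum m i (x - t)‖) (haar m) := fun i hi =>
    ((dependsOnFirst_fejerSum (hi.trans hnM)).shift x).integrable.norm
  have hpt : ∀ t, ‖rieszKernel m n (x - t)‖ ≤ ‖fejerSum m n (x - t)‖ * (1 / n)
      + ∑ i ∈ Finset.range n, ‖fejerSum m i (x - t)‖ * (1 / ((i : ℝ) * (i + 1))) := by
    intro t
    rw [rieszKernel_eq]
    refine (norm_add_le _ _).trans (add_le_add (le_of_eq ?_) ?_)
    · rw [norm_div, Complex.norm_natCast, mul_one_div]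
    · refine (norm_sum_le _ _).trans (Finset.sum_le_sum fun i _ => ?_)
      rcases Nat.eq_zero_or_pos i with rfl | hi
      · simp [fejerSum_zero]
      · rw [norm_mul, norm_inv_sub_inv_succ hi]
  have hn0 : (0 : ℝ) < n := by exact_mod_cast hn
  calc _ ≤ ∫ t, (‖fejerSum m n (x - t)‖ * (1 / n)
      + ∑ i ∈ Finset.range n, ‖fejerSum m i (x - t)‖ * (1 / ((i : ℝ) * (i + 1)))) ∂haar m := by
        refine integral_mono ((dependsOnFirst_rieszKernel hnM).shift x).integrable.norm ?_ hpt
        exact ((hE n le_rfl).mul_const _).add (integrable_finsetSum _ fun i hi =>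
          (hE i (Finset.mem_range.1 hi).le).mul_const _)
    _ = (∫ t, ‖fejerSum m n (x - t)‖ ∂haar m) * (1 / n)
      + ∑ i ∈ Finset.range n, (∫ t, ‖fejerSum m i (x - t)‖ ∂haar m)
          * (1 / ((i : ℝ) * (i + 1))) := by
        rw [integral_add ((hE n le_rfl).mul_const _) (integrable_finsetSum _ fun i hi =>
          (hE i (Finset.mem_range.1 hi).le).mul_const _), integral_mul_const,
          integral_finsetSum _ fun i hi => (hE i (Finset.mem_range.1 hi).le).mul_const _]
        simp_rw [integral_mul_const]
    _ ≤ (12 * b ^ 5 * n) * (1 / n)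
      + ∑ i ∈ Finset.range n, (12 * b ^ 5) * (1 / ((i : ℝ) + 1)) := by
        refine add_le_add ?_ (Finset.sum_le_sum fun i _ => ?_)
        · gcongr
          exact integral_norm_fejerSum_le hm hb n x
        · rcases Nat.eq_zero_or_pos i with rfl | hi
          · simp only [fejerSum_zero, norm_zero, integral_zero, zero_mul]
            positivity
          · have hi0 : (0 : ℝ) < i := by exact_mod_cast hi
            refine (mul_le_mul_of_nonneg_right (integral_norm_fejerSum_le hm hb i x)
              (by positivity)).trans (le_of_eq ?_)
            field_simp
    -- The sum of the `1/(i+1)` is at most `3 log(n + 1)`, and `1 ≤ 2 log(n + 1)`, so the constant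
    -- is `12 · 3 + 12 · 2 = 60`.
    _ ≤ _ := by
        rw [← Finset.mul_sum]
        have e : (12 * b ^ 5 * n : ℝ) * (1 / n) = 12 * b ^ 5 := by field_simp
        have hb0 : (0 : ℝ) ≤ b ^ 5 := by positivity
        rw [e]
        nlinarith [mul_le_mul_of_nonneg_left (sum_inv_le_log hn) hb0,
          mul_le_mul_of_nonneg_left (half_le_log_succ hn) hb0]

theorem norm_integral_mul_le {N : ℕ} {g w : Gm m → ℂ} {r : ℝ} (hg : ∀ t, ‖g t‖ ≤ r)
    (hw : DependsOnFirst m N w) :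
    ‖∫ t, g t * w t ∂haar m‖ ≤ r * ∫ t, ‖w t‖ ∂haar m := by
  rw [← integral_const_mul]
  refine norm_integral_le_of_norm_le (hw.integrable.norm.const_mul r) (ae_of_all _ fun t => ?_)
  rw [norm_mul]
  exact mul_le_mul_of_nonneg_right (hg t) (norm_nonneg _)

theorem norm_rieszSum_le (hm : ∀ k, 2 ≤ m k) {b : ℕ} (hb : ∀ k, m k ≤ b) {n : ℕ}
    (hn : 1 ≤ n) {g : Gm m → ℂ} {r : ℝ} (hg : ∀ t, ‖g t‖ ≤ r) (x : Gm m) :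
    ‖rieszSum m n g x‖ ≤ 60 * b ^ 5 * r * Real.log ((n : ℝ) + 1) := by
  have hr : 0 ≤ r := (norm_nonneg _).trans (hg 0)
  refine (norm_integral_mul_le hg
    ((dependsOnFirst_rieszKernel (lt_M m hm n).le).shift x)).trans ?_
  calc _ ≤ r * (60 * b ^ 5 * Real.log ((n : ℝ) + 1)) := by
        gcongr
        exact integral_norm_rieszKernel_le hm hb hn x
    _ = _ := by ring

theorem norm_sum_dirichlet_div_le (hm : ∀ k, 2 ≤ m k) {b : ℕ} (hb : ∀ k, m k ≤ b) {N c r : ℕ}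
    (hc : 1 ≤ c) (hr : r ≤ M m N) (z : Gm m) :
    ‖∑ i ∈ Finset.range (r + 1), dirichlet m i z / ((c + i : ℕ) : ℂ)‖
      ≤ ‖fejerSum m r z‖ / c + 3 * b ^ 3 * spikeTotal m N z * M m N / c ^ 2 := by
  have hc0 : (0 : ℝ) < c := by exact_mod_cast hc
  have hX := spikeTotal_nonneg m N z
  rw [sum_dirichlet_div]
  refine (norm_add_le _ _).trans (add_le_add ?_ ?_)
  · rw [norm_div, Complex.norm_natCast]
    gcongr
    omega
  · refine (norm_sum_le _ _).trans ?_
    have key : ∀ i ∈ Finset.range r,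
        ‖fejerSum m i z * (1 / ((c + i : ℕ) : ℂ) - 1 / ((c + (i + 1) : ℕ) : ℂ))‖
          ≤ 3 * b ^ 3 * spikeTotal m N z * (1 / c ^ 2) := by
      intro i hi
      rw [norm_mul, ← add_assoc, norm_inv_sub_inv_succ (by omega : 1 ≤ c + i)]
      refine mul_le_mul (norm_fejerSum_le hm hb ((Finset.mem_range.1 hi).le.trans hr) z) ?_
        (by positivity) (by positivity)
      refine one_div_le_one_div_of_le (by positivity) ?_
      push_cast
      nlinarith [(Nat.cast_nonneg i : (0 : ℝ) ≤ i)]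
    refine (Finset.sum_le_sum key).trans ?_
    rw [Finset.sum_const, Finset.card_range, nsmul_eq_mul]
    have hr' : (r : ℝ) ≤ M m N := by exact_mod_cast hr
    calc (r : ℝ) * (3 * b ^ 3 * spikeTotal m N z * (1 / c ^ 2))
        ≤ M m N * (3 * b ^ 3 * spikeTotal m N z * (1 / c ^ 2)) := by gcongr
      _ = _ := by ring

theorem dirichlet_mul_M_eq_zero (hm : ∀ k, 2 ≤ m k) (j : ℕ) {N : ℕ} {z : Gm m}
    (hz : z ∉ interval m N 0) : dirichlet m (j * M m N) z = 0 := by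
  have h := norm_dirichlet_mul_M_le m hm j N z
  rw [Set.indicator_of_notMem hz, mul_zero] at h
  exact norm_le_zero_iff.1 h

/-- Summation by parts over a full block ends at index `M_N - 1`. Replacing it by `M_N` makes the
sharper bound `norm_fejerSum_M_le` available. -/
theorem fejerSum_pred_M (hm : ∀ k, 2 ≤ m k) {N : ℕ} {z : Gm m} (hz : z ∉ interval m N 0) :
    fejerSum m (M m N - 1) z = fejerSum m (M m N) z := by
  obtain ⟨L, hL⟩ := Nat.exists_eq_succ_of_ne_zero (M_pos m N).ne'
  have h := dirichlet_mul_M_eq_zero hm 1 hz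
  rw [one_mul] at h
  rw [hL, Nat.succ_sub_one, Nat.succ_eq_add_one, fejerSum_succ, ← Nat.succ_eq_add_one, ← hL, h,
    add_zero]

/-- Away from the support interval of `g`, the partial sums of `g` are multiples of Dirichlet
kernels of low order. -/
theorem integral_mul_dirichlet_of_notMem (hm : ∀ k, 2 ≤ m k) {N : ℕ} {g : Gm m → ℂ} {y x : Gm m}
    (hsupp : ∀ t, t ∉ interval m N y → g t = 0) (hx : x - y ∉ interval m N 0) (j : ℕ) {i : ℕ}
    (hi : i ≤ M m N) :
    ∫ t, g t * dirichlet m (j * M m N + i) (x - t) ∂haar m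
      = (∫ t, g t * psi m (j * M m N) (x - t) ∂haar m) * dirichlet m i (x - y) := by
  rw [← integral_mul_const]
  congr 1
  ext t
  by_cases ht : t ∈ interval m N y
  · have h1 : x - t ∈ interval m N (x - y) := fun k hk => by
      rw [Pi.sub_apply, Pi.sub_apply, ht k hk]
    have h2 : x - t ∉ interval m N 0 := fun h => by
      rw [← interval_eq_of_mem h] at hx
      exact hx (mem_interval_comm.1 h1)
    rw [dirichlet_add m hm j hi, dirichlet_mul_M_eq_zero hm j h2, zero_add,
      dependsOnFirst_dirichlet hi _ _ h1, mul_assoc]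
  · rw [hsupp t ht, zero_mul, zero_mul, zero_mul]

theorem norm_integral_mul_psi_le {N : ℕ} {g : Gm m → ℂ} {y : Gm m} {r : ℝ}
    (hm : ∀ k, 2 ≤ m k) (hg : ∀ t, ‖g t‖ ≤ r) (hsupp : ∀ t, t ∉ interval m N y → g t = 0) (n : ℕ)
    (x : Gm m) : ‖∫ t, g t * psi m n (x - t) ∂haar m‖ ≤ r / M m N := by
  calc _ ≤ ∫ t, (interval m N y).indicator (fun _ => r) t ∂haar m := by
        refine norm_integral_le_of_norm_le
          ((integrable_const r).indicator (measurableSet_interval m N y)) (ae_of_all _ fun t => ?_)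
        rw [norm_mul, norm_psi m hm, mul_one]
        by_cases ht : t ∈ interval m N y
        · rw [Set.indicator_of_mem ht]
          exact hg t
        · rw [hsupp t ht, norm_zero, Set.indicator_of_notMem ht]
    _ = r / M m N := by
        rw [integral_indicator_const _ (measurableSet_interval m N y), haar_real_interval,
          smul_eq_mul, div_eq_inv_mul]

theorem rieszSum_eq_sum (n : ℕ) {g : Gm m → ℂ} (hm : ∀ k, 2 ≤ m k)
    (hgi : Integrable g (haar m)) (x : Gm m) :
    rieszSum m n g x = ∑ k ∈ Finset.range (n + 1),
      (∫ t, g t * dirichlet m k (x - t) ∂haar m) / k := by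
  unfold rieszSum rieszKernel
  simp_rw [Finset.mul_sum, ← integral_div, ← mul_div_assoc]
  refine integral_finsetSum _ fun k _ => Integrable.div_const ?_ _
  have hd := (dependsOnFirst_dirichlet (lt_M m hm k).le).shift x
  obtain ⟨C, hC⟩ := hd.exists_norm_le
  exact hgi.mul_bdd hd.measurable.aestronglyMeasurable (ae_of_all _ hC)

/-- Allows powers of `N + 1` to be traded for powers of `log(n + 1)`, which is possible only once
`n` reaches `M_N`. -/
theorem succ_le_log {N n : ℕ} (hm : ∀ k, 2 ≤ m k) (h : M m N ≤ n) :
    ((N : ℝ) + 1) ≤ 3 * Real.log ((n : ℝ) + 1) := by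
  have hn : 1 ≤ n := (M_pos m N).trans_le h
  rcases Nat.eq_zero_or_pos N with rfl | hN
  · have := half_le_log_succ hn
    push_cast
    linarith
  · have h1 : (2 : ℝ) ^ N ≤ (n : ℝ) + 1 := by
      have : (2 : ℝ) ^ N ≤ n := by exact_mod_cast (two_pow_le_M m hm N).trans h
      linarith
    have h2 := Real.log_le_log (by positivity) h1
    rw [Real.log_pow] at h2
    have hN' : (1 : ℝ) ≤ N := by exact_mod_cast hN
    nlinarith [Real.log_two_gt_d9]

/-- On the block `j M_N ≤ k < (j + 1) M_N` the partial sums of `g` are `c_j` times low-order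
Dirichlet kernels at `z = x - y`, with `|c_j| ≤ r / M_N`. Summation by parts in a full block yields
a boundary term of size `S / j` and a remainder of size `X / j²`, up to the common factor `r /
M_N²`; here `S` is `spikeSum` and `X` is `spikeTotal`. -/
theorem norm_rieszSum_le_of_notMem (hm : ∀ k, 2 ≤ m k) {b : ℕ} (hb : ∀ k, m k ≤ b) {n N : ℕ}
    {g : Gm m → ℂ} (hgi : Integrable g (haar m)) {y x : Gm m} {r : ℝ} (hg : ∀ t, ‖g t‖ ≤ r)
    (hsupp : ∀ t, t ∉ interval m N y → g t = 0) (hmean : ∫ t, g t ∂haar m = 0)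
    (hx : x - y ∉ interval m N 0) (hn : 1 ≤ n) :
    ‖rieszSum m n g x‖ ≤ 108 * b ^ 3 * r * Real.log ((n : ℝ) + 1) ^ 2 / M m N ^ 2
      * (spikeSum m N (x - y) + spikeTotal m N (x - y) / (N + 1) ^ 2) := by
  have hr : 0 ≤ r := (norm_nonneg _).trans (hg 0)
  set z := x - y with hz
  set L := M m N with hL
  have hL0 : 0 < L := M_pos m N
  have hL0' : (0 : ℝ) < L := by exact_mod_cast hL0
  set S := spikeSum m N z
  set X := spikeTotal m N z
  have hS0 : 0 ≤ S := spikeSum_nonneg m N z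
  have hX0 : 0 ≤ X := spikeTotal_nonneg m N z
  set lg := Real.log ((n : ℝ) + 1)
  have hlg : 1 / 2 ≤ lg := half_le_log_succ hn
  set c : ℕ → ℂ := fun j => ∫ t, g t * psi m (j * L) (x - t) ∂haar m with hc
  -- Mean zero removes the block `j = 0`, where the denominators would be too small.
  have hc0 : c 0 = 0 := by simp [hc, psi_zero, hmean]
  have hcle : ∀ j, ‖c j‖ ≤ r / L := fun j => norm_integral_mul_psi_le hm hg hsupp _ x
  set J := n / L with hJ
  set q := n % L with hq
  have hnq : n + 1 = J * L + (q + 1) := by rw [← add_assoc, Nat.div_add_mod']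
  have hqL : q < L := Nat.mod_lt _ hL0
  have hdecomp : rieszSum m n g x
      = ∑ j ∈ Finset.range J, c j * ∑ i ∈ Finset.range L, dirichlet m i z / ((j * L + i : ℕ) : ℂ)
        + c J * ∑ i ∈ Finset.range (q + 1), dirichlet m i z / ((J * L + i : ℕ) : ℂ) := by
    rw [rieszSum_eq_sum n hm hgi, hnq, Finset.sum_range_add, sum_range_mul_eq]
    simp_rw [Finset.mul_sum, ← mul_div_assoc]
    congr 1
    · refine Finset.sum_congr rfl fun j _ => Finset.sum_congr rfl fun i hi => ?_
      rw [integral_mul_dirichlet_of_notMem hm hsupp hx j (Finset.mem_range.1 hi).le]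
    · refine Finset.sum_congr rfl fun i hi => ?_
      rw [integral_mul_dirichlet_of_notMem hm hsupp hx J
        ((Nat.lt_succ_iff.1 (Finset.mem_range.1 hi)).trans hqL.le)]
  have hblock : ∀ j, ‖c (j + 1) * ∑ i ∈ Finset.range L,
      dirichlet m i z / (((j + 1) * L + i : ℕ) : ℂ)‖
        ≤ 3 * b ^ 3 * r / L ^ 2 * (S * (1 / ((j : ℝ) + 1)) + X * (1 / ((j : ℝ) + 1) ^ 2)) := by
    intro j
    have h1 := norm_sum_dirichlet_div_le hm hb (N := N) (c := (j + 1) * L) (r := L - 1)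
      (Nat.mul_pos j.succ_pos hL0) (Nat.sub_le _ _) z
    rw [Nat.sub_add_cancel hL0, fejerSum_pred_M hm hx] at h1
    have h2 : ‖fejerSum m (M m N) z‖ ≤ 3 * b ^ 3 * S := by
      refine (norm_fejerSum_M_le hm hb N z).trans ?_
      have hb1 : (1 : ℝ) ≤ b := by exact_mod_cast (by linarith [hm 0, hb 0] : 1 ≤ b)
      have hb2 : (b : ℝ) ^ 2 ≤ b ^ 3 := pow_le_pow_right₀ hb1 (by norm_num)
      exact mul_le_mul_of_nonneg_right (by nlinarith [sq_nonneg (b : ℝ)]) hS0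
    rw [norm_mul]
    calc _ ≤ r / L * (3 * b ^ 3 * S / ((j + 1) * L : ℕ)
          + 3 * b ^ 3 * X * L / (((j + 1) * L : ℕ) : ℝ) ^ 2) := by
          refine mul_le_mul (hcle _) (h1.trans ?_) (norm_nonneg _) (by positivity)
          gcongr
      _ = _ := by
          push_cast
          field_simp
  -- The last block may be incomplete, so its boundary term is only controlled by `X`; as it occurs
  -- once, no logarithm arises.
  have hlast : ‖c J * ∑ i ∈ Finset.range (q + 1), dirichlet m i z / ((J * L + i : ℕ) : ℂ)‖
        ≤ 3 * b ^ 3 * r / L ^ 2 * (2 * X) := by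
    rcases Nat.eq_zero_or_pos J with h0 | hJ0
    · rw [h0, hc0, zero_mul, norm_zero]
      positivity
    · have h1 := norm_sum_dirichlet_div_le hm hb (N := N) (c := J * L) (r := q)
        (Nat.mul_pos hJ0 hL0) hqL.le z
      have h2 := norm_fejerSum_le hm hb hqL.le z
      have hJ1 : (1 : ℝ) ≤ J := by exact_mod_cast hJ0
      have hJL : (L : ℝ) ≤ (J * L : ℕ) := by push_cast; nlinarith
      rw [norm_mul]
      calc _ ≤ r / L * (3 * b ^ 3 * X / L + 3 * b ^ 3 * X * L / L ^ 2) := by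
            refine mul_le_mul (hcle _) (h1.trans ?_) (norm_nonneg _) (by positivity)
            gcongr
        _ = _ := by
            field_simp
            ring
  have hJn : J ≤ n := Nat.div_le_self _ _
  rcases Nat.eq_zero_or_pos J with h0 | hJ0
  · rw [hdecomp, h0, hc0]
    simp only [Finset.range_zero, Finset.sum_empty, zero_mul, add_zero, norm_zero]
    positivity
  · have hLn : L ≤ n := (Nat.le_mul_of_pos_left L hJ0).trans (Nat.div_mul_le_self n L)
    have hNlog : ((N : ℝ) + 1) ≤ 3 * lg := succ_le_log hm hLn
    have hsum : ‖∑ j ∈ Finset.range J,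
        c j * ∑ i ∈ Finset.range L, dirichlet m i z / ((j * L + i : ℕ) : ℂ)‖
          ≤ 3 * b ^ 3 * r / L ^ 2 * (S * (3 * lg) + X * 2) := by
      obtain ⟨K, hK⟩ := Nat.exists_eq_succ_of_ne_zero hJ0.ne'
      rw [hK, Finset.sum_range_succ', hc0, zero_mul, add_zero]
      refine (norm_sum_le _ _).trans ((Finset.sum_le_sum fun j _ => hblock j).trans ?_)
      rw [← Finset.mul_sum, Finset.sum_add_distrib, ← Finset.mul_sum, ← Finset.mul_sum]
      have e1 : ∑ i ∈ Finset.range K, 1 / ((i : ℝ) + 1) ≤ 3 * lg :=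
        (Finset.sum_le_sum_of_subset_of_nonneg (Finset.range_mono (by omega : K ≤ n))
          fun _ _ _ => by positivity).trans (sum_inv_le_log hn)
      have e2 : ∑ i ∈ Finset.range K, 1 / ((i : ℝ) + 1) ^ 2 ≤ 2 :=
        (sum_inv_sq_le K).trans (by have : (0 : ℝ) ≤ 1 / K := by positivity
                                    linarith)
      gcongr
    rw [hdecomp]
    -- The decisive exchange: since `J > 0` means `n ≥ M_N`, a term without logarithm may be given
    -- `log²` in return for `(N + 1)^{-2}`.
    have hX1 : X ≤ 9 * lg ^ 2 * (X / (N + 1) ^ 2) := by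
      rw [mul_div_assoc', le_div_iff₀ (by positivity)]
      nlinarith [mul_le_mul_of_nonneg_left
        (pow_le_pow_left₀ (by positivity) hNlog 2) hX0]
    have hlg2 : 3 * lg ≤ 6 * lg ^ 2 := by nlinarith
    calc _ ≤ 3 * b ^ 3 * r / L ^ 2 * (S * (3 * lg) + X * 2) + 3 * b ^ 3 * r / L ^ 2 * (2 * X) :=
          (norm_add_le _ _).trans (add_le_add hsum hlast)
      _ = 3 * b ^ 3 * r / L ^ 2 * (S * (3 * lg) + 4 * X) := by ring
      _ ≤ 3 * b ^ 3 * r / L ^ 2 * (36 * lg ^ 2 * (S + X / (N + 1) ^ 2)) := by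
          gcongr
          nlinarith [mul_le_mul_of_nonneg_left hlg2 hS0, mul_nonneg hS0 (sq_nonneg lg)]
      _ = _ := by ring

/-- The pointwise estimate of the Riesz logarithmic sums of an atom. -/
theorem norm_rieszSum_atom_le (hm : ∀ k, 2 ≤ m k) {b : ℕ} (hb : ∀ k, m k ≤ b) {n N : ℕ}
    {g : Gm m → ℂ} (hgi : Integrable g (haar m)) {y : Gm m} {r : ℝ} (hg : ∀ t, ‖g t‖ ≤ r)
    (hsupp : ∀ t, t ∉ interval m N y → g t = 0) (hmean : ∫ t, g t ∂haar m = 0)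
    (hn : 1 ≤ n) (x : Gm m) :
    ‖rieszSum m n g x‖ ≤ 120 * b ^ 5 * r * Real.log ((n : ℝ) + 1) ^ 2 / M m N ^ 2
      * (spikeSum m N (x - y) + spikeTotal m N (x - y) / (N + 1) ^ 2) := by
  have hr : 0 ≤ r := (norm_nonneg _).trans (hg 0)
  have hL0 : (0 : ℝ) < M m N := by exact_mod_cast M_pos m N
  have hS0 := spikeSum_nonneg m N (x - y)
  have hX0 := spikeTotal_nonneg m N (x - y)
  have hb1 : (1 : ℝ) ≤ b := by exact_mod_cast (by linarith [hm 0, hb 0] : 1 ≤ b)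
  -- On the support interval the `L¹` bound of the kernel suffices, because `spikeSum` is at least
  -- `M_N²` there.
  by_cases hx : x - y ∈ interval m N 0
  · have h1 := indicator_sq_le_spikeSum m N (x - y)
    rw [Set.indicator_of_mem hx] at h1
    set lg := Real.log ((n : ℝ) + 1)
    have hlg : 1 / 2 ≤ lg := half_le_log_succ hn
    calc _ ≤ 60 * b ^ 5 * r * lg := norm_rieszSum_le hm hb hn hg x
      _ ≤ 60 * b ^ 5 * r * (2 * lg ^ 2) := by
          gcongr
          nlinarith
      _ = 120 * b ^ 5 * r * lg ^ 2 / M m N ^ 2 * (M m N ^ 2) := by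
          field_simp
          ring
      _ ≤ _ := by
          gcongr
          exact h1.trans (le_add_of_nonneg_right (by positivity))
  · refine (norm_rieszSum_le_of_notMem hm hb hgi hg hsupp hmean hx hn).trans ?_
    have hb3 : (b : ℝ) ^ 3 ≤ b ^ 5 := pow_le_pow_right₀ hb1 (by norm_num)
    gcongr
    norm_num

end

/-! ### The weighted maximal operator on integrable functions and on atoms -/

section
variable {m : ℕ → ℕ} [∀ k, NeZero (m k)]

/-- The logarithmically weighted maximal operator of the Riesz means of an integrable function. -/
noncomputable def rieszMax (m : ℕ → ℕ) [∀ k, NeZero (m k)] (g : Gm m → ℂ) (x : Gm m) : ℝ≥0∞ :=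
  ⨆ n : ℕ+, ‖(∑ k ∈ Finset.Icc 1 (n : ℕ), (1 : ℂ) / k)⁻¹ * rieszSum m n g x‖ₑ
    / ENNReal.ofReal (Real.log (((n : ℕ) : ℝ) + 1))

theorem sum_Icc_one_div (n : ℕ) :
    ∑ k ∈ Finset.Icc 1 n, (1 : ℂ) / k = ((∑ i ∈ Finset.range n, 1 / ((i : ℝ) + 1) : ℝ) : ℂ) := by
  induction n with
  | zero => simp
  | succ n ih =>
    rw [Finset.sum_Icc_succ_top (by omega), ih, Finset.sum_range_succ]
    push_cast
    rfl

theorem log_le_sum_inv (n : ℕ) :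
    Real.log ((n : ℝ) + 1) ≤ ∑ i ∈ Finset.range n, 1 / ((i : ℝ) + 1) := by
  have h := log_add_one_le_harmonic n
  have h2 : ((harmonic n : ℚ) : ℝ) = ∑ i ∈ Finset.range n, 1 / ((i : ℝ) + 1) := by
    simp [harmonic]
  rw [← h2]
  exact_mod_cast h

/-- One logarithm is divided out by `l_n ≥ log(n + 1)`, the other by the weight. -/
theorem enorm_rieszMean_div_log_le {n : ℕ+} {w : ℂ} {B : ℝ}
    (h : ‖w‖ ≤ B * Real.log (((n : ℕ) : ℝ) + 1) ^ 2) :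
    ‖(∑ k ∈ Finset.Icc 1 (n : ℕ), (1 : ℂ) / k)⁻¹ * w‖ₑ
      / ENNReal.ofReal (Real.log (((n : ℕ) : ℝ) + 1)) ≤ ENNReal.ofReal B := by
  have hlg := half_le_log_succ (n := (n : ℕ)) n.pos
  have hsum := log_le_sum_inv n
  set lg := Real.log (((n : ℕ) : ℝ) + 1)
  have hlg0 : 0 < lg := by linarith
  rw [← ofReal_norm, ← ENNReal.ofReal_div_of_pos hlg0]
  refine ENNReal.ofReal_le_ofReal ?_
  rw [norm_mul, norm_inv, sum_Icc_one_div, Complex.norm_real, Real.norm_eq_abs,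
    abs_of_pos (hlg0.trans_le hsum), div_le_iff₀ hlg0, inv_mul_le_iff₀ (hlg0.trans_le hsum)]
  have hB : 0 ≤ B := by
    by_contra hB
    have := norm_nonneg w
    nlinarith [mul_pos hlg0 hlg0]
  calc ‖w‖ ≤ B * lg ^ 2 := h
    _ = lg * (B * lg) := by ring
    _ ≤ _ := by gcongr

theorem rieszMax_le_of_norm_le (hm : ∀ k, 2 ≤ m k) {b : ℕ} (hb : ∀ k, m k ≤ b) {g : Gm m → ℂ}
    {r : ℝ} (hg : ∀ t, ‖g t‖ ≤ r) (x : Gm m) :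
    rieszMax m g x ≤ ENNReal.ofReal (120 * b ^ 5 * r) := by
  have hr : 0 ≤ r := (norm_nonneg _).trans (hg 0)
  refine iSup_le fun n => enorm_rieszMean_div_log_le ?_
  have hlg := half_le_log_succ (n := (n : ℕ)) n.pos
  refine (norm_rieszSum_le hm hb n.pos hg x).trans ?_
  set lg := Real.log (((n : ℕ) : ℝ) + 1)
  calc 60 * b ^ 5 * r * lg ≤ 60 * b ^ 5 * r * (2 * lg ^ 2) := by
        gcongr
        nlinarith
    _ = _ := by ring

theorem dependsOnFirst_rieszSum (hm : ∀ k, 2 ≤ m k) (n : ℕ) (g : Gm m → ℂ) :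
    DependsOnFirst m n (rieszSum m n g) := by
  intro x x' hx
  unfold rieszSum
  congr 1
  ext t
  rw [dependsOnFirst_rieszKernel (lt_M m hm n).le (x - t) (x' - t) fun j hj => by
    rw [Pi.sub_apply, Pi.sub_apply, hx j hj]]

theorem measurable_rieszMax (hm : ∀ k, 2 ≤ m k) (g : Gm m → ℂ) : Measurable (rieszMax m g) :=
  Measurable.iSup fun n => ((dependsOnFirst_rieszSum hm n g).comp
    fun w => ‖(∑ k ∈ Finset.Icc 1 (n : ℕ), (1 : ℂ) / k)⁻¹ * w‖ₑ
    / ENNReal.ofReal (Real.log (((n : ℕ) : ℝ) + 1))).measurable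

theorem rieszSum_add (hm : ∀ k, 2 ≤ m k) (n : ℕ) {g h : Gm m → ℂ} (hg : Integrable g (haar m))
    (hh : Integrable h (haar m)) (x : Gm m) :
    rieszSum m n (fun t => g t + h t) x = rieszSum m n g x + rieszSum m n h x := by
  have hd := (dependsOnFirst_rieszKernel (lt_M m hm n).le).shift x
  obtain ⟨C, hC⟩ := hd.exists_norm_le
  unfold rieszSum
  simp_rw [add_mul]
  exact integral_add (hg.mul_bdd hd.measurable.aestronglyMeasurable (ae_of_all _ hC))
    (hh.mul_bdd hd.measurable.aestronglyMeasurable (ae_of_all _ hC))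

theorem rieszMax_add_le (hm : ∀ k, 2 ≤ m k) {g h : Gm m → ℂ} (hg : Integrable g (haar m))
    (hh : Integrable h (haar m)) (x : Gm m) :
    rieszMax m (fun t => g t + h t) x ≤ rieszMax m g x + rieszMax m h x := by
  refine iSup_le fun n => ?_
  rw [rieszSum_add hm n hg hh, mul_add]
  refine (ENNReal.div_le_div_right (enorm_add_le _ _) _).trans ?_
  rw [ENNReal.add_div]
  exact add_le_add (le_iSup (fun n : ℕ+ => ‖(∑ k ∈ Finset.Icc 1 (n : ℕ), (1 : ℂ) / k)⁻¹
      * rieszSum m n g x‖ₑ / ENNReal.ofReal (Real.log (((n : ℕ) : ℝ) + 1))) n)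
    (le_iSup (fun n : ℕ+ => ‖(∑ k ∈ Finset.Icc 1 (n : ℕ), (1 : ℂ) / k)⁻¹
      * rieszSum m n h x‖ₑ / ENNReal.ofReal (Real.log (((n : ℕ) : ℝ) + 1))) n)

theorem rieszMax_zero (x : Gm m) : rieszMax m (fun _ => 0) x = 0 := by
  simp [rieszMax, rieszSum]

/-- The square root is subadditive, so these integrals add with constant 1 and any finite number of
atoms can be summed without loss. -/
theorem lintegral_rpow_rieszMax_add_le (hm : ∀ k, 2 ≤ m k) {g h : Gm m → ℂ}
    (hg : Integrable g (haar m)) (hh : Integrable h (haar m)) :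
    ∫⁻ x, rieszMax m (fun t => g t + h t) x ^ (1 / 2 : ℝ) ∂haar m
      ≤ ∫⁻ x, rieszMax m g x ^ (1 / 2 : ℝ) ∂haar m
        + ∫⁻ x, rieszMax m h x ^ (1 / 2 : ℝ) ∂haar m := by
  rw [← lintegral_add_left ((measurable_rieszMax hm g).pow_const _)]
  refine lintegral_mono fun x => ?_
  exact (ENNReal.rpow_le_rpow (rieszMax_add_le hm hg hh x) (by norm_num)).trans
    (ENNReal.rpow_add_le_add_rpow _ _ (by norm_num) (by norm_num))

theorem lintegral_rpow_rieszMax_sum_le (hm : ∀ k, 2 ≤ m k) {ι : Type*} (s : Finset ι)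
    {g : ι → Gm m → ℂ} (hg : ∀ i ∈ s, Integrable (g i) (haar m)) :
    ∫⁻ x, rieszMax m (fun t => ∑ i ∈ s, g i t) x ^ (1 / 2 : ℝ) ∂haar m
      ≤ ∑ i ∈ s, ∫⁻ x, rieszMax m (g i) x ^ (1 / 2 : ℝ) ∂haar m := by
  classical
  induction s using Finset.induction_on with
  | empty => simp [rieszMax_zero]
  | insert i s hi ih =>
    simp_rw [Finset.sum_insert hi]
    have h := fun j hj => hg j (Finset.mem_insert_of_mem hj)
    exact (lintegral_rpow_rieszMax_add_le hm (hg i (Finset.mem_insert_self i s))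
      (integrable_finsetSum _ h)).trans (add_le_add le_rfl (ih h))

/-- The constant in the atomic estimate. -/
noncomputable def atomConst (b : ℕ) : ℝ≥0∞ :=
  ENNReal.ofReal (120 * b ^ 5) ^ (1 / 2 : ℝ) * (8 * b)

theorem atomConst_ne_top (b : ℕ) : atomConst b ≠ ∞ := by
  refine ENNReal.mul_ne_top (ENNReal.rpow_ne_top_of_nonneg (by norm_num) ENNReal.ofReal_ne_top) ?_
  exact ENNReal.mul_ne_top (by simp) (ENNReal.natCast_ne_top b)

theorem ofReal_sq_rpow_half {a : ℝ} (ha : 0 ≤ a) :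
    ENNReal.ofReal (a ^ 2) ^ (1 / 2 : ℝ) = ENNReal.ofReal a := by
  rw [ENNReal.ofReal_rpow_of_nonneg (by positivity) (by norm_num), ← Real.sqrt_eq_rpow,
    Real.sqrt_sq ha]

/-- Under the square root, `M_N^{-2}` becomes `M_N⁻¹`, the measure of the interval, and `(N +
1)^{-2}` becomes `(N + 1)⁻¹`, which cancels the growth of the `spikeTotal` integral. Both majorants
then contribute `4 b`, whence `8 b` in `atomConst`. -/
theorem lintegral_rpow_rieszMax_atom_le (hm : ∀ k, 2 ≤ m k) {b : ℕ} (hb : ∀ k, m k ≤ b) {N : ℕ}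
    {g : Gm m → ℂ} (hgi : Integrable g (haar m)) {y : Gm m} {r : ℝ} (hg : ∀ t, ‖g t‖ ≤ r)
    (hsupp : ∀ t, t ∉ interval m N y → g t = 0) (hmean : ∫ t, g t ∂haar m = 0) :
    ∫⁻ x, rieszMax m g x ^ (1 / 2 : ℝ) ∂haar m
      ≤ atomConst b * ENNReal.ofReal r ^ (1 / 2 : ℝ) * haar m (interval m N y) := by
  have hr : 0 ≤ r := (norm_nonneg _).trans (hg 0)
  have hL0 : (0 : ℝ) < M m N := by exact_mod_cast M_pos m N
  set c : ℝ≥0∞ := ENNReal.ofReal (120 * b ^ 5) ^ (1 / 2 : ℝ) * ENNReal.ofReal r ^ (1 / 2 : ℝ)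
    * (M m N : ℝ≥0∞)⁻¹ with hc
  have hNinv : ENNReal.ofReal (((N : ℝ) + 1)⁻¹) = ((N : ℝ≥0∞) + 1)⁻¹ := by
    rw [ENNReal.ofReal_inv_of_pos (by positivity), ENNReal.ofReal_add (by positivity) zero_le_one,
      ENNReal.ofReal_natCast, ENNReal.ofReal_one]
  have hpt : ∀ x, rieszMax m g x ^ (1 / 2 : ℝ)
      ≤ c * (ENNReal.ofReal (spikeSum m N (x - y)) ^ (1 / 2 : ℝ)
        + ENNReal.ofReal (spikeTotal m N (x - y)) ^ (1 / 2 : ℝ) * ((N : ℝ≥0∞) + 1)⁻¹) := by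
    intro x
    have hS0 := spikeSum_nonneg m N (x - y)
    have hX0 := spikeTotal_nonneg m N (x - y)
    have h1 : rieszMax m g x ≤ ENNReal.ofReal (120 * b ^ 5 * r * (((M m N : ℝ))⁻¹) ^ 2
        * (spikeSum m N (x - y) + spikeTotal m N (x - y) * (((N : ℝ) + 1)⁻¹) ^ 2)) := by
      refine iSup_le fun n => enorm_rieszMean_div_log_le ?_
      refine (norm_rieszSum_atom_le hm hb hgi hg hsupp hmean n.pos x).trans (le_of_eq ?_)
      field_simp
    refine (ENNReal.rpow_le_rpow h1 (by norm_num)).trans ?_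
    rw [ENNReal.ofReal_mul (by positivity), ENNReal.ofReal_mul (by positivity),
      ENNReal.ofReal_mul (by positivity), ENNReal.mul_rpow_of_nonneg _ _ (by norm_num),
      ENNReal.mul_rpow_of_nonneg _ _ (by norm_num), ENNReal.mul_rpow_of_nonneg _ _ (by norm_num),
      ofReal_sq_rpow_half (by positivity), ENNReal.ofReal_inv_of_pos hL0, ENNReal.ofReal_natCast]
    refine mul_le_mul_right ?_ c
    rw [ENNReal.ofReal_add hS0 (by positivity)]
    refine (ENNReal.rpow_add_le_add_rpow _ _ (by norm_num) (by norm_num)).trans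
      (add_le_add le_rfl (le_of_eq ?_))
    rw [ENNReal.ofReal_mul hX0, ENNReal.mul_rpow_of_nonneg _ _ (by norm_num),
      ofReal_sq_rpow_half (by positivity), hNinv]
  have hctop : c ≠ ∞ := by
    refine ENNReal.mul_ne_top (ENNReal.mul_ne_top ?_ ?_) ?_
    · exact ENNReal.rpow_ne_top_of_nonneg (by norm_num) ENNReal.ofReal_ne_top
    · exact ENNReal.rpow_ne_top_of_nonneg (by norm_num) ENNReal.ofReal_ne_top
    · exact ENNReal.inv_ne_top.2 (by exact_mod_cast (M_pos m N).ne')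
  have hN0 : ((N : ℝ≥0∞) + 1) ≠ 0 := by simp
  have hNt : ((N : ℝ≥0∞) + 1) ≠ ∞ := by simp
  have hmeas : Measurable fun x => ENNReal.ofReal (spikeSum m N (x - y)) ^ (1 / 2 : ℝ) := by
    simp_rw [ofReal_spikeSum]
    exact (Finset.measurable_fun_sum _ fun s _ => measurable_spike_shift s N y _).pow_const _
  calc _ ≤ ∫⁻ x, c * (ENNReal.ofReal (spikeSum m N (x - y)) ^ (1 / 2 : ℝ)
        + ENNReal.ofReal (spikeTotal m N (x - y)) ^ (1 / 2 : ℝ) * ((N : ℝ≥0∞) + 1)⁻¹) ∂haar m :=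
        lintegral_mono hpt
    _ = c * (∫⁻ x, ENNReal.ofReal (spikeSum m N (x - y)) ^ (1 / 2 : ℝ) ∂haar m
        + (∫⁻ x, ENNReal.ofReal (spikeTotal m N (x - y)) ^ (1 / 2 : ℝ) ∂haar m)
          * ((N : ℝ≥0∞) + 1)⁻¹) := by
        rw [lintegral_const_mul' _ _ hctop, lintegral_add_left hmeas,
          lintegral_mul_const' _ _ (ENNReal.inv_ne_top.2 hN0)]
    _ ≤ c * (4 * b + 4 * b * (N + 1) * ((N : ℝ≥0∞) + 1)⁻¹) := by
        gcongr
        · exact lintegral_rpow_spikeSum_shift_le hm hb N y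
        · exact lintegral_rpow_spikeTotal_shift_le hm hb N y
    _ = c * (8 * b) := by
        rw [mul_assoc (4 * b : ℝ≥0∞), ENNReal.mul_inv_cancel hN0 hNt, mul_one]
        ring
    _ = _ := by
        rw [haar_interval, hc, atomConst]
        ring

/-! ### Predictable stopping -/

/-- The points at which the martingale `f` has not yet exceeded the level `r`, predictably,
before time `n`. -/
def live (m : ℕ → ℕ) (f : ℕ → Gm m → ℂ) (r : ℝ) (n : ℕ) : Set (Gm m) :=
  {x | ∀ j < n, ∀ y ∈ interval m j x, ‖f (j + 1) y‖ ≤ r}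

/-- The points at which `f` is predictably about to exceed the level `r` for the first time at
time `n`. -/
def exit (m : ℕ → ℕ) (f : ℕ → Gm m → ℂ) (r : ℝ) (n : ℕ) : Set (Gm m) :=
  live m f r n \ live m f r (n + 1)

/-- The martingale `f` stopped before it exceeds the level `r`, at time `N`. -/
noncomputable def stopped (m : ℕ → ℕ) (f : ℕ → Gm m → ℂ) (r : ℝ) (N : ℕ) (x : Gm m) : ℂ :=
  f 0 x + ∑ n ∈ Finset.range N, (live m f r (n + 1)).indicator (fun x => f (n + 1) x - f n x) x

end

section stopping
variable {m : ℕ → ℕ} {f : ℕ → Gm m → ℂ} {r r' : ℝ}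

theorem live_anti {n k : ℕ} (h : n ≤ k) : live m f r k ⊆ live m f r n :=
  fun _ hx j hj => hx j (hj.trans_le h)

theorem live_mono (h : r ≤ r') (n : ℕ) : live m f r n ⊆ live m f r' n :=
  fun _ hx j hj y hy => (hx j hj y hy).trans h

theorem live_zero : live m f r 0 = Set.univ := by simp [live]

/-- Predictability: the condition at time `j` quantifies over the whole interval `I_j(x)`, so
although it concerns `f (j + 1)` it depends on `j` coordinates only. Hence the index `k + 1` on the
left. -/
theorem dependsOnFirst_live {n k : ℕ} (h : n ≤ k + 1) :
    DependsOnFirst m k (· ∈ live m f r n) := by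
  intro x z hz
  refine propext (forall_congr' fun j => forall_congr' fun hj => ?_)
  rw [interval_eq_of_mem (interval_anti m x (by omega : j ≤ k) hz)]

theorem dependsOnFirst_exit (n : ℕ) : DependsOnFirst m n (· ∈ exit m f r n) :=
  (dependsOnFirst_live (Nat.le_succ n)).comp₂ (dependsOnFirst_live le_rfl) (fun p q => p ∧ ¬ q)

theorem stopped_succ (N : ℕ) (x : Gm m) : stopped m f r (N + 1) x = stopped m f r N x
    + (live m f r (N + 1)).indicator (fun x => f (N + 1) x - f N x) x := by
  rw [stopped, Finset.sum_range_succ, ← add_assoc, stopped]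

theorem stopped_eq_of_mem_live {N : ℕ} {x : Gm m} (hx : x ∈ live m f r N) :
    stopped m f r N x = f N x := by
  induction N with
  | zero => simp [stopped]
  | succ N ih =>
    rw [stopped_succ, ih (live_anti (Nat.le_succ N) hx), Set.indicator_of_mem hx]
    ring

/-- Because exits are announced one step ahead, the jump that could pass the level `r` is never
taken. -/
theorem norm_stopped_le (h0 : ∀ x, ‖f 0 x‖ ≤ r) (N : ℕ) (x : Gm m) :
    ‖stopped m f r N x‖ ≤ r := by
  induction N with
  | zero => simpa [stopped] using h0 x
  | succ N ih =>
    by_cases hx : x ∈ live m f r (N + 1)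
    · rw [stopped_eq_of_mem_live hx]
      exact hx N (Nat.lt_succ_self N) x (mem_interval_self m N x)
    · rwa [stopped_succ, Set.indicator_of_notMem hx, add_zero]

theorem sum_indicator_exit (u : Gm m → ℂ) (N : ℕ) (x : Gm m) :
    ∑ n ∈ Finset.range N, (exit m f r n).indicator u x + (live m f r N).indicator u x = u x := by
  classical
  induction N with
  | zero => simp [live_zero]
  | succ N ih =>
    rw [Finset.sum_range_succ, ← ih, add_assoc]
    congr 1
    have h := @live_anti m f r N (N + 1) (Nat.le_succ N) x
    by_cases h1 : x ∈ live m f r N <;> by_cases h2 : x ∈ live m f r (N + 1) <;>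
      simp_all [exit, Set.indicator]

theorem dependsOnFirst_stopped (hf : ∀ n, DependsOnFirst m n (f n)) (N : ℕ) :
    DependsOnFirst m N (stopped m f r N) := by
  refine ((hf 0).mono N.zero_le).comp₂ (DependsOnFirst.sum fun n hn => ?_) (· + ·)
  have hn := Finset.mem_range.1 hn
  exact ((dependsOnFirst_live le_rfl).mono hn.le).indicator
    (((hf (n + 1)).mono hn).comp₂ ((hf n).mono hn.le) (· - ·))

variable [∀ k, NeZero (m k)]

/-- Supplies the mean-zero property of the atoms. Before time `n` both stopped martingales have the
same increments on `S`. From time `n` on the one at level `r` is frozen, and the remaining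
increments are integrated over `S ∩ live m f r' (j + 1)`, a set known at time `j`. -/
theorem setIntegral_stopped_sub_eq_zero (hf : ∀ n, DependsOnFirst m n (f n))
    (hmart : ∀ n, ∀ S, DependsOnFirst m n (· ∈ S) →
      ∫ x in S, f n x ∂haar m = ∫ x in S, f (n + 1) x ∂haar m)
    (hrr : r ≤ r') {n N : ℕ} {S : Set (Gm m)} (hS : DependsOnFirst m n (· ∈ S))
    (hSexit : S ⊆ exit m f r n) :
    ∫ x in S, (stopped m f r' N x - stopped m f r N x) ∂haar m = 0 := by
  have hSm : MeasurableSet S := intervalAlgebra_le m n _ hS.measurableSet'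
  have hd : ∀ j, DependsOnFirst m (j + 1) fun x => f (j + 1) x - f j x := fun j =>
    (hf (j + 1)).comp₂ ((hf j).mono (Nat.le_succ j)) (· - ·)
  have hdi : ∀ (q : ℝ) j, Integrable
      ((live m f q (j + 1)).indicator fun x => f (j + 1) x - f j x) (haar m) := fun q j =>
    (((dependsOnFirst_live le_rfl).mono (Nat.le_succ j)).indicator (hd j)).integrable
  have e : ∀ x, stopped m f r' N x - stopped m f r N x = ∑ j ∈ Finset.range N,
      ((live m f r' (j + 1)).indicator (fun x => f (j + 1) x - f j x) x
        - (live m f r (j + 1)).indicator (fun x => f (j + 1) x - f j x) x) := by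
    intro x
    rw [stopped, stopped, Finset.sum_sub_distrib]
    ring
  have hsubi : ∀ j, Integrable (fun x =>
      (live m f r' (j + 1)).indicator (fun x => f (j + 1) x - f j x) x
        - (live m f r (j + 1)).indicator (fun x => f (j + 1) x - f j x) x)
      ((haar m).restrict S) := fun j => ((hdi r' j).sub (hdi r j)).integrableOn
  simp_rw [e]
  rw [integral_finsetSum _ fun j _ => hsubi j]
  refine Finset.sum_eq_zero fun j _ => ?_
  rcases lt_or_ge j n with hjn | hjn
  · rw [setIntegral_congr_fun (g := fun _ => 0) hSm, integral_zero]
    intro x hx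
    have h1 : x ∈ live m f r (j + 1) := live_anti hjn (hSexit hx).1
    simp only
    rw [Set.indicator_of_mem h1, Set.indicator_of_mem (live_mono hrr _ h1), sub_self]
  · have hSl : DependsOnFirst m j (· ∈ S ∩ live m f r' (j + 1)) :=
      (hS.mono hjn).comp₂ (dependsOnFirst_live le_rfl) (fun p q => p ∧ q)
    rw [setIntegral_congr_fun
      (g := (live m f r' (j + 1)).indicator fun x => f (j + 1) x - f j x) hSm,
      setIntegral_indicator (intervalAlgebra_le m j _
        (dependsOnFirst_live le_rfl).measurableSet'),
      integral_sub (hf (j + 1)).integrable.integrableOn (hf j).integrable.integrableOn,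
      hmart j _ hSl, sub_self]
    intro x hx
    have h1 : x ∉ live m f r (j + 1) := fun h => (hSexit hx).2 (live_anti (by omega) h)
    simp only
    rw [Set.indicator_of_notMem h1, sub_zero]

theorem haar_eq_sum_interval (n : ℕ) {S : Set (Gm m)} (hS : MeasurableSet S) :
    haar m S = ∑ v : Prefix m n, haar m (S ∩ interval m n (extend m n v)) := by
  rw [← lintegral_indicator_one hS, lintegral_eq_sum_interval n]
  refine Finset.sum_congr rfl fun v _ => ?_
  rw [setLIntegral_indicator hS, Pi.one_def, setLIntegral_one]

/-- Each interval of order `n` in the exit set contains one of order `n + 1` on which `|f (n + 1)| >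
r`, and the latter has at least the fraction `1/b` of the measure. Boundedness of `m` thus makes the
predictable exit comparable with the actual one. -/
theorem haar_exit_le {b : ℕ} (hb : ∀ k, m k ≤ b) (hf : ∀ n, DependsOnFirst m n (f n)) (n : ℕ) :
    haar m (exit m f r n) ≤ b * haar m (exit m f r n ∩ {x | r < ‖f (n + 1) x‖}) := by
  have hE := dependsOnFirst_exit (f := f) (r := r) n
  have hEm : MeasurableSet (exit m f r n) := intervalAlgebra_le m n _ hE.measurableSet'
  have hB : DependsOnFirst m (n + 1) (· ∈ {x | r < ‖f (n + 1) x‖}) :=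
    (hf (n + 1)).comp (fun w => r < ‖w‖)
  have hBm : MeasurableSet {x | r < ‖f (n + 1) x‖} := intervalAlgebra_le m _ _ hB.measurableSet'
  rw [haar_eq_sum_interval n hEm, haar_eq_sum_interval n (hEm.inter hBm), Finset.mul_sum]
  refine Finset.sum_le_sum fun v _ => ?_
  rcases (exit m f r n ∩ interval m n (extend m n v)).eq_empty_or_nonempty with h | ⟨x, hx, hxv⟩
  · simp [h]
  · obtain ⟨y, hy, hyr⟩ : ∃ y ∈ interval m n x, r < ‖f (n + 1) y‖ := by
      by_contra! hcon
      refine hx.2 fun j hj y hy => ?_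
      rcases Nat.lt_succ_iff_lt_or_eq.1 hj with h | rfl
      · exact hx.1 j h y hy
      · exact hcon y hy
    have hsub : interval m (n + 1) y ⊆
        exit m f r n ∩ {x | r < ‖f (n + 1) x‖} ∩ interval m n (extend m n v) := by
      intro z hz
      have hzx : z ∈ interval m n x := by
        rw [← interval_eq_of_mem hy]
        exact interval_anti m y (Nat.le_succ n) hz
      refine ⟨⟨(hE x z hzx).mpr hx, (hB y z hz).mpr hyr⟩, ?_⟩
      rwa [← interval_eq_of_mem hxv]
    calc _ ≤ haar m (interval m n (extend m n v)) := measure_mono Set.inter_subset_right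
      _ ≤ b * haar m (interval m (n + 1) y) := by
          have hmn : (m n : ℝ≥0∞) ≠ 0 := by exact_mod_cast NeZero.ne (m n)
          have hbn : (m n : ℝ≥0∞) ≤ b := by exact_mod_cast hb n
          rw [haar_interval, haar_interval, M, Nat.cast_mul,
            ENNReal.mul_inv (Or.inl hmn) (Or.inl (ENNReal.natCast_ne_top _)), ← mul_assoc]
          refine le_mul_of_one_le_left zero_le ?_
          rw [← ENNReal.mul_inv_cancel hmn (ENNReal.natCast_ne_top _)]
          gcongr
      _ ≤ _ := by gcongr

theorem sum_haar_exit_le (hr : 0 ≤ r) {b : ℕ} (hb : ∀ k, m k ≤ b)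
    (hf : ∀ n, DependsOnFirst m n (f n))
    (N : ℕ) :
    ∑ n ∈ Finset.range N, haar m (exit m f r n)
      ≤ b * haar m {x | ENNReal.ofReal r < maximalFunction m f x} := by
  have hmeas : ∀ n, MeasurableSet (exit m f r n ∩ {x | r < ‖f (n + 1) x‖}) := fun n =>
    (intervalAlgebra_le m n _ (dependsOnFirst_exit n).measurableSet').inter
      (intervalAlgebra_le m (n + 1) _ (DependsOnFirst.measurableSet'
        ((hf (n + 1)).comp (fun w => r < ‖w‖))))
  calc _ ≤ ∑ n ∈ Finset.range N, b * haar m (exit m f r n ∩ {x | r < ‖f (n + 1) x‖}) :=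
        Finset.sum_le_sum fun n _ => haar_exit_le hb hf n
    _ = b * haar m (⋃ n ∈ Finset.range N, exit m f r n ∩ {x | r < ‖f (n + 1) x‖}) := by
        rw [← Finset.mul_sum, measure_biUnion_finset _ fun n _ => hmeas n]
        have hlt : ∀ n k, n < k → Disjoint (exit m f r n) (exit m f r k) := fun n k h =>
          Set.disjoint_left.2 fun x hx hx' => hx.2 (live_anti h hx'.1)
        intro n _ k _ hnk
        refine Disjoint.mono Set.inter_subset_left Set.inter_subset_left ?_
        rcases lt_or_gt_of_ne hnk with h | h
        · exact hlt n k h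
        · exact (hlt k n h).symm
    _ ≤ _ := by
        gcongr
        refine Set.iUnion₂_subset fun n _ x hx => ?_
        refine lt_of_lt_of_le ?_ (le_iSup (fun n => ‖f n x‖ₑ) (n + 1))
        rw [← ofReal_norm]
        exact (ENNReal.ofReal_lt_ofReal_iff (hr.trans_lt hx.2)).2 hx.2

end stopping

/-! ### From atoms to the Hardy space estimate -/

section
variable {m : ℕ → ℕ} [∀ k, NeZero (m k)] {f : ℕ → Gm m → ℂ}

/-- The exit sets at level `r` are disjoint unions of intervals. Restricted to each such interval
the difference is an atom bounded by `r' + r`, and the measures of the intervals sum to at most `b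
μ{f* > r}`. -/
theorem lintegral_rpow_rieszMax_stopped_sub_le (hm : ∀ k, 2 ≤ m k) {b : ℕ} (hb : ∀ k, m k ≤ b)
    (hf : ∀ n, DependsOnFirst m n (f n))
    (hmart : ∀ n, ∀ S, DependsOnFirst m n (· ∈ S) →
      ∫ x in S, f n x ∂haar m = ∫ x in S, f (n + 1) x ∂haar m)
    {r r' : ℝ} (h0 : ∀ x, ‖f 0 x‖ ≤ r) (hrr : r ≤ r') (N : ℕ) :
    ∫⁻ x, rieszMax m (fun t => stopped m f r' N t - stopped m f r N t) x ^ (1 / 2 : ℝ) ∂haar m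
      ≤ atomConst b * ENNReal.ofReal (r' + r) ^ (1 / 2 : ℝ)
        * (b * haar m {x | ENNReal.ofReal r < maximalFunction m f x}) := by
  have hr : 0 ≤ r := (norm_nonneg _).trans (h0 0)
  set u : Gm m → ℂ := fun t => stopped m f r' N t - stopped m f r N t with hu
  have hud : DependsOnFirst m N u :=
    (dependsOnFirst_stopped hf N).comp₂ (dependsOnFirst_stopped hf N) (· - ·)
  have hub : ∀ t, ‖u t‖ ≤ r' + r := fun t => (norm_sub_le _ _).trans
    (add_le_add (norm_stopped_le (fun x => (h0 x).trans hrr) N t) (norm_stopped_le h0 N t))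
  have hEm : ∀ n, MeasurableSet (exit m f r n) := fun n =>
    intervalAlgebra_le m n _ (dependsOnFirst_exit n).measurableSet'
  have hsplit : ∀ n t, (exit m f r n).indicator u t = ∑ v : Prefix m n,
      (exit m f r n ∩ interval m n (extend m n v)).indicator u t := by
    classical
    intro n t
    rw [Finset.sum_eq_single (fun j : Fin n => t j)]
    · have := self_mem_interval_extend (n := n) t
      simp only [Set.indicator, Set.mem_inter_iff, this, and_true]
    · intro v _ hv
      refine Set.indicator_of_notMem (fun h => hv ?_) _
      exact (mem_interval_extend.1 h.2).symm
    · simp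
  have hpieces : u = fun t => ∑ n ∈ Finset.range N, ∑ v : Prefix m n,
      (exit m f r n ∩ interval m n (extend m n v)).indicator u t := by
    ext t
    simp_rw [← hsplit]
    have h := sum_indicator_exit (f := f) (r := r) u N t
    -- Where level `r` has not been left, both stopped martingales equal `f N`.
    have hz : (live m f r N).indicator u t = 0 := by
      by_cases ht : t ∈ live m f r N
      · rw [Set.indicator_of_mem ht, hu]
        simp only
        rw [stopped_eq_of_mem_live ht, stopped_eq_of_mem_live (live_mono hrr N ht), sub_self]
      · exact Set.indicator_of_notMem ht _
    rw [hz, add_zero] at h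
    exact h.symm
  have hint : ∀ n (v : Prefix m n), Integrable
      ((exit m f r n ∩ interval m n (extend m n v)).indicator u) (haar m) := fun n v =>
    hud.integrable.indicator ((hEm n).inter (measurableSet_interval m n _))
  have hatom : ∀ n (v : Prefix m n),
      ∫⁻ x, rieszMax m ((exit m f r n ∩ interval m n (extend m n v)).indicator u) x
        ^ (1 / 2 : ℝ) ∂haar m
      ≤ atomConst b * ENNReal.ofReal (r' + r) ^ (1 / 2 : ℝ)
        * haar m (exit m f r n ∩ interval m n (extend m n v)) := by
    intro n v
    have hE := dependsOnFirst_exit (f := f) (r := r) n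
    rcases (exit m f r n ∩ interval m n (extend m n v)).eq_empty_or_nonempty with h | ⟨x, hx, hxv⟩
    · rw [h, Set.indicator_empty]
      simp [rieszMax_zero]
    · have heq : exit m f r n ∩ interval m n (extend m n v) = interval m n (extend m n v) := by
        refine Set.inter_eq_right.2 fun z hz => (hE x z ?_).mpr hx
        rwa [interval_eq_of_mem hxv]
      rw [heq]
      refine lintegral_rpow_rieszMax_atom_le hm hb (heq ▸ hint n v) (fun t => ?_)
        (fun t ht => Set.indicator_of_notMem ht _) ?_
      · rw [norm_indicator_eq_indicator_norm]
        exact (Set.indicator_le_self' (fun _ _ => norm_nonneg _) t).trans (hub t)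
      · rw [integral_indicator (measurableSet_interval m n _)]
        exact setIntegral_stopped_sub_eq_zero hf hmart hrr (dependsOnFirst_interval m n _)
          (Set.inter_eq_right.1 heq)
  calc _ = ∫⁻ x, rieszMax m (fun t => ∑ n ∈ Finset.range N, ∑ v : Prefix m n,
      (exit m f r n ∩ interval m n (extend m n v)).indicator u t) x ^ (1 / 2 : ℝ) ∂haar m := by
        rw [← hpieces]
    _ ≤ ∑ n ∈ Finset.range N, ∑ v : Prefix m n,
        ∫⁻ x, rieszMax m ((exit m f r n ∩ interval m n (extend m n v)).indicator u) x
        ^ (1 / 2 : ℝ) ∂haar m := by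
        refine (lintegral_rpow_rieszMax_sum_le hm _
          fun n _ => integrable_finsetSum _ fun v _ => hint n v).trans ?_
        exact Finset.sum_le_sum fun n _ => lintegral_rpow_rieszMax_sum_le hm _
          fun v _ => hint n v
    _ ≤ ∑ n ∈ Finset.range N, ∑ v : Prefix m n, atomConst b
        * ENNReal.ofReal (r' + r) ^ (1 / 2 : ℝ)
        * haar m (exit m f r n ∩ interval m n (extend m n v)) :=
        Finset.sum_le_sum fun n _ => Finset.sum_le_sum fun v _ => hatom n v
    _ = atomConst b * ENNReal.ofReal (r' + r) ^ (1 / 2 : ℝ)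
        * ∑ n ∈ Finset.range N, haar m (exit m f r n) := by
        rw [Finset.mul_sum]
        refine Finset.sum_congr rfl fun n _ => ?_
        rw [← Finset.mul_sum, ← haar_eq_sum_interval n (hEm n)]
    _ ≤ _ := by
        gcongr
        exact sum_haar_exit_le hr hb hf N

/-- Discrete layer cake: the terms present form a geometric progression whose largest member is
below `F`. -/
theorem sum_two_pow_indicator_le (a F : ℝ≥0∞) (P : ℕ) :
    ∑ k ∈ Finset.range P, (Set.Ioi (2 ^ k * a)).indicator (fun _ => 2 ^ k * a) F ≤ 2 * F := by
  induction P with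
  | zero => simp
  | succ P ih =>
    by_cases h : F ∈ Set.Ioi (2 ^ P * a)
    · have h1 : ∀ k ∈ Finset.range (P + 1),
          (Set.Ioi (2 ^ k * a)).indicator (fun _ => 2 ^ k * a) F ≤ 2 ^ k * a := fun k _ =>
        Set.indicator_le_self' (fun _ _ => zero_le) F
      refine (Finset.sum_le_sum h1).trans ?_
      calc ∑ k ∈ Finset.range (P + 1), 2 ^ k * a
          = ((∑ k ∈ Finset.range (P + 1), 2 ^ k : ℕ) : ℝ≥0∞) * a := by
            rw [← Finset.sum_mul]
            push_cast
            rfl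
        _ ≤ ((2 * 2 ^ P : ℕ) : ℝ≥0∞) * a := by
            gcongr
            rw [← pow_succ']
            exact (Nat.geomSum_lt le_rfl fun k hk => Finset.mem_range.1 hk).le
        _ = 2 * (2 ^ P * a) := by push_cast; ring
        _ ≤ 2 * F := by
            have h2 : 2 ^ P * a ≤ F := le_of_lt h
            gcongr
    · rw [Finset.sum_range_succ, Set.indicator_of_notMem h, add_zero]
      exact ih

theorem measurable_maximalFunction (hf : ∀ n, DependsOnFirst m n (f n)) :
    Measurable (maximalFunction m f) :=
  Measurable.iSup fun n => ((hf n).comp fun w => ‖w‖ₑ).measurable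

theorem lintegral_rpow_rieszMax_le_add (hm : ∀ k, 2 ≤ m k) {b : ℕ} (hb : ∀ k, m k ≤ b)
    (hf : ∀ n, DependsOnFirst m n (f n))
    (hmart : ∀ n, ∀ S, DependsOnFirst m n (· ∈ S) →
      ∫ x in S, f n x ∂haar m = ∫ x in S, f (n + 1) x ∂haar m)
    {r : ℝ} (hr0 : 0 < r) (h0 : ∀ x, ‖f 0 x‖ ≤ r) (N : ℕ) :
    ∫⁻ x, rieszMax m (f N) x ^ (1 / 2 : ℝ) ∂haar m
      ≤ ENNReal.ofReal (120 * b ^ 5) ^ (1 / 2 : ℝ) * ENNReal.ofReal r ^ (1 / 2 : ℝ)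
        + atomConst b * 3 * b * (2 * ∫⁻ x, maximalFunction m f x ^ (1 / 2 : ℝ) ∂haar m) := by
  -- The functions `f 0, …, f N` are bounded, so finitely many levels recover `f N` and the
  -- decomposition raises no convergence question. The ratio 4 becomes 2 under the square root.
  obtain ⟨P, hP⟩ : ∃ P : ℕ, live m f (4 ^ P * r) N = Set.univ := by
    choose C hC using fun n => (hf n).exists_norm_le
    obtain ⟨P, hP⟩ := pow_unbounded_of_one_lt
      ((∑ n ∈ Finset.range (N + 1), |C n|) / r) (by norm_num : (1 : ℝ) < 4)
    rw [div_lt_iff₀ hr0] at hP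
    refine ⟨P, Set.eq_univ_of_forall fun x j hj y _ => (hC (j + 1) y).trans ?_⟩
    refine (le_abs_self _).trans (le_trans ?_ hP.le)
    exact Finset.single_le_sum (f := fun n => |C n|) (fun _ _ => abs_nonneg _)
      (Finset.mem_range.2 (by omega))
  have hle : ∀ k : ℕ, r ≤ 4 ^ k * r := fun k =>
    le_mul_of_one_le_left hr0.le (one_le_pow₀ (by norm_num))
  have htel : f N = fun t => stopped m f r N t + ∑ k ∈ Finset.range P,
      (stopped m f (4 ^ (k + 1) * r) N t - stopped m f (4 ^ k * r) N t) := by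
    ext t
    rw [Finset.sum_range_sub (fun k => stopped m f (4 ^ k * r) N t), pow_zero, one_mul,
      stopped_eq_of_mem_live (r := 4 ^ P * r) (by rw [hP]; trivial)]
    ring
  have hi : ∀ q, Integrable (stopped m f q N) (haar m) := fun q =>
    (dependsOnFirst_stopped hf N).integrable
  set A := ENNReal.ofReal r ^ (1 / 2 : ℝ) with hA
  have hpow : ∀ k : ℕ, ENNReal.ofReal (4 ^ k * r) ^ (1 / 2 : ℝ) = 2 ^ k * A := by
    intro k
    rw [ENNReal.ofReal_mul (by positivity), ENNReal.mul_rpow_of_nonneg _ _ (by norm_num),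
      show (4 : ℝ) ^ k = (2 ^ k) ^ 2 by rw [← pow_mul, mul_comm, pow_mul]; norm_num,
      ofReal_sq_rpow_half (by positivity), ENNReal.ofReal_pow (by norm_num)]
    simp [hA]
  have hset : ∀ k : ℕ, {x | ENNReal.ofReal (4 ^ k * r) < maximalFunction m f x}
      = {x | 2 ^ k * A < maximalFunction m f x ^ (1 / 2 : ℝ)} := by
    intro k
    ext x
    simp only [Set.mem_ofPred_eq]
    rw [← hpow, ENNReal.rpow_lt_rpow_iff (by norm_num)]
  have hmaxm := (measurable_maximalFunction hf).pow_const (1 / 2 : ℝ)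
  have hbase : ∫⁻ x, rieszMax m (stopped m f r N) x ^ (1 / 2 : ℝ) ∂haar m
      ≤ ENNReal.ofReal (120 * b ^ 5) ^ (1 / 2 : ℝ) * A := by
    calc _ ≤ ∫⁻ x, ENNReal.ofReal (120 * b ^ 5 * r) ^ (1 / 2 : ℝ) ∂haar m :=
          lintegral_mono fun x => ENNReal.rpow_le_rpow
            (rieszMax_le_of_norm_le hm hb (norm_stopped_le h0 N) x) (by norm_num)
      _ = _ := by
          rw [lintegral_const, measure_univ, mul_one, ENNReal.ofReal_mul (by positivity),
            ENNReal.mul_rpow_of_nonneg _ _ (by norm_num)]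
  have hstep : ∀ k ∈ Finset.range P, ∫⁻ x, rieszMax m (fun t =>
      stopped m f (4 ^ (k + 1) * r) N t - stopped m f (4 ^ k * r) N t) x ^ (1 / 2 : ℝ) ∂haar m
      ≤ atomConst b * 3 * b * ∫⁻ x, (Set.Ioi (2 ^ k * A)).indicator
        (fun _ => 2 ^ k * A) (maximalFunction m f x ^ (1 / 2 : ℝ)) ∂haar m := by
    intro k _
    have h1 : 4 ^ k * r ≤ 4 ^ (k + 1) * r := by
      rw [pow_succ]; nlinarith [hle k]
    refine (lintegral_rpow_rieszMax_stopped_sub_le hm hb hf hmart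
      (fun x => (h0 x).trans (hle k)) h1 N).trans ?_
    -- The sum is `5 · 4^k r`, bounded by `9 · 4^k r` so that the square root is rational.
    have h2 : ENNReal.ofReal (4 ^ (k + 1) * r + 4 ^ k * r) ^ (1 / 2 : ℝ) ≤ 3 * (2 ^ k * A) := by
      have h9 : (3 : ℝ≥0∞) = ENNReal.ofReal (3 ^ 2) ^ (1 / 2 : ℝ) := by
        rw [ofReal_sq_rpow_half (by norm_num)]
        simp
      rw [← hpow, h9, ← ENNReal.mul_rpow_of_nonneg _ _ (by norm_num),
        ← ENNReal.ofReal_mul (by norm_num)]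
      refine ENNReal.rpow_le_rpow (ENNReal.ofReal_le_ofReal ?_) (by norm_num)
      rw [pow_succ]
      nlinarith [hle k]
    have h3 : ∫⁻ x, (Set.Ioi (2 ^ k * A)).indicator
        (fun _ => 2 ^ k * A) (maximalFunction m f x ^ (1 / 2 : ℝ)) ∂haar m
        = 2 ^ k * A * haar m {x | 2 ^ k * A < maximalFunction m f x ^ (1 / 2 : ℝ)} :=
      lintegral_indicator_const (hmaxm measurableSet_Ioi) _
    rw [hset, h3]
    calc _ ≤ atomConst b * (3 * (2 ^ k * A))
          * (b * haar m {x | 2 ^ k * A < maximalFunction m f x ^ (1 / 2 : ℝ)}) := by gcongr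
      _ = _ := by ring
  rw [htel]
  refine (lintegral_rpow_rieszMax_add_le hm (hi r) (integrable_finsetSum _
    fun k _ => (hi _).sub (hi _))).trans (add_le_add hbase ?_)
  refine (lintegral_rpow_rieszMax_sum_le hm _ fun k _ => (hi _).sub (hi _)).trans ?_
  refine (Finset.sum_le_sum hstep).trans ?_
  rw [← Finset.mul_sum, ← lintegral_finsetSum]
  · gcongr
    rw [← lintegral_const_mul _ hmaxm]
    exact lintegral_mono fun x => sum_two_pow_indicator_le A _ P
  · exact fun k _ => (measurable_const.indicator measurableSet_Ioi).comp hmaxm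

/-- The constant in the `H_{1/2}` estimate. -/
noncomputable def hardyConst (b : ℕ) : ℝ≥0∞ :=
  ENNReal.ofReal (120 * b ^ 5) ^ (1 / 2 : ℝ) + atomConst b * 3 * b * 2

theorem hardyConst_ne_top (b : ℕ) : hardyConst b ≠ ∞ := by
  refine ENNReal.add_ne_top.2
    ⟨ENNReal.rpow_ne_top_of_nonneg (by norm_num) ENNReal.ofReal_ne_top, ?_⟩
  exact ENNReal.mul_ne_top (ENNReal.mul_ne_top (ENNReal.mul_ne_top (atomConst_ne_top b) (by simp))
    (ENNReal.natCast_ne_top b)) (by simp)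

/-- The starting level must be positive and at least `|f 0|`, a constant possibly zero. It is taken
as `|f 0| + δ²`, whose square root costs at most an extra `δ`, and `δ` tends to zero. -/
theorem lintegral_rpow_rieszMax_le (hm : ∀ k, 2 ≤ m k) {b : ℕ} (hb : ∀ k, m k ≤ b)
    (hf : ∀ n, DependsOnFirst m n (f n))
    (hmart : ∀ n, ∀ S, DependsOnFirst m n (· ∈ S) →
      ∫ x in S, f n x ∂haar m = ∫ x in S, f (n + 1) x ∂haar m) (N : ℕ) :
    ∫⁻ x, rieszMax m (f N) x ^ (1 / 2 : ℝ) ∂haar m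
      ≤ hardyConst b * ∫⁻ x, maximalFunction m f x ^ (1 / 2 : ℝ) ∂haar m := by
  set H := ∫⁻ x, maximalFunction m f x ^ (1 / 2 : ℝ) ∂haar m with hH
  set c := ENNReal.ofReal (120 * b ^ 5) ^ (1 / 2 : ℝ) with hc
  have hct : c ≠ ∞ := ENNReal.rpow_ne_top_of_nonneg (by norm_num) ENNReal.ofReal_ne_top
  have hconst : ∀ x, f 0 x = f 0 0 := fun x => hf 0 0 x fun j hj => absurd hj (Nat.not_lt_zero j)
  have hH0 : ENNReal.ofReal ‖f 0 0‖ ^ (1 / 2 : ℝ) ≤ H := by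
    calc _ = ∫⁻ _, ENNReal.ofReal ‖f 0 0‖ ^ (1 / 2 : ℝ) ∂haar m := by simp
      _ ≤ H := by
        refine lintegral_mono fun x => ENNReal.rpow_le_rpow ?_ (by norm_num)
        rw [← hconst x, ofReal_norm]
        exact le_iSup (fun n => ‖f n x‖ₑ) 0
  have key : ∀ δ : ℝ, 0 < δ → ∫⁻ x, rieszMax m (f N) x ^ (1 / 2 : ℝ) ∂haar m
      ≤ hardyConst b * H + c * ENNReal.ofReal δ := by
    intro δ hδ
    refine (lintegral_rpow_rieszMax_le_add hm hb hf hmart (r := ‖f 0 0‖ + δ ^ 2) (by positivity)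
      (fun x => by rw [hconst x]; exact le_add_of_nonneg_right (sq_nonneg δ)) N).trans ?_
    have h1 : ENNReal.ofReal (‖f 0 0‖ + δ ^ 2) ^ (1 / 2 : ℝ) ≤ H + ENNReal.ofReal δ := by
      rw [ENNReal.ofReal_add (norm_nonneg _) (sq_nonneg _)]
      refine (ENNReal.rpow_add_le_add_rpow _ _ (by norm_num) (by norm_num)).trans ?_
      rw [ofReal_sq_rpow_half hδ.le]
      exact add_le_add hH0 le_rfl
    calc _ ≤ c * (H + ENNReal.ofReal δ) + atomConst b * 3 * b * (2 * H) := by gcongr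
      _ = _ := by rw [hardyConst, ← hc]; ring
  have hlim : Tendsto (fun δ : ℝ => hardyConst b * H + c * ENNReal.ofReal δ)
      (nhdsWithin 0 (Set.Ioi 0)) (nhds (hardyConst b * H + c * 0)) := by
    refine tendsto_const_nhds.add (ENNReal.Tendsto.const_mul ?_ (Or.inr hct))
    rw [← ENNReal.ofReal_zero]
    exact (ENNReal.continuous_ofReal.tendsto 0).mono_left nhdsWithin_le_nhds
  rw [mul_zero, add_zero] at hlim
  exact ge_of_tendsto hlim (eventually_mem_nhdsWithin.mono fun δ hδ => key δ hδ)

/-! ### Fourier coefficients of martingales and the proof of part (a) -/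

theorem martingale_dependsOnFirst (hf : Martingale f (filtration m) (haar m)) (n : ℕ) :
    DependsOnFirst m n (f n) :=
  dependsOnFirst_of_measurable (hf.1 n).measurable

theorem martingale_setIntegral_succ (hf : Martingale f (filtration m) (haar m)) (n : ℕ)
    (S : Set (Gm m)) (hS : DependsOnFirst m n (· ∈ S)) :
    ∫ x in S, f n x ∂haar m = ∫ x in S, f (n + 1) x ∂haar m :=
  hf.setIntegral_eq (Nat.le_succ n) hS.measurableSet'

/-- For `i < M_N` the character depends on `N` coordinates only, so it is orthogonal to all later
martingale differences and the defining sequence is constant from `N` on. -/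
theorem vilenkinCoeff_eq (hf : Martingale f (filtration m) (haar m)) {i N : ℕ}
    (hi : i < M m N) :
    vilenkinCoeff m f i = ∫ x, f N x * (starRingEnd ℂ) (psi m i x) ∂haar m := by
  have hdep := martingale_dependsOnFirst hf
  have hpsi : DependsOnFirst m N fun x => (starRingEnd ℂ) (psi m i x) :=
    (dependsOnFirst_psi hi).comp _
  have hconst : ∀ k, N ≤ k → ∫ x, f k x * (starRingEnd ℂ) (psi m i x) ∂haar m
      = ∫ x, f N x * (starRingEnd ℂ) (psi m i x) ∂haar m := by
    intro k hk
    induction k, hk using Nat.le_induction with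
    | base => rfl
    | succ k hk ih =>
      rw [← ih, ← sub_eq_zero, ← integral_sub]
      · simp_rw [← sub_mul]
        refine integral_mul_eq_zero (n := k)
          ((hdep (k + 1)).integrable.sub (hdep k).integrable) (fun y => ?_) (hpsi.mono hk)
        rw [integral_sub (hdep (k + 1)).integrable.integrableOn (hdep k).integrable.integrableOn,
          martingale_setIntegral_succ hf k _ (dependsOnFirst_interval m k y), sub_self]
      · exact ((hdep (k + 1)).comp₂ (hpsi.mono (by omega)) (· * ·)).integrable
      · exact ((hdep k).comp₂ (hpsi.mono hk) (· * ·)).integrable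
  refine Tendsto.limUnder_eq (tendsto_const_nhds.congr' ?_)
  filter_upwards [eventually_ge_atTop N] with k hk
  exact (hconst k hk).symm

theorem partialSum_eq (hm : ∀ k, 2 ≤ m k) (hf : Martingale f (filtration m) (haar m)) {n N : ℕ}
    (hn : n ≤ M m N) (x : Gm m) :
    partialSum m n f x = ∫ t, f N t * dirichlet m n (x - t) ∂haar m := by
  have hdep := martingale_dependsOnFirst hf
  unfold partialSum dirichlet
  simp_rw [Finset.mul_sum]
  rw [integral_finsetSum]
  · refine Finset.sum_congr rfl fun k hk => ?_
    rw [vilenkinCoeff_eq hf ((Finset.mem_range.1 hk).trans_le hn), ← integral_mul_const]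
    congr 1
    ext t
    rw [psi_sub m hm]
    ring
  · intro k hk
    exact ((hdep N).comp₂ ((dependsOnFirst_psi ((Finset.mem_range.1 hk).trans_le hn)).shift x)
      (· * ·)).integrable

theorem rieszMean_eq (hm : ∀ k, 2 ≤ m k) (hf : Martingale f (filtration m) (haar m)) {n N : ℕ}
    (hn : n ≤ M m N) (x : Gm m) :
    rieszMean m n f x = (∑ k ∈ Finset.Icc 1 n, (1 : ℂ) / k)⁻¹ * rieszSum m n (f N) x := by
  rw [rieszMean, rieszSum_eq_sum n hm (martingale_dependsOnFirst hf N).integrable]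
  congr 1
  rw [Finset.sum_range_succ', Nat.cast_zero, div_zero, add_zero,
    Finset.range_eq_Ico, Finset.sum_Ico_add'
      (fun k => (∫ t, f N t * dirichlet m k (x - t) ∂haar m) / (k : ℂ)) 0 n 1]
  refine Finset.sum_congr (by ext k; simp) fun k hk => ?_
  rw [partialSum_eq hm hf]
  have := (Finset.mem_Ico.1 hk).2
  omega

theorem dependsOnFirst_rieszMean (hm : ∀ k, 2 ≤ m k) (n : ℕ) :
    DependsOnFirst m n (rieszMean m n f) := by
  have hS : ∀ k ∈ Finset.Icc 1 n, DependsOnFirst m n fun x => partialSum m k f x / k := by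
    intro k hk
    have h : DependsOnFirst m n (partialSum m k f) := DependsOnFirst.sum fun i hi =>
      (dependsOnFirst_psi (N := n) (((Finset.mem_range.1 hi).trans_le
        (Finset.mem_Icc.1 hk).2).trans (lt_M m hm n))).comp (vilenkinCoeff m f i * ·)
    exact h.comp (· / (k : ℂ))
  exact (DependsOnFirst.sum hS).comp ((∑ k ∈ Finset.Icc 1 n, (1 : ℂ) / k)⁻¹ * ·)

/-- For `n ≤ N < M_N` the mean `R_n f` is that of the function `f N`. The bound for `f N` is uniform
in `N`, so monotone convergence of the truncated suprema concludes. -/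
theorem isBounded_weightedRieszMax_log (hm : ∀ k, 2 ≤ m k) {b : ℕ} (hb : ∀ k, m k ≤ b) :
    IsBoundedHardyLp m (1 / 2)
      (weightedRieszMax m fun n : ℕ+ => Real.log (((n : ℕ) : ℝ) + 1)) := by
  refine ⟨(hardyConst b ^ 2).toNNReal, fun f ⟨hf, _⟩ => ?_⟩
  rw [ENNReal.coe_toNNReal (ENNReal.pow_ne_top (hardyConst_ne_top b))]
  set T := weightedRieszMax m (fun n : ℕ+ => Real.log (((n : ℕ) : ℝ) + 1)) f with hT
  let W : ℕ → Gm m → ℝ≥0∞ := fun N x => ⨆ n : ℕ+, ⨆ _ : (n : ℕ) ≤ N,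
    ‖rieszMean m n f x‖ₑ / ENNReal.ofReal (Real.log (((n : ℕ) : ℝ) + 1))
  have hWT : ∀ x, T x ^ (1 / 2 : ℝ) = ⨆ N, W N x ^ (1 / 2 : ℝ) := by
    intro x
    have h1 : T x = ⨆ N, W N x := by
      refine le_antisymm (iSup_le fun n => ?_) (iSup_le fun N => iSup₂_le fun n _ => ?_)
      · exact (le_iSup₂_of_le (f := fun (k : ℕ+) (_ : (k : ℕ) ≤ (n : ℕ)) =>
          ‖rieszMean m k f x‖ₑ / ENNReal.ofReal (Real.log (((k : ℕ) : ℝ) + 1))) n le_rfl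
          le_rfl).trans (le_iSup (fun N => W N x) (n : ℕ))
      · exact le_iSup (fun n : ℕ+ => ‖rieszMean m n f x‖ₑ
          / ENNReal.ofReal (Real.log (((n : ℕ) : ℝ) + 1))) n
    rw [h1]
    exact (ENNReal.orderIsoRpow (1 / 2) (by norm_num)).map_iSup _
  have hWmeas : ∀ N, Measurable (W N) := fun N =>
    Measurable.iSup fun n => Measurable.iSup fun _ => ((dependsOnFirst_rieszMean hm n).comp fun w =>
      ‖w‖ₑ / ENNReal.ofReal (Real.log (((n : ℕ) : ℝ) + 1))).measurable
  have hWmono : Monotone W := fun N N' h x =>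
    iSup₂_le fun n hn => le_iSup₂_of_le (f := fun (k : ℕ+) (_ : (k : ℕ) ≤ N') =>
          ‖rieszMean m k f x‖ₑ / ENNReal.ofReal (Real.log (((k : ℕ) : ℝ) + 1)))
          n (hn.trans h) le_rfl
  have hWle : ∀ N x, W N x ≤ rieszMax m (f N) x := fun N x => iSup₂_le fun n hn => by
    rw [rieszMean_eq hm hf (hn.trans (lt_M m hm N).le)]
    exact le_iSup (fun n : ℕ+ => ‖(∑ k ∈ Finset.Icc 1 (n : ℕ), (1 : ℂ) / k)⁻¹
      * rieszSum m n (f N) x‖ₑ / ENNReal.ofReal (Real.log (((n : ℕ) : ℝ) + 1))) n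
  have hmain : ∫⁻ x, T x ^ (1 / 2 : ℝ) ∂haar m
      ≤ hardyConst b * ∫⁻ x, maximalFunction m f x ^ (1 / 2 : ℝ) ∂haar m := by
    simp_rw [hWT]
    rw [lintegral_iSup (fun N => (hWmeas N).pow_const _)
      fun N N' h x => ENNReal.rpow_le_rpow (hWmono h x) (by norm_num)]
    refine iSup_le fun N => (lintegral_mono fun x =>
      ENNReal.rpow_le_rpow (hWle N x) (by norm_num)).trans ?_
    exact lintegral_rpow_rieszMax_le hm hb (martingale_dependsOnFirst hf)
      (martingale_setIntegral_succ hf) N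
  unfold hardyNorm lpQuasiNorm
  refine (ENNReal.rpow_le_rpow hmain (by norm_num)).trans (le_of_eq ?_)
  rw [ENNReal.mul_rpow_of_nonneg _ _ (by norm_num)]
  congr 1
  norm_num

end

/-! ### The test martingales and the proof of part (b) -/

/-- The points whose first nonzero coordinate is the one of index `s`, and is equal to `1`. -/
def firstOne (m : ℕ → ℕ) (s : ℕ) : Set (Gm m) := interval m (s + 1) (Function.update 0 s 1)

theorem firstOne_subset {m : ℕ → ℕ} (s : ℕ) : firstOne m s ⊆ interval m s 0 := fun x hx j hj => by
  rw [hx j (by omega), Function.update_of_ne hj.ne]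

theorem disjoint_firstOne {m : ℕ → ℕ} (hm : ∀ k, 2 ≤ m k) {s t : ℕ} (h : s < t) :
    Disjoint (firstOne m s) (firstOne m t) := by
  refine Set.disjoint_left.2 fun x hx hx' => ?_
  have : Fact (1 < m s) := ⟨hm s⟩
  have h1 := hx s (Nat.lt_succ_self s)
  have h2 := firstOne_subset t hx' s h
  rw [Function.update_self] at h1
  rw [h1] at h2
  exact one_ne_zero h2

theorem M_le_pow {m : ℕ → ℕ} {b : ℕ} (hb : ∀ k, m k ≤ b) (N : ℕ) : M m N ≤ b ^ N := by
  induction N with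
  | zero => simp [M]
  | succ N ih =>
    rw [M, pow_succ']
    exact Nat.mul_le_mul (hb N) ih

section
variable {m : ℕ → ℕ} [∀ k, NeZero (m k)]

theorem psi_apply_of_mem {n N : ℕ} (h : n < M m N) {x : Gm m} (hx : x ∈ interval m N 0) :
    psi m n x = 1 := by
  rw [psi_congr m h hx, psi_eq_prod m h]
  simp [rademacher]

theorem dirichlet_apply_of_mem {n N : ℕ} (h : n ≤ M m N) {x : Gm m} (hx : x ∈ interval m N 0) :
    dirichlet m n x = n := by
  rw [dirichlet, Finset.sum_congr rfl fun k hk =>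
    psi_apply_of_mem ((Finset.mem_range.1 hk).trans_le h) hx]
  simp

theorem setIntegral_rademacher (hm : ∀ k, 2 ≤ m k) (N : ℕ) :
    ∫ x in interval m N 0, rademacher m N x ∂haar m = 0 := by
  have hcover : interval m N (0 : Gm m)
      = ⋃ c : ZMod (m N), interval m (N + 1) (Function.update 0 N c) := by
    ext x
    simp only [Set.mem_iUnion]
    constructor
    · refine fun hx => ⟨x N, fun j hj => ?_⟩
      by_cases h : j = N
      · subst h; simp
      · rw [Function.update_of_ne h]
        exact hx j (by omega)
    · rintro ⟨c, hc⟩ j hj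
      rw [hc j (by omega), Function.update_of_ne hj.ne]
  have hdisj : Pairwise (Function.onFun Disjoint fun c : ZMod (m N) =>
      interval m (N + 1) (Function.update (0 : Gm m) N c)) := by
    intro c d hcd
    refine Set.disjoint_left.2 fun x hx hx' => hcd ?_
    have h1 := hx N (Nat.lt_succ_self N)
    have h2 := hx' N (Nat.lt_succ_self N)
    rw [Function.update_self] at h1 h2
    rw [← h1, ← h2]
  have hdep : DependsOnFirst m (N + 1) (rademacher m N) := fun x y hy => by
    rw [rademacher, rademacher, hy N (Nat.lt_succ_self N)]
  rw [hcover, integral_iUnion_fintype (fun c => measurableSet_interval m _ _) hdisj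
    fun c => hdep.integrable.integrableOn]
  have hc : ∀ c : ZMod (m N), ∫ x in interval m (N + 1) (Function.update 0 N c),
      rademacher m N x ∂haar m = (M m (N + 1) : ℝ)⁻¹ • ZMod.stdAddChar c := by
    intro c
    rw [setIntegral_congr_fun (g := fun _ => ZMod.stdAddChar c) (measurableSet_interval m _ _),
      setIntegral_const, haar_real_interval]
    intro x hx
    simp only
    rw [rademacher_eq, hx N (Nat.lt_succ_self N), Function.update_self, ZMod.stdAddChar_apply]
  simp_rw [hc]
  rw [← Finset.smul_sum]
  have : Fact (1 < m N) := ⟨hm N⟩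
  rw [AddChar.sum_eq_zero_of_ne_one, smul_zero]
  intro h
  have h1 : (1 : ZMod (m N)) = 0 := ZMod.injective_stdAddChar (by rw [h]; simp)
  exact one_ne_zero h1

/-- The terminal value of the test martingale: the character `ψ_{M_N}` on the interval
`I_N(0)`. -/
noncomputable def testFun (m : ℕ → ℕ) (N : ℕ) : Gm m → ℂ :=
  (interval m N 0).indicator (psi m (M m N))

/-- The test martingale. -/
noncomputable def testMartingale (m : ℕ → ℕ) (N n : ℕ) : Gm m → ℂ :=
  if n ≤ N then 0 else testFun m N

theorem psi_M (hm : ∀ k, 2 ≤ m k) (N : ℕ) (x : Gm m) : psi m (M m N) x = rademacher m N x := by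
  simpa using psi_mul_M m (j := 1) (hm N) x

theorem dependsOnFirst_testFun (hm : ∀ k, 2 ≤ m k) (N : ℕ) :
    DependsOnFirst m (N + 1) (testFun m N) := by
  refine ((dependsOnFirst_interval m N 0).mono (Nat.le_succ N)).indicator (dependsOnFirst_psi ?_)
  have h := two_pow_mul_M_le m hm N 1
  have h0 := M_pos m N
  change M m N < M m (N + 1)
  omega

theorem setIntegral_testFun (hm : ∀ k, 2 ≤ m k) {N : ℕ} {S : Set (Gm m)}
    (hS : DependsOnFirst m N (· ∈ S)) : ∫ x in S, testFun m N x ∂haar m = 0 := by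
  unfold testFun
  rw [setIntegral_indicator (measurableSet_interval m N 0)]
  rcases (S ∩ interval m N 0).eq_empty_or_nonempty with h | ⟨x, hx, hx0⟩
  · rw [h, setIntegral_empty]
  · have heq : S ∩ interval m N 0 = interval m N 0 :=
      Set.inter_eq_right.2 fun z hz => (hS x z (by rwa [interval_eq_of_mem hx0])).mpr hx
    simp_rw [heq, psi_M hm]
    exact setIntegral_rademacher hm N

theorem martingale_testMartingale (hm : ∀ k, 2 ≤ m k) (N : ℕ) :
    Martingale (testMartingale m N) (filtration m) (haar m) := by
  have hdep : ∀ n, DependsOnFirst m n (testMartingale m N n) := by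
    intro n
    unfold testMartingale
    split_ifs with h
    · exact fun _ _ _ => rfl
    · exact (dependsOnFirst_testFun hm N).mono (by omega)
  refine martingale_of_setIntegral_eq_succ (fun n => (hdep n).measurable'.stronglyMeasurable)
    (fun n => (hdep n).integrable) fun n S hS => ?_
  unfold testMartingale
  rcases lt_trichotomy n N with h | rfl | h
  · rw [if_pos h.le, if_pos (by omega)]
  · rw [if_pos le_rfl, if_neg (by omega),
      setIntegral_testFun hm (dependsOnFirst_of_measurableSet hS)]
    simp
  · rw [if_neg (by omega), if_neg (by omega)]

theorem maximalFunction_testMartingale_le (hm : ∀ k, 2 ≤ m k) (N : ℕ) (x : Gm m) :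
    maximalFunction m (testMartingale m N) x ≤ (interval m N 0).indicator (fun _ => 1) x := by
  refine iSup_le fun n => ?_
  unfold testMartingale
  split_ifs with h
  · simp
  · by_cases hx : x ∈ interval m N 0
    · rw [testFun, Set.indicator_of_mem hx, Set.indicator_of_mem hx, ← ofReal_norm, norm_psi m hm]
      simp
    · rw [testFun, Set.indicator_of_notMem hx]
      simp

theorem lintegral_rpow_maximalFunction_testMartingale_le (hm : ∀ k, 2 ≤ m k) (N : ℕ) :
    ∫⁻ x, maximalFunction m (testMartingale m N) x ^ (1 / 2 : ℝ) ∂haar m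
      ≤ (M m N : ℝ≥0∞)⁻¹ := by
  classical
  rw [← haar_interval N 0, ← lintegral_indicator_one (measurableSet_interval m N 0)]
  refine lintegral_mono fun x => (ENNReal.rpow_le_rpow
    (maximalFunction_testMartingale_le hm N x) (by norm_num)).trans (le_of_eq ?_)
  by_cases hx : x ∈ interval m N 0
  · simp [hx]
  · simp [hx]

theorem vilenkinCoeff_testMartingale (hm : ∀ k, 2 ≤ m k) {N i : ℕ} (hi : i < M m (N + 1)) :
    vilenkinCoeff m (testMartingale m N) i
      = ∫ x in interval m N 0, psi m (M m N) x * (starRingEnd ℂ) (psi m i x) ∂haar m := by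
  rw [vilenkinCoeff_eq (martingale_testMartingale hm N) hi, testMartingale, if_neg (by omega),
    ← integral_indicator (measurableSet_interval m N 0)]
  congr 1
  ext x
  by_cases hx : x ∈ interval m N 0 <;> simp [testFun, hx]

theorem vilenkinCoeff_testMartingale_low (hm : ∀ k, 2 ≤ m k) {N i : ℕ} (hi : i < M m N) :
    vilenkinCoeff m (testMartingale m N) i = 0 := by
  rw [vilenkinCoeff_testMartingale hm (hi.trans_le (M_mono m (Nat.le_succ N))),
    setIntegral_congr_fun (g := rademacher m N) (measurableSet_interval m N 0),
    setIntegral_rademacher hm]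
  intro x hx
  simp only
  rw [psi_apply_of_mem hi hx, map_one, mul_one, psi_M hm]

theorem vilenkinCoeff_testMartingale_add (hm : ∀ k, 2 ≤ m k) {N i : ℕ} (hi : i < M m N) :
    vilenkinCoeff m (testMartingale m N) (M m N + i) = (M m N : ℂ)⁻¹ := by
  have h2 := two_pow_mul_M_le m hm N 1
  rw [vilenkinCoeff_testMartingale hm (by omega),
    setIntegral_congr_fun (g := fun _ => 1) (measurableSet_interval m N 0),
    setIntegral_const, haar_real_interval]
  · simp
  intro x hx
  have h := psi_add m hm 1 hi x
  rw [one_mul] at h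
  simp only
  rw [h, psi_apply_of_mem hi hx, mul_one, Complex.mul_conj, Complex.normSq_eq_norm_sq,
    norm_psi m hm]
  simp

theorem partialSum_testMartingale_low (hm : ∀ k, 2 ≤ m k) {N n : ℕ} (hn : n ≤ M m N) (x : Gm m) :
    partialSum m n (testMartingale m N) x = 0 :=
  Finset.sum_eq_zero fun k hk => by
    rw [vilenkinCoeff_testMartingale_low hm ((Finset.mem_range.1 hk).trans_le hn), zero_mul]

/-- The coefficients vanish below `M_N` and equal `M_N⁻¹` on the next `M_N` indices, since every
`ψ_i` with `i < M_N` is 1 on `I_N(0)`. -/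
theorem partialSum_testMartingale_add (hm : ∀ k, 2 ≤ m k) {N i : ℕ} (hi : i ≤ M m N) (x : Gm m) :
    partialSum m (M m N + i) (testMartingale m N) x
      = (M m N : ℂ)⁻¹ * psi m (M m N) x * dirichlet m i x := by
  have h0 := partialSum_testMartingale_low hm (le_refl (M m N)) x
  rw [partialSum] at h0 ⊢
  rw [Finset.sum_range_add, h0, zero_add, dirichlet, Finset.mul_sum]
  refine Finset.sum_congr rfl fun k hk => ?_
  have hk' := (Finset.mem_range.1 hk).trans_le hi
  have h := psi_add m hm 1 hk' x
  rw [one_mul] at h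
  rw [vilenkinCoeff_testMartingale_add hm hk', h, mul_assoc]

/-- On `I_s(0)` the kernels `D_i`, `i ≤ M_s`, equal `i`, so all nonzero terms have the common phase
`ψ_{M_N}` and nothing cancels. The sum of `i / (M_N + i)` is at least `M_s² / (4 M_N)`; the bound
`l_n ≤ 3 log(n + 1)` accounts for the rest of the 12. -/
theorem le_norm_rieszMean_testMartingale (hm : ∀ k, 2 ≤ m k) {N s : ℕ} (hs : s ≤ N) {x : Gm m}
    (hx : x ∈ interval m s 0) :
    (M m s : ℝ) ^ 2 / (12 * M m N ^ 2 * Real.log ((M m (N + 1) : ℝ) + 1))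
      ≤ ‖rieszMean m (M m N + M m s) (testMartingale m N) x‖ := by
  have hMN : (0 : ℝ) < M m N := by exact_mod_cast M_pos m N
  have hsN := M_mono m hs
  have hsN' : (M m s : ℝ) ≤ M m N := by exact_mod_cast hsN
  have h2 := two_pow_mul_M_le m hm N 1
  set n := M m N + M m s with hn
  have hnle : n ≤ M m (N + 1) := by omega
  have hn1 : 1 ≤ n := by have := M_pos m N; omega
  have hsum : ∑ k ∈ Finset.Icc 1 n, partialSum m k (testMartingale m N) x / k
      = (M m N : ℂ)⁻¹ * psi m (M m N) x
        * ((∑ i ∈ Finset.range (M m s + 1), (i : ℝ) / (M m N + i) : ℝ) : ℂ) := by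
    have e1 : ∑ k ∈ Finset.Icc 1 n, partialSum m k (testMartingale m N) x / k
        = ∑ k ∈ Finset.range (n + 1), partialSum m k (testMartingale m N) x / k := by
      rw [Finset.sum_range_succ', Nat.cast_zero, div_zero, add_zero, Finset.range_eq_Ico,
        Finset.sum_Ico_add' (fun k => partialSum m k (testMartingale m N) x / (k : ℂ)) 0 n 1]
      exact Finset.sum_congr (by ext k; simp) fun _ _ => rfl
    rw [e1, hn, add_assoc, Finset.sum_range_add, Finset.sum_eq_zero fun k hk => ?_, zero_add]
    · push_cast
      rw [Finset.mul_sum]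
      refine Finset.sum_congr rfl fun i hi => ?_
      have hi' := Nat.lt_succ_iff.1 (Finset.mem_range.1 hi)
      rw [partialSum_testMartingale_add hm (hi'.trans hsN), dirichlet_apply_of_mem hi' hx,
        mul_div_assoc]
    · rw [partialSum_testMartingale_low hm (Finset.mem_range.1 hk).le, zero_div]
  have hlow : (M m s : ℝ) ^ 2 / (4 * M m N)
      ≤ ∑ i ∈ Finset.range (M m s + 1), (i : ℝ) / (M m N + i) := by
    calc (M m s : ℝ) ^ 2 / (4 * M m N)
        ≤ ∑ i ∈ Finset.range (M m s + 1), (i : ℝ) / (2 * M m N) := by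
          rw [← Finset.sum_div]
          have hg : (∑ i ∈ Finset.range (M m s + 1), (i : ℝ)) * 2 = (M m s + 1) * M m s := by
            have h := Finset.sum_range_id_mul_two (M m s + 1)
            rw [Nat.add_sub_cancel] at h
            rw [← Nat.cast_sum]
            exact_mod_cast h
          rw [div_le_div_iff₀ (by positivity) (by positivity)]
          nlinarith [(Nat.cast_nonneg (M m s) : (0 : ℝ) ≤ M m s)]
      _ ≤ _ := by
          refine Finset.sum_le_sum fun i hi => ?_
          have hi' : (i : ℝ) ≤ M m s := by
            exact_mod_cast Nat.lt_succ_iff.1 (Finset.mem_range.1 hi)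
          refine div_le_div_of_nonneg_left (Nat.cast_nonneg i) (by positivity) (by linarith)
  have hl := sum_inv_le_log hn1
  have hl0 : 0 < ∑ i ∈ Finset.range n, 1 / ((i : ℝ) + 1) :=
    Finset.sum_pos (fun _ _ => by positivity) ⟨0, Finset.mem_range.2 hn1⟩
  have hlog : Real.log ((n : ℝ) + 1) ≤ Real.log ((M m (N + 1) : ℝ) + 1) :=
    Real.log_le_log (by positivity) (by
      have : (n : ℝ) ≤ M m (N + 1) := by exact_mod_cast hnle
      linarith)
  rw [rieszMean, hsum, sum_Icc_one_div, norm_mul, norm_mul, norm_mul, norm_inv, norm_inv,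
    norm_psi m hm, Complex.norm_real, Complex.norm_real, Complex.norm_natCast, Real.norm_eq_abs,
    Real.norm_eq_abs, abs_of_pos hl0, abs_of_nonneg (le_trans (by positivity) hlow), mul_one]
  have hlg0 : 0 < Real.log ((M m (N + 1) : ℝ) + 1) := by linarith
  calc _ = (3 * Real.log ((M m (N + 1) : ℝ) + 1))⁻¹
        * ((M m N : ℝ)⁻¹ * ((M m s : ℝ) ^ 2 / (4 * M m N))) := by
        field_simp
        ring
    _ ≤ _ := by
        gcongr
        linarith

/-- The lower bound `M_s / (M_N D)` on `firstOne m s`, of measure `1 / M_{s+1} ≥ 1 / (b M_s)`,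
contributes an amount independent of `s`. Disjointness over `s < N` yields the factor `N`. -/
theorem le_lintegral_rpow_weightedRieszMax_testMartingale (hm : ∀ k, 2 ≤ m k) {b : ℕ}
    (hb : ∀ k, m k ≤ b) {φ : ℕ+ → ℝ} (hφ1 : ∀ n, 1 ≤ φ n) (hφ : Monotone φ) (N : ℕ) (q : ℕ+)
    (hq : (q : ℕ) = M m (N + 1)) :
    ENNReal.ofReal (N / (b * M m N * √(12 * Real.log ((q : ℝ) + 1) * φ q)))
      ≤ ∫⁻ x, weightedRieszMax m φ (testMartingale m N) x ^ (1 / 2 : ℝ) ∂haar m := by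
  have hMN : (0 : ℝ) < M m N := by exact_mod_cast M_pos m N
  have hb0 : (0 : ℝ) < b := by exact_mod_cast (by linarith [hm 0, hb 0] : 0 < b)
  have hlg := half_le_log_succ (n := (q : ℕ)) q.pos
  set lg := Real.log ((q : ℝ) + 1) with hlgdef
  have hlg0 : 0 < lg := by linarith
  have hφq : 0 < φ q := zero_lt_one.trans_le (hφ1 q)
  set D := √(12 * lg * φ q) with hD
  have hD0 : 0 < D := Real.sqrt_pos.2 (by positivity)
  have hDsq : D ^ 2 = 12 * lg * φ q := Real.sq_sqrt (by positivity)
  have hpt : ∀ s ∈ Finset.range N, ∀ x ∈ firstOne m s, ENNReal.ofReal (M m s / (M m N * D))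
      ≤ weightedRieszMax m φ (testMartingale m N) x ^ (1 / 2 : ℝ) := by
    intro s hs x hx
    have hs' := (Finset.mem_range.1 hs).le
    have h1 := le_norm_rieszMean_testMartingale hm hs' (firstOne_subset s hx)
    have h2 := two_pow_mul_M_le m hm N 1
    have h3 := M_mono m hs'
    let n : ℕ+ := ⟨M m N + M m s, by have := M_pos m N; omega⟩
    -- One index `q` serves all `s`: monotonicity bounds the weight at `M_N + M_s` by `φ q`.
    have hnq : n ≤ q := by
      rw [← PNat.coe_le_coe, hq]
      change M m N + M m s ≤ _
      omega
    rw [← ofReal_sq_rpow_half (by positivity)]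
    refine ENNReal.rpow_le_rpow (le_trans ?_ (le_iSup (fun n : ℕ+ =>
      ‖rieszMean m n (testMartingale m N) x‖ₑ / ENNReal.ofReal (φ n)) n)) (by norm_num)
    have hφn : 0 < φ n := zero_lt_one.trans_le (hφ1 n)
    rw [← ofReal_norm, ← ENNReal.ofReal_div_of_pos hφn]
    refine ENNReal.ofReal_le_ofReal ?_
    rw [le_div_iff₀ hφn]
    refine le_trans ?_ h1
    rw [← hq, ← hlgdef, div_pow, mul_pow, hDsq]
    calc _ ≤ (M m s : ℝ) ^ 2 / (M m N ^ 2 * (12 * lg * φ q)) * φ q := by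
          gcongr
          exact hφ hnq
      _ = _ := by field_simp
  have hmeas : ∀ s, MeasurableSet (firstOne m s) := fun s => measurableSet_interval m _ _
  have hdisj : Set.PairwiseDisjoint (↑(Finset.range N)) (firstOne m) := by
    intro s _ t _ hst
    rcases lt_or_gt_of_ne hst with h | h
    · exact disjoint_firstOne hm h
    · exact (disjoint_firstOne hm h).symm
  calc ENNReal.ofReal (N / (b * M m N * D))
      = ∑ s ∈ Finset.range N, ENNReal.ofReal (1 / (b * M m N * D)) := by
        rw [Finset.sum_const, Finset.card_range, nsmul_eq_mul, ← ENNReal.ofReal_natCast,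
          ← ENNReal.ofReal_mul (Nat.cast_nonneg _), mul_one_div]
    _ ≤ ∑ s ∈ Finset.range N, ENNReal.ofReal (M m s / (M m N * D)) * haar m (firstOne m s) := by
        refine Finset.sum_le_sum fun s _ => ?_
        have hMs : (0 : ℝ) < M m s := by exact_mod_cast M_pos m s
        have hMs1 : (0 : ℝ) < M m (s + 1) := by exact_mod_cast M_pos m (s + 1)
        have hle : (M m (s + 1) : ℝ) ≤ b * M m s := by
          exact_mod_cast Nat.mul_le_mul_right (M m s) (hb s)
        rw [firstOne, haar_interval, ← ENNReal.ofReal_natCast, ← ENNReal.ofReal_inv_of_pos hMs1,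
          ← ENNReal.ofReal_mul (by positivity)]
        refine ENNReal.ofReal_le_ofReal ?_
        rw [← div_eq_mul_inv, div_div, div_le_div_iff₀ (by positivity) (by positivity)]
        nlinarith [mul_le_mul_of_nonneg_right hle (mul_pos hMN hD0).le]
    _ ≤ ∑ s ∈ Finset.range N, ∫⁻ x in firstOne m s,
        weightedRieszMax m φ (testMartingale m N) x ^ (1 / 2 : ℝ) ∂haar m := by
        refine Finset.sum_le_sum fun s hs => ?_
        rw [← setLIntegral_const]
        exact setLIntegral_mono' (hmeas s) (hpt s hs)
    _ = ∫⁻ x in ⋃ s ∈ Finset.range N, firstOne m s,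
        weightedRieszMax m φ (testMartingale m N) x ^ (1 / 2 : ℝ) ∂haar m :=
        (lintegral_biUnion_finset hdisj (fun s _ => hmeas s) _).symm
    _ ≤ _ := setLIntegral_le_lintegral _ _

theorem sq_le_of_isBounded (hm : ∀ k, 2 ≤ m k) {b : ℕ}
    (hb : ∀ k, m k ≤ b) {φ : ℕ+ → ℝ} (hφ1 : ∀ n, 1 ≤ φ n) (hφ : Monotone φ) {C : ℝ≥0}
    (hC : ∀ f : ℕ → Gm m → ℂ, MemHardy m (1 / 2) f →
      lpQuasiNorm m (1 / 2) (weightedRieszMax m φ f) ≤ C * hardyNorm m (1 / 2) f)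
    (N : ℕ) (q : ℕ+) (hq : (q : ℕ) = M m (N + 1)) :
    (N : ℝ) ^ 2 ≤ 12 * b ^ 2 * C * Real.log ((q : ℝ) + 1) * φ q := by
  have hMN : (0 : ℝ) < M m N := by exact_mod_cast M_pos m N
  have hb0 : (0 : ℝ) < b := by exact_mod_cast (by linarith [hm 0, hb 0] : 0 < b)
  have hlg := half_le_log_succ (n := (q : ℕ)) q.pos
  have hφq : 0 < φ q := zero_lt_one.trans_le (hφ1 q)
  have hlow := le_lintegral_rpow_weightedRieszMax_testMartingale hm hb hφ1 hφ N q hq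
  set lg := Real.log ((q : ℝ) + 1) with hlgdef
  have hlg0 : 0 < lg := by linarith
  have hD0 : 0 < √(12 * lg * φ q) := Real.sqrt_pos.2 (by positivity)
  have hDsq : √(12 * lg * φ q) ^ 2 = 12 * lg * φ q := Real.sq_sqrt (by positivity)
  set D := √(12 * lg * φ q) with hD
  have htwo : (1 / (1 / 2) : ℝ) = ((2 : ℕ) : ℝ) := by norm_num
  have hH : hardyNorm m (1 / 2) (testMartingale m N) ≤ ENNReal.ofReal (((M m N : ℝ)⁻¹) ^ 2) := by
    rw [hardyNorm, lpQuasiNorm, htwo, ENNReal.rpow_natCast, ENNReal.ofReal_pow (by positivity),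
      ENNReal.ofReal_inv_of_pos hMN, ENNReal.ofReal_natCast]
    gcongr
    exact lintegral_rpow_maximalFunction_testMartingale_le hm N
  have h := hC _ ⟨martingale_testMartingale hm N, hH.trans_lt ENNReal.ofReal_lt_top⟩
  rw [lpQuasiNorm, htwo, ENNReal.rpow_natCast] at h
  have h1 : ENNReal.ofReal ((N / (b * M m N * D)) ^ 2)
      ≤ ENNReal.ofReal (C * ((M m N : ℝ)⁻¹) ^ 2) := by
    rw [ENNReal.ofReal_pow (by positivity), ENNReal.ofReal_mul C.coe_nonneg,
      ENNReal.ofReal_coe_nnreal]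
    exact (pow_le_pow_left' hlow 2).trans (h.trans (by gcongr))
  rw [ENNReal.ofReal_le_ofReal_iff (by positivity), div_pow, mul_pow, mul_pow, hDsq,
    div_le_iff₀ (by positivity)] at h1
  refine h1.trans (le_of_eq ?_)
  field_simp

theorem not_isBounded_weightedRieszMax (hm : ∀ k, 2 ≤ m k) {b : ℕ} (hb : ∀ k, m k ≤ b)
    {φ : ℕ+ → ℝ} (hφ1 : ∀ n, 1 ≤ φ n) (hφ : Monotone φ)
    (hlim : limsup (fun n : ℕ+ => ((Real.log (((n : ℕ) : ℝ) + 1) / φ n : ℝ) : EReal)) atTop = ⊤) :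
    ¬ IsBoundedHardyLp m (1 / 2) (weightedRieszMax m φ) := by
  rintro ⟨C, hC⟩
  have hb2 : (2 : ℝ) ≤ b := by exact_mod_cast (hm 0).trans (hb 0)
  have hlb : 0 < Real.log b := Real.log_pos (by linarith)
  have hlogM : ∀ N, Real.log (M m N) ≤ N * Real.log b := fun N => by
    rw [← Real.log_pow]
    exact Real.log_le_log (by exact_mod_cast M_pos m N) (by exact_mod_cast M_le_pow hb N)
  have hlogn : ∀ {n N : ℕ}, n < M m N → Real.log ((n : ℝ) + 1) ≤ N * Real.log b :=
    fun {n N} h => (Real.log_le_log (by positivity) (by exact_mod_cast h)).trans (hlogM N)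
  have hpow : ∀ N : ℕ, 1 ≤ N → ∀ q : ℕ+, (q : ℕ) = M m (N + 1) →
      (N : ℝ) ≤ 36 * b ^ 2 * C * Real.log b * φ q := by
    intro N hN q hq
    have h1 := sq_le_of_isBounded hm hb hφ1 hφ hC N q hq
    have hN' : (1 : ℝ) ≤ N := by exact_mod_cast hN
    have hqM : (q : ℕ) < M m (N + 2) := by
      have h2 := two_pow_mul_M_le m hm (N + 1) 1
      have h3 := M_pos m (N + 1)
      rw [hq]
      change M m (N + 1) < M m (N + 1 + 1)
      omega
    have h2 := hlogn hqM
    have h3 : Real.log ((q : ℝ) + 1) ≤ 3 * N * Real.log b := by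
      refine h2.trans ?_
      push_cast
      nlinarith
    have hφq : 0 < φ q := zero_lt_one.trans_le (hφ1 q)
    have h4 : (N : ℝ) ^ 2 ≤ N * (36 * b ^ 2 * C * Real.log b * φ q) :=
      calc (N : ℝ) ^ 2 ≤ 12 * b ^ 2 * C * Real.log ((q : ℝ) + 1) * φ q := h1
        _ ≤ 12 * b ^ 2 * C * (3 * N * Real.log b) * φ q := by gcongr
        _ = _ := by ring
    rw [pow_two] at h4
    exact le_of_mul_le_mul_left h4 (by linarith)
  -- The first summand covers `n < M_2`, where `φ ≥ 1` suffices. The second covers `M_{N+1} ≤ n <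
  -- M_{N+2}` with `N ≥ 1`, its factor 3 coming from `N + 2 ≤ 3 N`.
  set K : ℝ := 2 * Real.log b + 3 * Real.log b * (36 * b ^ 2 * C * Real.log b) with hK
  have hbound : ∀ n : ℕ+, Real.log (((n : ℕ) : ℝ) + 1) / φ n ≤ K := by
    intro n
    have hφn : 0 < φ n := zero_lt_one.trans_le (hφ1 n)
    rw [div_le_iff₀ hφn]
    have hE0 : 0 ≤ 3 * Real.log b * (36 * b ^ 2 * C * Real.log b) := by positivity
    by_cases hn : (n : ℕ) < M m 2
    · have h1 := hlogn hn
      push_cast at h1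
      nlinarith [hφ1 n]
    · classical
      have hex : ∃ N, (n : ℕ) < M m N := ⟨n, lt_M m hm n⟩
      have hfind : 2 < Nat.find hex := by
        by_contra hcon
        exact hn ((Nat.find_spec hex).trans_le (M_mono m (not_lt.1 hcon)))
      obtain ⟨N, hN⟩ : ∃ N, Nat.find hex = N + 2 := ⟨Nat.find hex - 2, by omega⟩
      have h1 : (n : ℕ) < M m (N + 2) := hN ▸ Nat.find_spec hex
      have h2 : M m (N + 1) ≤ n := not_lt.1 (Nat.find_min hex (by omega))
      have hN1 : 1 ≤ N := by omega
      have hN' : (1 : ℝ) ≤ N := by exact_mod_cast hN1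
      have h3 := hlogn h1
      obtain ⟨q, hq⟩ : ∃ q : ℕ+, (q : ℕ) = M m (N + 1) := ⟨⟨M m (N + 1), M_pos m _⟩, rfl⟩
      have h4 := hpow N hN1 q hq
      have h5 : φ q ≤ φ n := hφ (PNat.coe_le_coe _ _ |>.1 (hq ▸ h2))
      have h6 : (N : ℝ) ≤ 36 * b ^ 2 * C * Real.log b * φ n :=
        h4.trans (mul_le_mul_of_nonneg_left h5 (by positivity))
      calc Real.log (((n : ℕ) : ℝ) + 1) ≤ (N + 2 : ℕ) * Real.log b := h3
        _ ≤ 3 * Real.log b * N := by push_cast; nlinarith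
        _ ≤ 3 * Real.log b * (36 * b ^ 2 * C * Real.log b * φ n) := by gcongr
        _ ≤ K * φ n := by
          rw [hK]
          nlinarith [mul_pos hlb hφn]
  have hle : limsup (fun n : ℕ+ => ((Real.log (((n : ℕ) : ℝ) + 1) / φ n : ℝ) : EReal)) atTop
      ≤ (K : EReal) :=
    limsup_le_of_le (by isBoundedDefault)
      (Eventually.of_forall fun n => EReal.coe_le_coe_iff.2 (hbound n))
  rw [hlim, top_le_iff] at hle
  exact EReal.coe_ne_top K hle

end

end Vilenkin

theorem theorem2 (m : ℕ → ℕ) [∀ k, NeZero (m k)] (hm : ∀ k, 2 ≤ m k)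
    (hbdd : BddAbove (Set.range m)) :
    Vilenkin.IsBoundedHardyLp m (1 / 2)
        (Vilenkin.weightedRieszMax m fun n : ℕ+ => Real.log (((n : ℕ) : ℝ) + 1)) ∧
      ∀ φ : ℕ+ → ℝ, (∀ n, 1 ≤ φ n) → Monotone φ →
        Filter.limsup (fun n : ℕ+ => ((Real.log (((n : ℕ) : ℝ) + 1) / φ n : ℝ) : EReal))
          Filter.atTop = ⊤ →
        ¬ Vilenkin.IsBoundedHardyLp m (1 / 2) (Vilenkin.weightedRieszMax m φ) := by
  obtain ⟨b, hb⟩ := hbdd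
  have hb' : ∀ k, m k ≤ b := fun k => hb ⟨k, rfl⟩
  exact ⟨Vilenkin.isBounded_weightedRieszMax_log hm hb', fun φ hφ1 hφ hlim =>
    Vilenkin.not_isBounded_weightedRieszMax hm hb' hφ1 hφ hlim⟩
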